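/- **Theorem 4.3.** Let $a\neq 0$ be a vector of the Euclidean plane and let $C=\mathbb{R}^2/\mathbb{Z}a$ be the flat cylinder, with the quotient distance. A *segment* is the minimal geodesic joining two different points of $C$ between which the minimal geodesic is unique. Let $S\subset C$ be a finite set of points. A set of *non-crossing segments* on $S$ is a set of segments with both ends in $S$, such that no segment contains a point of $S$ other than its ends and any two of the segments meet only at common ends. The *regions* of such a set are the connected components of the complement in $C$ of the points of $S$ and of the segments. A *triangulation* of $S$ is a maximal set $T$ of non-crossing segments on $S$ such that each bounded region is triangular, that is, it is the projection of the interior of a non-degenerate planar triangle whose three sides project to segments of $T$. A *flip* takes two triangles $ABC$ and $ABD$ of a triangulation (represented in the plane) that share the side $AB$ and form a strictly convex quadrangle whose other diagonal $CD$ also projects to a segment, and replaces $AB$ by $CD$. The *flip graph* of $S$ has the triangulations of $S$ as nodes, two different ones being adjacent if one arises from the other by a flip. The *upper* (respectively *lower*) *boundary* of a triangulation $T$ is the set of the segments of $T$ contained in the frontier of the region that is unbounded upwards (respectively downwards) along the axis of the cylinder. If $S$ is such that $T$ contains a closed polygonal line that wraps around the cylinder, these are the upper and lower essential polygonal lines bounding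 the triangulated region. Then, for any two triangulations $T_1$ and $T_2$ of $S$: $T_1$ can be transformed into $T_2$ by a finite sequence of flips if and only if $T_1$ and $T_2$ have the same upper boundary and the same lower boundary. In other words, the connected components of the flip graph of $S$ correspond exactly to the pairs of boundary chains of its triangulations. -/

import Mathlib

namespace FlatCylinder

/-- The flat cylinder `ℝ² / Γ`, where `Γ` is the group generated by the translation by the vector
`a ≠ 0`.  The plane is written as `ℂ` (with its Euclidean distance).  The distance on the quotient
is the least distance between representatives. -/
abbrev Cylinder (a : ℂ) : Type := ℂ ⧸ AddSubgroup.zmultiples a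

/-- The orbit of a point of the plane, as a point of the cylinder. -/
abbrev proj (a : ℂ) (A : ℂ) : Cylinder a := QuotientAddGroup.mk A

/-- The straight arc from `A` to `B` projects to the unique minimal geodesic between the orbits
of `A` and `B`: it is strictly shorter than the arc from `A` to any other point of the orbit
of `B`. -/
def IsShortest (a A B : ℂ) : Prop :=
  ∀ n : ℤ, n ≠ 0 → dist A B < dist A (B + n • a)

/-- The unordered pair of points of the cylinder represented by `A` and `B`. A segment, being the
unique minimal geodesic between its ends, is recorded by the pair of its ends. -/
abbrev edge (a A B : ℂ) : Sym2 (Cylinder a) := s(proj a A, proj a B)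

/-- Two different points of the cylinder that are joined by a segment. -/
def IsSegment (a : ℂ) (e : Sym2 (Cylinder a)) : Prop :=
  ∃ A B : ℂ, A ≠ B ∧ IsShortest a A B ∧ edge a A B = e

/-- The set of the points of the cylinder on a segment, ends included. -/
def carrier (a : ℂ) (e : Sym2 (Cylinder a)) : Set (Cylinder a) :=
  {x | ∃ A B : ℂ, IsShortest a A B ∧ edge a A B = e ∧ x ∈ proj a '' segment ℝ A B}

/-- `T` is a set of non-crossing segments on the point set `S`: each member is a segment with both
ends in `S` and with no further point of `S` on it, and two of them meet only at common ends. -/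
structure IsNonCrossing (a : ℂ) (S : Set (Cylinder a)) (T : Set (Sym2 (Cylinder a))) : Prop where
  isSegment : ∀ e ∈ T, IsSegment a e
  ends_mem : ∀ e ∈ T, ∀ p ∈ e, p ∈ S
  inter_points : ∀ e ∈ T, ∀ p ∈ carrier a e, p ∈ S → p ∈ e
  inter_segments : ∀ e ∈ T, ∀ f ∈ T, e ≠ f → ∀ p ∈ carrier a e, p ∈ carrier a f → p ∈ e ∧ p ∈ f

/-- The union of the points of `S` and of the segments of `T`. -/
def skeleton (a : ℂ) (S : Set (Cylinder a)) (T : Set (Sym2 (Cylinder a))) : Set (Cylinder a) :=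
  S ∪ ⋃ e ∈ T, carrier a e

/-- The region (connected component of the complement of the points and segments) that
contains `x`; it is empty if `x` is on the skeleton. -/
def region (a : ℂ) (S : Set (Cylinder a)) (T : Set (Sym2 (Cylinder a))) (x : Cylinder a) :
    Set (Cylinder a) :=
  connectedComponentIn (skeleton a S T)ᶜ x

/-- The open triangle on the cylinder that is represented by the planar triangle `A B C`. -/
def openTriangle (a A B C : ℂ) : Set (Cylinder a) :=
  proj a '' interior (convexHull ℝ {A, B, C})

/-- `A B C` represents a triangle of `T`: the three sides are segments of `T`, the triangle is not
degenerate, and its interior contains no point of `S` and of the segments of `T`. -/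
structure IsTriangle (a : ℂ) (S : Set (Cylinder a)) (T : Set (Sym2 (Cylinder a)))
    (A B C : ℂ) : Prop where
  affineIndependent : AffineIndependent ℝ ![A, B, C]
  shortest_AB : IsShortest a A B
  shortest_BC : IsShortest a B C
  shortest_CA : IsShortest a C A
  mem_AB : edge a A B ∈ T
  mem_BC : edge a B C ∈ T
  mem_CA : edge a C A ∈ T
  disjoint_skeleton : Disjoint (openTriangle a A B C) (skeleton a S T)

/-- A triangulation of the point set `S`: a maximal set of non-crossing segments such that each
bounded region is triangular. -/
structure IsTriangulation (a : ℂ) (S : Set (Cylinder a)) (T : Set (Sym2 (Cylinder a))) :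
    Prop where
  maximal : Maximal (IsNonCrossing a S) T
  triangular : ∀ x ∈ (skeleton a S T)ᶜ, Bornology.IsBounded (region a S T x) →
    ∃ A B C : ℂ, IsTriangle a S T A B C ∧ region a S T x = openTriangle a A B C

/-- The type of the triangulations of `S`. -/
abbrev Triangulation (a : ℂ) (S : Set (Cylinder a)) : Type :=
  {T : Set (Sym2 (Cylinder a)) // IsTriangulation a S T}

/-- `T'` arises from `T` by a flip: two triangles `A B C` and `A B D` of `T` that share the
segment `A B` form a (strictly) convex quadrangle, its other diagonal `C D` is a segment, and `A B`
is replaced by `C D`. -/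
def IsFlip (a : ℂ) (S : Set (Cylinder a)) (T T' : Set (Sym2 (Cylinder a))) : Prop :=
  ∃ A B C D : ℂ, IsTriangle a S T A B C ∧ IsTriangle a S T A B D ∧ IsShortest a C D ∧
    (openSegment ℝ A B ∩ openSegment ℝ C D).Nonempty ∧
    T' = (T \ {edge a A B}) ∪ {edge a C D}

/-- The graph of triangulations of `S`: two different triangulations are adjacent if one of them
arises from the other by a flip. -/
def flipGraph (a : ℂ) (S : Set (Cylinder a)) : SimpleGraph (Triangulation a S) :=
  SimpleGraph.fromRel fun T T' => IsFlip a S T.1 T'.1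

/-- The union of the regions that are unbounded upwards, `(z / a).im` being (in units of the length
of `a`) the height of `z` orthogonally to `a`. -/
def upperRegion (a : ℂ) (S : Set (Cylinder a)) (T : Set (Sym2 (Cylinder a))) :
    Set (Cylinder a) :=
  {x | ∀ M : ℝ, ∃ z : ℂ, proj a z ∈ region a S T x ∧ M < (z / a).im}

/-- The union of the regions that are unbounded downwards. -/
def lowerRegion (a : ℂ) (S : Set (Cylinder a)) (T : Set (Sym2 (Cylinder a))) :
    Set (Cylinder a) :=
  {x | ∀ M : ℝ, ∃ z : ℂ, proj a z ∈ region a S T x ∧ (z / a).im < M}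

/-- The upper boundary of the triangulated region: the segments of `T` along the boundary of the
region that is unbounded upwards. For points that are not in Euclidean position this is the upper
essential polygonal line that bounds the triangulated region. -/
def upperBoundary (a : ℂ) (S : Set (Cylinder a)) (T : Set (Sym2 (Cylinder a))) :
    Set (Sym2 (Cylinder a)) :=
  {e ∈ T | carrier a e ⊆ frontier (upperRegion a S T)}

/-- The lower boundary of the triangulated region: the segments of `T` along the boundary of the
region that is unbounded downwards. -/
def lowerBoundary (a : ℂ) (S : Set (Cylinder a)) (T : Set (Sym2 (Cylinder a))) :
    Set (Sym2 (Cylinder a)) :=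
  {e ∈ T | carrier a e ⊆ frontier (lowerRegion a S T)}

end FlatCylinder

/-! Necessity of equal boundaries: a flip changes nothing outside the open quadrangle formed by its
two triangles. A region that is unbounded upwards or downwards is not an open triangle, so it avoids
this quadrangle, and neither diagonal can lie on its frontier (`IsExchange.boundary_eq`).

Sufficiency follows Lawson's scheme of lowering a lifted surface. Each lift `z` of a point of `S`
gets a height `w z`, the sum of `hor a z ^ 2`, of a small multiple of the squared vertical
coordinate, and of a much smaller generic function of the orbit. A translation by `n • a` adds the
affine function `2 * n * hor a z + n ^ 2`, so comparisons of heights with affine interpolations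
descend to the cylinder. The horizontal square dominates because being a segment only means having
horizontal extent less than 1/2 (`isShortest_iff`). This choice has two effects. If exchanging
diagonals lowers the surface, the new diagonal is automatically a segment, so the flip is allowed
(`mul_lt_mul_of_nested`). Where two adjacent triangles form a straight or reflex angle, so that no
flip exists, the surface is automatically convex across their common side (`affine_sq`). The generic
term excludes ties.

There are finitely many triangulations and a lowering flip strictly lowers the surface, so every
triangulation can be flipped into one whose surface no exchange lowers
(`exists_reachable_isOptimal`). Such a surface is convex across every segment with triangles on both
sides (`IsOptimal.le_apex`). Let `T` and `T'` be optimal with equal boundaries. A segment of `T`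
cannot cross a boundary segment of `T'`, which also belongs to `T`; it crosses only inner segments
of `T'`, and convexity along it puts the surface of `T'` nowhere above the lifted segment at the
crossings (`IsOptimal.crosses_nonpos`). By symmetry the two heights agree at a crossing of a segment
of `T` with one of `T'`, contrary to genericity. Hence nothing crosses, and maximality gives `T =
T'`. -/

open Set Topology Filter

namespace FlatCylinder

/-! ### Triangles of the plane in barycentric coordinates -/

/-- The orientation (twice the signed area) of a planar triangle. -/
def ori (A B C : ℂ) : ℝ := (B - A).re * (C - A).im - (B - A).im * (C - A).re

lemma ori_swap (A B C : ℂ) : ori B A C = -ori A B C := by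
  simp only [ori, Complex.sub_re, Complex.sub_im]; ring

lemma ori_rotate (A B C : ℂ) : ori B C A = ori A B C := by
  simp only [ori, Complex.sub_re, Complex.sub_im]; ring

lemma ori_combination (A B P Q R : ℂ) {α β γ : ℝ} (h : α + β + γ = 1) :
    ori A B (α • P + β • Q + γ • R) = α * ori A B P + β * ori A B Q + γ * ori A B R := by
  obtain rfl : α = 1 - β - γ := by linarith
  simp only [ori, Complex.sub_re, Complex.sub_im, Complex.add_re, Complex.add_im,
    Complex.real_smul, Complex.re_ofReal_mul, Complex.im_ofReal_mul]
  ring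

lemma ori_left (A B : ℂ) : ori A B A = 0 := by simp [ori]

lemma ori_right (A B : ℂ) : ori A B B = 0 := by simp only [ori]; ring

lemma ori_add_right (A B C t : ℂ) : ori (A + t) (B + t) (C + t) = ori A B C := by
  simp [ori]

lemma ori_of_bary {A B C z : ℂ} {α β γ : ℝ} (h : α + β + γ = 1)
    (hz : z = α • A + β • B + γ • C) : ori A B z = γ * ori A B C := by
  rw [hz, ori_combination _ _ _ _ _ h, ori_left, ori_right]; ring

lemma exists_bary {A B C : ℂ} (h : ori A B C ≠ 0) (z : ℂ) :
    ∃ α β γ : ℝ, α + β + γ = 1 ∧ z = α • A + β • B + γ • C := by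
  refine ⟨ori B C z / ori A B C, ori C A z / ori A B C, ori A B z / ori A B C, ?_, ?_⟩
  · rw [← add_div, ← add_div, div_eq_one_iff_eq h]
    simp only [ori, Complex.sub_re, Complex.sub_im]; ring
  · apply Complex.ext
    all_goals
      simp only [Complex.add_re, Complex.add_im,
        Complex.real_smul, Complex.re_ofReal_mul, Complex.im_ofReal_mul]
      field_simp
      simp only [ori, Complex.sub_re, Complex.sub_im]
      ring

lemma bary_unique {A B C : ℂ} (h : ori A B C ≠ 0) {α β γ α' β' γ' : ℝ}
    (h1 : α + β + γ = 1) (h1' : α' + β' + γ' = 1)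
    (hz : α • A + β • B + γ • C = α' • A + β' • B + γ' • C) : α = α' ∧ β = β' ∧ γ = γ' := by
  have e1 : γ = γ' := by
    have := (ori_of_bary h1 rfl).symm.trans ((congrArg (ori A B) hz).trans (ori_of_bary h1' rfl))
    exact mul_right_cancel₀ h this
  have e2 : β = β' := by
    have hca : ori C A B ≠ 0 := by rwa [← ori_rotate]
    have k1 : γ + α + β = 1 := by linarith
    have k2 : γ' + α' + β' = 1 := by linarith
    have hz' : γ • C + α • A + β • B = γ' • C + α' • A + β' • B := by
      rw [add_assoc, add_comm, hz]; abel
    have := (ori_of_bary k1 rfl).symm.trans ((congrArg (ori C A) hz').trans (ori_of_bary k2 rfl))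
    exact mul_right_cancel₀ hca this
  exact ⟨by linarith, e2, e1⟩

lemma affineIndependent_iff_ori (A B C : ℂ) :
    AffineIndependent ℝ ![A, B, C] ↔ ori A B C ≠ 0 := by
  rw [affineIndependent_iff_linearIndependent_vsub ℝ _ (0 : Fin 3)]
  have : (fun i : {x : Fin 3 // x ≠ 0} => (![A, B, C] i -ᵥ ![A, B, C] 0 : ℂ))
      = ![B - A, C - A] ∘ (finSuccAboveEquiv (0 : Fin 3)).symm := by
    funext ⟨i, hi⟩
    obtain ⟨j, rfl⟩ := Fin.exists_succ_eq.2 hi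
    have : (finSuccAboveEquiv (0 : Fin 3)).symm ⟨j.succ, hi⟩ = j := by
      rw [Equiv.symm_apply_eq]; ext; simp [finSuccAboveEquiv_apply]
    simp only [Function.comp, this]
    fin_cases j <;> simp
  rw [this, linearIndependent_equiv, LinearIndependent.pair_iff]
  constructor
  · intro h h0
    have key := h (-(C - A).im) ((B - A).im) ?_
    · have key2 := h (-(C - A).re) ((B - A).re) ?_
      · have hC : C - A = 0 := by apply Complex.ext <;> simp <;> linarith [key.1, key2.1, neg_eq_zero.1 key.1, neg_eq_zero.1 key2.1, Complex.sub_re C A, Complex.sub_im C A]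
        have := h 0 1 (by simp [hC])
        simp at this
      · apply Complex.ext <;> simp [ori] at * <;> linarith
    · apply Complex.ext <;> simp [ori] at * <;> linarith
  · intro h s t hst
    have h1 := congrArg Complex.re hst
    have h2 := congrArg Complex.im hst
    simp only [Complex.add_re, Complex.add_im, Complex.real_smul, Complex.re_ofReal_mul,
      Complex.im_ofReal_mul, Complex.zero_re, Complex.zero_im] at h1 h2
    constructor
    · have : s * ori A B C = 0 := by unfold ori; linear_combination (C - A).im * h1 - (C - A).re * h2
      exact (mul_eq_zero.1 this).resolve_right h
    · have : t * ori A B C = 0 := by unfold ori; linear_combination (B - A).re * h2 - (B - A).im * h1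
      exact (mul_eq_zero.1 this).resolve_right h

lemma range_triple (A B C : ℂ) : range ![A, B, C] = {A, B, C} := by
  simp only [Matrix.range_cons, Matrix.range_empty, union_empty, singleton_union]

lemma mem_convexHull_triple {A B C z : ℂ} : z ∈ convexHull ℝ {A, B, C} ↔
    ∃ α β γ : ℝ, 0 ≤ α ∧ 0 ≤ β ∧ 0 ≤ γ ∧ α + β + γ = 1 ∧ z = α • A + β • B + γ • C := by
  constructor
  · intro hz
    rw [convexHull_insert ⟨B, by simp⟩, convexHull_pair, convexJoin_singleton_left] at hz
    simp only [mem_iUnion] at hz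
    obtain ⟨y, ⟨s, t, hs, ht, hst, rfl⟩, u, v, hu, hv, huv, rfl⟩ := hz
    exact ⟨u, v * s, v * t, hu, by positivity, by positivity,
      by rw [add_assoc, ← mul_add, hst, mul_one, huv], by rw [smul_add, smul_smul, smul_smul, add_assoc]⟩
  · rintro ⟨α, β, γ, h1, h2, h3, h, rfl⟩
    refine mem_convexHull_of_exists_fintype ![α, β, γ] ![A, B, C] ?_ ?_ ?_ ?_
    · intro i; fin_cases i <;> assumption
    · simpa [Fin.sum_univ_three] using h
    · intro i; fin_cases i <;> simp
    · simp [Fin.sum_univ_three]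

lemma mem_interior_triangle {A B C z : ℂ} (h : ori A B C ≠ 0) :
    z ∈ interior (convexHull ℝ {A, B, C}) ↔
    ∃ α β γ : ℝ, 0 < α ∧ 0 < β ∧ 0 < γ ∧ α + β + γ = 1 ∧ z = α • A + β • B + γ • C := by
  have hai := (affineIndependent_iff_ori A B C).2 h
  let b : AffineBasis (Fin 3) ℝ ℂ := ⟨![A, B, C], hai, hai.affineSpan_eq_top_iff_card_eq_finrank_add_one.2 (by simp)⟩
  have hb : (b : Fin 3 → ℂ) = ![A, B, C] := rfl
  rw [← range_triple, ← hb, b.interior_convexHull]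
  constructor
  · intro hz
    refine ⟨b.coord 0 z, b.coord 1 z, b.coord 2 z, hz 0, hz 1, hz 2, ?_, ?_⟩
    · have := b.sum_coord_apply_eq_one z
      rwa [Fin.sum_univ_three] at this
    · have := b.linear_combination_coord_eq_self z
      rw [Fin.sum_univ_three] at this
      exact this.symm
  · rintro ⟨α, β, γ, h1, h2, h3, hs, rfl⟩
    have e1 := b.sum_coord_apply_eq_one (α • A + β • B + γ • C)
    have e2 := b.linear_combination_coord_eq_self (α • A + β • B + γ • C)
    rw [Fin.sum_univ_three] at e1 e2
    obtain ⟨k1, k2, k3⟩ := bary_unique h hs e1 e2.symm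
    intro i
    fin_cases i
    · exact k1 ▸ h1
    · exact k2 ▸ h2
    · exact k3 ▸ h3

lemma mem_side_of_mem_convexHull {A B C z : ℂ} (h : ori A B C ≠ 0)
    (hz : z ∈ convexHull ℝ {A, B, C}) (hz' : z ∉ interior (convexHull ℝ {A, B, C})) :
    z ∈ segment ℝ A B ∨ z ∈ segment ℝ B C ∨ z ∈ segment ℝ C A := by
  obtain ⟨α, β, γ, h1, h2, h3, hs, rfl⟩ := mem_convexHull_triple.1 hz
  rw [mem_interior_triangle h] at hz'
  rcases h1.eq_or_lt with rfl | h1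
  · exact Or.inr (Or.inl ⟨β, γ, h2, h3, by linarith, by simp⟩)
  rcases h2.eq_or_lt with rfl | h2
  · exact Or.inr (Or.inr ⟨γ, α, h3, h1.le, by linarith, by simp [add_comm]⟩)
  rcases h3.eq_or_lt with rfl | h3
  · exact Or.inl ⟨α, β, h1.le, h2.le, by linarith, by simp⟩
  exact absurd ⟨α, β, γ, h1, h2, h3, hs, rfl⟩ hz'

lemma segment_left_notMem_interior {A B C z : ℂ} (h : ori A B C ≠ 0) (hz : z ∈ segment ℝ A B) :
    z ∉ interior (convexHull ℝ {A, B, C}) := by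
  rw [mem_interior_triangle h]
  rintro ⟨α, β, γ, h1, h2, h3, hs, rfl⟩
  obtain ⟨s, t, -, -, hst, e⟩ := hz
  have := bary_unique h (α' := s) (β' := t) (γ' := 0) hs (by linarith) (by rw [← e]; simp)
  linarith [this.2.2]

lemma triple_rotate (A B C : ℂ) : ({A, B, C} : Set ℂ) = {B, C, A} := by
  ext; simp only [mem_insert_iff, mem_singleton_iff]; tauto

lemma triple_swap (A B C : ℂ) : ({A, B, C} : Set ℂ) = {B, A, C} := by
  ext; simp only [mem_insert_iff, mem_singleton_iff]; tauto

lemma side_notMem_interior {A B C z : ℂ} (h : ori A B C ≠ 0)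
    (hz : z ∈ segment ℝ A B ∨ z ∈ segment ℝ B C ∨ z ∈ segment ℝ C A) :
    z ∉ interior (convexHull ℝ {A, B, C}) := by
  rcases hz with hz | hz | hz
  · exact segment_left_notMem_interior h hz
  · rw [triple_rotate]
    exact segment_left_notMem_interior (by rwa [ori_rotate]) hz
  · rw [triple_rotate, triple_rotate]
    exact segment_left_notMem_interior (by rwa [ori_rotate, ori_rotate]) hz

lemma isClosed_triangle (A B C : ℂ) : IsClosed (convexHull ℝ {A, B, C}) :=
  ((Set.toFinite _).isCompact_convexHull ℝ).isClosed

/-- A connected set that meets an open triangle but not its sides is contained in it. -/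
lemma subset_interior_triangle {A B C : ℂ} (h : ori A B C ≠ 0) {H : Set ℂ} (hH : IsPreconnected H)
    (hne : (H ∩ interior (convexHull ℝ {A, B, C})).Nonempty)
    (hd : ∀ z ∈ H, ¬(z ∈ segment ℝ A B ∨ z ∈ segment ℝ B C ∨ z ∈ segment ℝ C A)) :
    H ⊆ interior (convexHull ℝ {A, B, C}) := by
  refine hH.subset_left_of_subset_union isOpen_interior (isClosed_triangle A B C).isOpen_compl
    ?_ ?_ hne
  · exact Set.disjoint_compl_right_iff_subset.2 interior_subset
  · intro z hz
    by_cases h1 : z ∈ interior (convexHull ℝ {A, B, C})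
    · exact Or.inl h1
    · exact Or.inr fun h2 => hd z hz (mem_side_of_mem_convexHull h h2 h1)

/-! ### Points and segments of the cylinder -/

/-- The coordinate along the axis vector, in units of its length. -/
noncomputable def hor (a z : ℂ) : ℝ := (z / a).re

lemma hor_add (a z w : ℂ) : hor a (z + w) = hor a z + hor a w := by simp [hor, add_div]

lemma hor_sub (a z w : ℂ) : hor a (z - w) = hor a z - hor a w := by simp [hor, sub_div]

lemma hor_smul (a : ℂ) (r : ℝ) (z : ℂ) : hor a (r • z) = r * hor a z := by
  simp [hor, mul_div_assoc]

variable {a : ℂ} {S : Set (Cylinder a)} {T T' T'' : Set (Sym2 (Cylinder a))} {w : ℂ → ℝ}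
  {P : Set (Cylinder a) → Prop}

lemma hor_zsmul (ha : a ≠ 0) (n : ℤ) : hor a (n • a) = n := by
  simp [hor, ha]

lemma hor_add_zsmul (ha : a ≠ 0) (z : ℂ) (n : ℤ) : hor a (z + n • a) = hor a z + n := by
  rw [hor_add, hor_zsmul ha]

lemma im_add_zsmul (ha : a ≠ 0) (z : ℂ) (n : ℤ) : ((z + n • a) / a).im = (z / a).im := by
  simp [add_div, ha]

lemma proj_eq_iff {z w : ℂ} : proj a z = proj a w ↔ ∃ n : ℤ, w = z + n • a := by
  rw [QuotientAddGroup.eq, AddSubgroup.mem_zmultiples_iff]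
  constructor
  · rintro ⟨n, hn⟩; exact ⟨n, by rw [hn]; abel⟩
  · rintro ⟨n, hn⟩; exact ⟨n, by rw [hn]; abel⟩

lemma proj_add_zsmul (z : ℂ) (n : ℤ) : proj a (z + n • a) = proj a z :=
  (proj_eq_iff.2 ⟨n, rfl⟩).symm

/-- Distinct lifts of one orbit differ horizontally by a nonzero integer. This is the standard way
of passing from equalities on the cylinder to equalities in the plane. -/
lemma eq_of_proj_eq (ha : a ≠ 0) {z w : ℂ} (h : proj a z = proj a w)
    (hx : |hor a w - hor a z| < 1) : z = w := by
  obtain ⟨n, rfl⟩ := proj_eq_iff.1 h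
  rw [hor_add_zsmul ha, add_sub_cancel_left] at hx
  have : n = 0 := by
    have : |n| < 1 := by exact_mod_cast hx
    exact Int.abs_lt_one_iff.1 this
  simp [this]

/-- After division by `a` the vertical parts cancel in the comparison of squared lengths. With `d`
the horizontal difference, a shift by `n` changes the square by `n * (n + 2 * d)`, and only `n = 1`
and `n = -1` are binding. -/
lemma isShortest_iff (ha : a ≠ 0) {A B : ℂ} :
    IsShortest a A B ↔ |hor a B - hor a A| < 1 / 2 := by
  have key : ∀ n : ℤ, dist A B < dist A (B + n • a) ↔
      0 < (n : ℝ) * (n + 2 * (hor a B - hor a A)) := by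
    intro n
    have h1 : dist A B = ‖(B - A) / a‖ * ‖a‖ := by
      rw [← norm_mul, div_mul_cancel₀ _ ha, dist_comm, dist_eq_norm]
    have h2 : dist A (B + n • a) = ‖(B - A) / a + n‖ * ‖a‖ := by
      rw [← norm_mul, add_mul, div_mul_cancel₀ _ ha, dist_comm, dist_eq_norm, zsmul_eq_mul]
      congr 1; ring
    rw [h1, h2, mul_lt_mul_iff_left₀ (norm_pos_iff.2 ha), ← sq_lt_sq₀ (norm_nonneg _) (norm_nonneg _),
      Complex.sq_norm, Complex.sq_norm, Complex.normSq_apply, Complex.normSq_apply, ← hor_sub]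
    simp only [Complex.add_re, Complex.add_im, Complex.intCast_re, Complex.intCast_im, hor]
    rw [← sub_pos]
    ring_nf
  simp only [IsShortest, key]
  set d := hor a B - hor a A
  constructor
  · intro h
    have h1 := h 1 one_ne_zero
    have h2 := h (-1) (by norm_num)
    push_cast at h1 h2
    rw [abs_lt]; constructor <;> linarith
  · intro h n hn
    rw [abs_lt] at h
    rcases lt_or_gt_of_ne hn with h0 | h0
    · have : (n : ℝ) ≤ -1 := by exact_mod_cast Int.le_sub_one_of_lt h0
      exact mul_pos_of_neg_of_neg (by linarith) (by linarith)
    · have : (1 : ℝ) ≤ n := by exact_mod_cast h0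
      exact mul_pos (by linarith) (by linarith)

lemma IsShortest.symm (ha : a ≠ 0) {A B : ℂ} (h : IsShortest a A B) : IsShortest a B A := by
  rw [isShortest_iff ha] at *; rwa [abs_sub_comm]

lemma IsShortest.add_zsmul (ha : a ≠ 0) {A B : ℂ} (h : IsShortest a A B) (n : ℤ) :
    IsShortest a (A + n • a) (B + n • a) := by
  rw [isShortest_iff ha] at *; rwa [hor_add_zsmul ha, hor_add_zsmul ha, add_sub_add_right_eq_sub]

lemma edge_comm (A B : ℂ) : edge a A B = edge a B A := Sym2.eq_swap

lemma edge_add_zsmul (A B : ℂ) (n : ℤ) : edge a (A + n • a) (B + n • a) = edge a A B := by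
  simp only [edge, proj_add_zsmul]

lemma hor_segment {A B z : ℂ} (hz : z ∈ segment ℝ A B) :
    |hor a z - hor a A| ≤ |hor a B - hor a A| := by
  obtain ⟨s, t, hs, ht, hst, rfl⟩ := hz
  obtain rfl : s = 1 - t := by linarith
  rw [hor_add, hor_smul, hor_smul, show (1 - t) * hor a A + t * hor a B - hor a A
    = t * (hor a B - hor a A) by ring, abs_mul, abs_of_nonneg ht]
  exact mul_le_of_le_one_left (abs_nonneg _) (by linarith)

lemma IsShortest.hor_lt (ha : a ≠ 0) {A B z : ℂ} (h : IsShortest a A B)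
    (hz : z ∈ segment ℝ A B) : |hor a z - hor a A| < 1 / 2 :=
  (hor_segment hz).trans_lt ((isShortest_iff ha).1 h)

/-- Two shortest representatives of the same segment differ by a translation. -/
lemma exists_zsmul_of_edge_eq (ha : a ≠ 0) {A B C D : ℂ} (h : IsShortest a A B)
    (h' : IsShortest a C D) (he : edge a C D = edge a A B) :
    ∃ n : ℤ, (C = A + n • a ∧ D = B + n • a) ∨ (C = B + n • a ∧ D = A + n • a) := by
  have aux : ∀ {A B : ℂ}, IsShortest a A B → proj a C = proj a A → proj a D = proj a B →
      ∃ n : ℤ, C = A + n • a ∧ D = B + n • a := by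
    intro A B h h1 h2
    obtain ⟨n, hn⟩ := proj_eq_iff.1 h1.symm
    refine ⟨n, hn, ?_⟩
    refine eq_of_proj_eq ha (by rw [h2, proj_add_zsmul]) ?_
    rw [isShortest_iff ha, abs_lt] at h h'
    rw [hn, hor_add_zsmul ha] at h'
    rw [hor_add_zsmul ha, abs_lt]
    constructor <;> linarith [h.1, h.2, h'.1, h'.2]
  rcases Sym2.eq_iff.1 he with ⟨h1, h2⟩ | ⟨h1, h2⟩
  · obtain ⟨n, hn⟩ := aux h h1 h2
    exact ⟨n, Or.inl hn⟩
  · obtain ⟨n, hn⟩ := aux (h.symm ha) h1 h2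
    exact ⟨n, Or.inr hn⟩

/-- Two shortest representatives of the same segment that share a point agree. -/
lemma eq_of_edge_eq (ha : a ≠ 0) {A B C D z : ℂ} (h : IsShortest a A B)
    (h' : IsShortest a C D) (he : edge a C D = edge a A B) (hz : z ∈ segment ℝ A B)
    (hz' : z ∈ segment ℝ C D) : (C = A ∧ D = B) ∨ (C = B ∧ D = A) := by
  obtain ⟨n, hn⟩ := exists_zsmul_of_edge_eq ha h h' he
  have h1 := abs_lt.1 (h.hor_lt ha hz)
  have h2 := abs_lt.1 (h'.hor_lt ha hz')
  have h3 := abs_lt.1 ((h.symm ha).hor_lt ha (segment_symm ℝ A B ▸ hz))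
  have h0 : n = 0 := by
    have : |(n : ℝ)| < 1 := by
      rw [abs_lt]
      rcases hn with ⟨rfl, -⟩ | ⟨rfl, -⟩ <;> rw [hor_add_zsmul ha] at h2 <;>
        constructor <;> linarith [h1.1, h1.2, h2.1, h2.2, h3.1, h3.2]
    exact Int.abs_lt_one_iff.1 (by exact_mod_cast this)
  simpa [h0] using hn

lemma carrier_edge (ha : a ≠ 0) {A B : ℂ} (h : IsShortest a A B) :
    carrier a (edge a A B) = proj a '' segment ℝ A B := by
  ext x
  constructor
  · rintro ⟨C, D, h', he, z, hz, rfl⟩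
    obtain ⟨n, hn⟩ := exists_zsmul_of_edge_eq ha h' h he.symm
    have : z + n • a ∈ segment ℝ A B := by
      have := (mem_segment_translate ℝ (n • a)).2 hz
      rw [add_comm _ C, add_comm _ D, add_comm _ z] at this
      rcases hn with ⟨rfl, rfl⟩ | ⟨rfl, rfl⟩
      · exact this
      · rwa [segment_symm]
    exact ⟨_, this, proj_add_zsmul _ _⟩
  · intro hx
    exact ⟨A, B, h, rfl, hx⟩

lemma mem_carrier_edge (ha : a ≠ 0) {A B z : ℂ} (h : IsShortest a A B) :
    proj a z ∈ carrier a (edge a A B) ↔ ∃ n : ℤ, z + n • a ∈ segment ℝ A B := by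
  rw [carrier_edge ha h]
  constructor
  · rintro ⟨w, hw, he⟩
    obtain ⟨n, rfl⟩ := proj_eq_iff.1 he.symm
    exact ⟨n, hw⟩
  · rintro ⟨n, hn⟩
    exact ⟨_, hn, proj_add_zsmul _ _⟩

lemma eq_end_of_proj_mem (ha : a ≠ 0) {A B z : ℂ} (h : IsShortest a A B)
    (hz : z ∈ segment ℝ A B) (hp : proj a z ∈ edge a A B) : z = A ∨ z = B := by
  have h1 := h.hor_lt ha hz
  have h3 := (h.symm ha).hor_lt ha (segment_symm ℝ A B ▸ hz)
  rcases Sym2.mem_iff.1 hp with hp | hp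
  · left; exact (eq_of_proj_eq ha hp.symm (by linarith)).symm
  · right; exact (eq_of_proj_eq ha hp.symm (by linarith)).symm

/-! ### Topology of the cylinder -/

lemma continuous_proj : Continuous (proj a) := QuotientAddGroup.continuous_mk

lemma isOpenMap_proj : IsOpenMap (proj a) := QuotientAddGroup.isOpenMap_coe

lemma isClosed_zmultiples (ha : a ≠ 0) : IsClosed (AddSubgroup.zmultiples a : Set ℂ) := by
  have : (AddSubgroup.zmultiples a : Set ℂ) = (fun z => z / a) ⁻¹' (range ((↑) : ℤ → ℂ)) := by
    ext z
    simp only [SetLike.mem_coe, AddSubgroup.mem_zmultiples_iff, mem_preimage, mem_range]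
    refine exists_congr fun n => ?_
    rw [eq_div_iff ha, zsmul_eq_mul]
  rw [this]
  exact (Complex.isClosedEmbedding_intCast.isClosed_range).preimage (by fun_prop)

lemma t2Space (ha : a ≠ 0) : T2Space (Cylinder a) := by
  have := isClosed_zmultiples ha
  infer_instance

lemma isCompact_carrier (ha : a ≠ 0) {A B : ℂ} (h : IsShortest a A B) :
    IsCompact (carrier a (edge a A B)) := by
  rw [carrier_edge ha h, ← convexHull_pair]
  exact ((Set.toFinite _).isCompact_convexHull ℝ).image continuous_proj


/-! ### Sets of non-crossing segments -/

lemma IsNonCrossing.proj_left_mem (h : IsNonCrossing a S T) {A B : ℂ} (hAB : edge a A B ∈ T) :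
    proj a A ∈ S := h.ends_mem _ hAB _ (Sym2.mem_mk_left _ _)

lemma IsNonCrossing.proj_right_mem (h : IsNonCrossing a S T) {A B : ℂ} (hAB : edge a A B ∈ T) :
    proj a B ∈ S := h.ends_mem _ hAB _ (Sym2.mem_mk_right _ _)

lemma IsNonCrossing.eq_end (h : IsNonCrossing a S T) (ha : a ≠ 0) {A B z : ℂ}
    (hs : IsShortest a A B) (hAB : edge a A B ∈ T) (hz : z ∈ segment ℝ A B) (hzS : proj a z ∈ S) :
    z = A ∨ z = B :=
  eq_end_of_proj_mem ha hs hz <| h.inter_points _ hAB _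
    (by rw [carrier_edge ha hs]; exact mem_image_of_mem _ hz) hzS

lemma IsNonCrossing.ne (h : IsNonCrossing a S T) (ha : a ≠ 0) {A B : ℂ}
    (hs : IsShortest a A B) (hAB : edge a A B ∈ T) : A ≠ B := by
  rintro rfl
  obtain ⟨C, D, hne, hCD, he⟩ := h.isSegment _ hAB
  obtain ⟨n, hn⟩ := exists_zsmul_of_edge_eq ha hs hCD he
  rcases hn with ⟨rfl, rfl⟩ | ⟨rfl, rfl⟩ <;> exact hne rfl

/-- The lifts of two segments meet only at common ends unless they agree. -/
lemma IsNonCrossing.meet (h : IsNonCrossing a S T) (ha : a ≠ 0) {A B C D z : ℂ}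
    (hs : IsShortest a A B) (hAB : edge a A B ∈ T) (hs' : IsShortest a C D)
    (hCD : edge a C D ∈ T) (hz : z ∈ segment ℝ A B) (hz' : z ∈ segment ℝ C D) :
    ((C = A ∧ D = B) ∨ (C = B ∧ D = A)) ∨ ((z = A ∨ z = B) ∧ (z = C ∨ z = D)) := by
  by_cases he : edge a C D = edge a A B
  · exact Or.inl (eq_of_edge_eq ha hs hs' he hz hz')
  · right
    have := h.inter_segments _ hAB _ hCD (Ne.symm he) (proj a z)
      (by rw [carrier_edge ha hs]; exact mem_image_of_mem _ hz)
      (by rw [carrier_edge ha hs']; exact mem_image_of_mem _ hz')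
    exact ⟨eq_end_of_proj_mem ha hs hz this.1, eq_end_of_proj_mem ha hs' hz' this.2⟩

/-- Every segment through a given point of the cylinder has a lift through a given lift of it. -/
lemma exists_lift (ha : a ≠ 0) {e : Sym2 (Cylinder a)} (he : IsSegment a e) {z : ℂ}
    (hz : proj a z ∈ carrier a e) :
    ∃ P Q : ℂ, P ≠ Q ∧ IsShortest a P Q ∧ edge a P Q = e ∧ z ∈ segment ℝ P Q := by
  obtain ⟨P, Q, hne, hs, rfl⟩ := he
  obtain ⟨n, hn⟩ := (mem_carrier_edge ha hs).1 hz
  refine ⟨P + (-n) • a, Q + (-n) • a, by simpa using hne, hs.add_zsmul ha _, edge_add_zsmul _ _ _, ?_⟩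
  have := (mem_segment_translate ℝ ((-n) • a)).2 hn
  rwa [show (-n) • a + (z + n • a) = z by rw [neg_smul]; abel, add_comm _ P, add_comm _ Q] at this

lemma mem_skeleton_of_mem_segment {A B z : ℂ} (hs : IsShortest a A B) (hAB : edge a A B ∈ T)
    (hz : z ∈ segment ℝ A B) : proj a z ∈ skeleton a S T :=
  Or.inr (mem_iUnion₂.2 ⟨_, hAB, A, B, hs, rfl, mem_image_of_mem _ hz⟩)

/-! ### Triangles -/

lemma openTriangle_rotate (A B C : ℂ) : openTriangle a B C A = openTriangle a A B C := by
  rw [openTriangle, openTriangle, triple_rotate A]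

lemma openTriangle_swap (A B C : ℂ) : openTriangle a B A C = openTriangle a A B C := by
  rw [openTriangle, openTriangle, triple_swap A]

lemma IsTriangle.ori_ne {A B C : ℂ} (h : IsTriangle a S T A B C) : ori A B C ≠ 0 :=
  (affineIndependent_iff_ori A B C).1 h.affineIndependent

lemma IsTriangle.rotate {A B C : ℂ} (h : IsTriangle a S T A B C) : IsTriangle a S T B C A where
  affineIndependent := (affineIndependent_iff_ori _ _ _).2 (by rw [ori_rotate]; exact h.ori_ne)
  shortest_AB := h.shortest_BC
  shortest_BC := h.shortest_CA
  shortest_CA := h.shortest_AB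
  mem_AB := h.mem_BC
  mem_BC := h.mem_CA
  mem_CA := h.mem_AB
  disjoint_skeleton := by rw [openTriangle_rotate]; exact h.disjoint_skeleton

lemma IsTriangle.swap (ha : a ≠ 0) {A B C : ℂ} (h : IsTriangle a S T A B C) :
    IsTriangle a S T B A C where
  affineIndependent := (affineIndependent_iff_ori _ _ _).2
    (by rw [ori_swap, neg_ne_zero]; exact h.ori_ne)
  shortest_AB := h.shortest_AB.symm ha
  shortest_BC := h.shortest_CA.symm ha
  shortest_CA := h.shortest_BC.symm ha
  mem_AB := edge_comm A B ▸ h.mem_AB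
  mem_BC := edge_comm C A ▸ h.mem_CA
  mem_CA := edge_comm B C ▸ h.mem_BC
  disjoint_skeleton := by rw [openTriangle_swap]; exact h.disjoint_skeleton

lemma bary_add {A B C t : ℂ} {α β γ : ℝ} (h : α + β + γ = 1) :
    α • (A + t) + β • (B + t) + γ • (C + t) = α • A + β • B + γ • C + t := by
  rw [show α • (A + t) + β • (B + t) + γ • (C + t)
    = α • A + β • B + γ • C + (α + β + γ) • t by simp only [smul_add, add_smul]; abel, h, one_smul]

lemma mem_interior_add {A B C z t : ℂ} (h : ori A B C ≠ 0)
    (hz : z ∈ interior (convexHull ℝ {A, B, C})) :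
    z + t ∈ interior (convexHull ℝ {A + t, B + t, C + t}) := by
  rw [mem_interior_triangle (by rwa [ori_add_right])]
  obtain ⟨α, β, γ, h1, h2, h3, hs, rfl⟩ := (mem_interior_triangle h).1 hz
  exact ⟨α, β, γ, h1, h2, h3, hs, (bary_add hs).symm⟩

lemma openTriangle_add_zsmul {A B C : ℂ} (h : ori A B C ≠ 0) (n : ℤ) :
    openTriangle a (A + n • a) (B + n • a) (C + n • a) = openTriangle a A B C := by
  ext x
  constructor
  · rintro ⟨z, hz, rfl⟩
    have := mem_interior_add (t := (-n) • a) (by rwa [ori_add_right]) hz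
    simp only [neg_smul, add_neg_cancel_right] at this
    refine ⟨_, this, ?_⟩
    rw [← neg_smul, proj_add_zsmul]
  · rintro ⟨z, hz, rfl⟩
    exact ⟨_, mem_interior_add h hz, proj_add_zsmul _ _⟩

lemma IsTriangle.add_zsmul (ha : a ≠ 0) {A B C : ℂ} (h : IsTriangle a S T A B C) (n : ℤ) :
    IsTriangle a S T (A + n • a) (B + n • a) (C + n • a) where
  affineIndependent := (affineIndependent_iff_ori _ _ _).2 (by rw [ori_add_right]; exact h.ori_ne)
  shortest_AB := h.shortest_AB.add_zsmul ha n
  shortest_BC := h.shortest_BC.add_zsmul ha n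
  shortest_CA := h.shortest_CA.add_zsmul ha n
  mem_AB := by rw [edge_add_zsmul]; exact h.mem_AB
  mem_BC := by rw [edge_add_zsmul]; exact h.mem_BC
  mem_CA := by rw [edge_add_zsmul]; exact h.mem_CA
  disjoint_skeleton := by rw [openTriangle_add_zsmul h.ori_ne]; exact h.disjoint_skeleton

lemma IsTriangle.notMem_skeleton {A B C z : ℂ} (h : IsTriangle a S T A B C)
    (hz : z ∈ interior (convexHull ℝ {A, B, C})) : proj a z ∉ skeleton a S T :=
  disjoint_left.1 h.disjoint_skeleton (mem_image_of_mem _ hz)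

lemma IsTriangle.side_mem_skeleton {A B C z : ℂ} (h : IsTriangle a S T A B C)
    (hz : z ∈ segment ℝ A B ∨ z ∈ segment ℝ B C ∨ z ∈ segment ℝ C A) :
    proj a z ∈ skeleton a S T := by
  rcases hz with hz | hz | hz
  · exact mem_skeleton_of_mem_segment h.shortest_AB h.mem_AB hz
  · exact mem_skeleton_of_mem_segment h.shortest_BC h.mem_BC hz
  · exact mem_skeleton_of_mem_segment h.shortest_CA h.mem_CA hz

/-- No segment of a set of non-crossing segments passes through the interior of a triangle
that is formed by such segments and contains no point of `S`. -/
lemma IsNonCrossing.notMem_interior (hT : IsNonCrossing a S T) (ha : a ≠ 0) {A B C : ℂ}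
    (h : ori A B C ≠ 0)
    (sAB : IsShortest a A B) (sBC : IsShortest a B C) (sCA : IsShortest a C A)
    (mAB : edge a A B ∈ T) (mBC : edge a B C ∈ T) (mCA : edge a C A ∈ T)
    (hS : ∀ z ∈ interior (convexHull ℝ {A, B, C}), proj a z ∉ S)
    {P Q q : ℂ} (sPQ : IsShortest a P Q) (mPQ : edge a P Q ∈ T) (hq : q ∈ segment ℝ P Q) :
    q ∉ interior (convexHull ℝ {A, B, C}) := by
  intro hqi
  -- If the way from `q` to the end `P` meets a side, the meeting point is a common end. It cannot
  -- be `Q`, which lies on the other side of `q`, so `P` itself is a vertex of the triangle.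
  have side : ∀ {U V P Q r : ℂ}, IsShortest a U V → edge a U V ∈ T →
      (∀ z ∈ segment ℝ U V, z ∉ interior (convexHull ℝ {A, B, C})) →
      IsShortest a P Q → edge a P Q ∈ T → q ∈ segment ℝ P Q → r ∈ segment ℝ q P →
      r ∈ segment ℝ U V → P = U ∨ P = V := by
    intro U V P Q r sUV mUV hUV sPQ mPQ hq hr hr'
    have hrPQ : r ∈ segment ℝ P Q :=
      (convex_segment P Q).segment_subset hq (left_mem_segment ℝ P Q) hr
    rcases hT.meet ha sUV mUV sPQ mPQ hr' hrPQ with h1 | ⟨h1, h2⟩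
    · exfalso
      rcases h1 with ⟨h1, h2⟩ | ⟨h1, h2⟩ <;> rw [h1, h2] at hq
      · exact hUV q hq hqi
      · exact hUV q (segment_symm ℝ V U ▸ hq) hqi
    · rcases h2 with rfl | rfl
      · exact h1
      · exfalso
        have : q = r := wbtw_swap_right_iff ℝ P |>.1
          ⟨mem_segment_iff_wbtw.1 hq, mem_segment_iff_wbtw.1 (segment_symm ℝ q P ▸ hr)⟩
        exact hUV q (this ▸ hr') hqi
  have ends : ∀ {P Q : ℂ}, IsShortest a P Q → edge a P Q ∈ T → q ∈ segment ℝ P Q →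
      P = A ∨ P = B ∨ P = C := by
    intro P Q sPQ mPQ hq
    by_contra hcon
    have hsub := subset_interior_triangle h (H := segment ℝ q P) (convex_segment q P).isPreconnected
      ⟨q, left_mem_segment ℝ q P, hqi⟩ (by
        intro r hr hr'
        apply hcon
        rcases hr' with hr' | hr' | hr'
        · have := side sAB mAB (fun z hz => side_notMem_interior h (Or.inl hz)) sPQ mPQ hq hr hr'
          tauto
        · have := side sBC mBC (fun z hz => side_notMem_interior h (Or.inr (Or.inl hz)))
            sPQ mPQ hq hr hr'
          tauto
        · have := side sCA mCA (fun z hz => side_notMem_interior h (Or.inr (Or.inr hz)))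
            sPQ mPQ hq hr hr'
          tauto)
    exact hS P (hsub (right_mem_segment ℝ q P)) (hT.proj_left_mem mPQ)
  have hP := ends sPQ mPQ hq
  -- Both ends are now vertices, so `q` lies on a side or is a vertex, and hence is not interior.
  have hQ := ends (sPQ.symm ha) (edge_comm P Q ▸ mPQ) (segment_symm ℝ P Q ▸ hq)
  refine side_notMem_interior h ?_ hqi
  rcases hP with rfl | rfl | rfl <;> rcases hQ with rfl | rfl | rfl
  all_goals first
    | exact Or.inl hq
    | exact Or.inr (Or.inl hq)
    | exact Or.inr (Or.inr hq)
    | (rw [segment_symm] at hq; exact Or.inl hq)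
    | (rw [segment_symm] at hq; exact Or.inr (Or.inl hq))
    | (rw [segment_symm] at hq; exact Or.inr (Or.inr hq))
    | (rw [segment_same, mem_singleton_iff] at hq; rw [hq]; simp [left_mem_segment, right_mem_segment])

/-- Avoiding the points of `S` already implies avoiding all segments. This is how triangles are
recognized in a triangulation that has just been altered. -/
lemma IsNonCrossing.isTriangle (hT : IsNonCrossing a S T) (ha : a ≠ 0) {A B C : ℂ}
    (h : ori A B C ≠ 0)
    (sAB : IsShortest a A B) (sBC : IsShortest a B C) (sCA : IsShortest a C A)
    (mAB : edge a A B ∈ T) (mBC : edge a B C ∈ T) (mCA : edge a C A ∈ T)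
    (hS : ∀ z ∈ interior (convexHull ℝ {A, B, C}), proj a z ∉ S) :
    IsTriangle a S T A B C where
  affineIndependent := (affineIndependent_iff_ori _ _ _).2 h
  shortest_AB := sAB
  shortest_BC := sBC
  shortest_CA := sCA
  mem_AB := mAB
  mem_BC := mBC
  mem_CA := mCA
  disjoint_skeleton := by
    rw [disjoint_left]
    rintro _ ⟨q, hq, rfl⟩ (hx | hx)
    · exact hS q hq hx
    · obtain ⟨e, he, hx⟩ := mem_iUnion₂.1 hx
      obtain ⟨P, Q, -, sPQ, rfl, hqPQ⟩ := exists_lift ha (hT.isSegment e he) hx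
      exact hT.notMem_interior ha h sAB sBC sCA mAB mBC mCA hS sPQ he hqPQ hq

lemma isOpen_openTriangle (A B C : ℂ) : IsOpen (openTriangle a A B C) :=
  isOpenMap_proj _ isOpen_interior

lemma isPreconnected_openTriangle (A B C : ℂ) : IsPreconnected (openTriangle a A B C) :=
  ((convex_convexHull ℝ _).interior.isPreconnected).image _ continuous_proj.continuousOn

/-- The interior of a triangle is a region. -/
lemma IsTriangle.region_eq (ha : a ≠ 0) {A B C : ℂ} (h : IsTriangle a S T A B C) {x : Cylinder a}
    (hx : x ∈ openTriangle a A B C) : region a S T x = openTriangle a A B C := by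
  have hsub : openTriangle a A B C ⊆ (skeleton a S T)ᶜ :=
    fun y hy => disjoint_left.1 h.disjoint_skeleton hy
  apply Subset.antisymm
  · have := t2Space ha
    -- The sides lie on the skeleton, so off the skeleton the open triangle and the complement of
    -- the closed one are disjoint open sets covering everything.
    have hcl : IsClosed (proj a '' convexHull ℝ {A, B, C}) :=
      (((Set.toFinite _).isCompact_convexHull ℝ).image continuous_proj).isClosed
    refine isPreconnected_connectedComponentIn.subset_left_of_subset_union
      (isOpen_openTriangle A B C) hcl.isOpen_compl ?_ ?_ ⟨x, mem_connectedComponentIn (hsub hx), hx⟩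
    · exact disjoint_compl_right_iff_subset.2 (image_mono interior_subset)
    · intro y hy
      by_cases hy' : y ∈ proj a '' convexHull ℝ {A, B, C}
      · left
        obtain ⟨z, hz, rfl⟩ := hy'
        refine mem_image_of_mem _ ?_
        by_contra hz'
        exact connectedComponentIn_subset _ _ hy
          (h.side_mem_skeleton (mem_side_of_mem_convexHull h.ori_ne hz hz'))
      · exact Or.inr hy'
  · exact (isPreconnected_openTriangle A B C).subset_connectedComponentIn hx hsub

lemma mem_closure_interior_triangle {A B C z : ℂ} (h : ori A B C ≠ 0)
    (hz : z ∈ convexHull ℝ {A, B, C}) : z ∈ closure (interior (convexHull ℝ {A, B, C})) := by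
  rw [(convex_convexHull ℝ _).closure_interior_eq_closure_of_nonempty_interior]
  · exact subset_closure hz
  · exact ⟨_, (mem_interior_triangle h).2 ⟨1/3, 1/3, 1/3, by norm_num, by norm_num, by norm_num,
      by norm_num, rfl⟩⟩

lemma exists_mem_interior_inter {A B C E : ℂ} (h : 0 < ori A B C * ori A B E) :
    (interior (convexHull ℝ {A, B, C}) ∩ interior (convexHull ℝ {A, B, E})).Nonempty := by
  have hC : ori A B C ≠ 0 := left_ne_zero_of_mul h.ne'
  have hE : ori A B E ≠ 0 := right_ne_zero_of_mul h.ne'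
  obtain ⟨α, β, γ, hs, hz⟩ := exists_bary hE C
  have hγ : 0 < γ := by
    rw [ori_of_bary hs hz, mul_assoc] at h
    exact (pos_iff_pos_of_mul_pos h).2 (mul_self_pos.2 hE)
  -- The common point is taken close to the midpoint of `A B`. This `t` makes `t * |α|` and `t *
  -- |β|` smaller than `(1 - t) / 2`.
  set t : ℝ := 1 / (2 + 2 * |α| + 2 * |β|) with ht
  have hα := neg_abs_le α
  have hβ := neg_abs_le β
  have hα' := abs_nonneg α
  have hβ' := abs_nonneg β
  have ht0 : 0 < t := by positivity
  have ht1 : t * (2 + 2 * |α| + 2 * |β|) = 1 := by rw [ht]; field_simp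
  have k1 : 0 ≤ t * (|α| + α) := mul_nonneg ht0.le (by linarith)
  have k2 : 0 ≤ t * (|β| + β) := mul_nonneg ht0.le (by linarith)
  have k3 : 0 ≤ t * |α| := mul_nonneg ht0.le hα'
  have k4 : 0 ≤ t * |β| := mul_nonneg ht0.le hβ'
  refine ⟨((1 - t) / 2) • A + ((1 - t) / 2) • B + t • C, (mem_interior_triangle hC).2
    ⟨_, _, _, by nlinarith, by nlinarith, ht0, by ring, rfl⟩, (mem_interior_triangle hE).2
    ⟨(1 - t) / 2 + t * α, (1 - t) / 2 + t * β, t * γ, by nlinarith, by nlinarith, by positivity,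
      by linear_combination t * hs, ?_⟩⟩
  rw [hz]
  simp only [smul_add, add_smul, smul_smul]
  abel

/-- Two triangles on the same side of a common side agree. -/
lemma IsTriangle.apex_unique {A B C E : ℂ} (h : IsTriangle a S T A B C)
    (h' : IsTriangle a S T A B E) (hside : 0 < ori A B C * ori A B E) : E = C := by
  have sub : ∀ {C E : ℂ}, IsTriangle a S T A B C → IsTriangle a S T A B E →
      0 < ori A B C * ori A B E → ∃ α β γ : ℝ, 0 ≤ α ∧ 0 ≤ β ∧ α + β + γ = 1 ∧
        E = α • A + β • B + γ • C := by
    intro C E h h' hside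
    have hsub : interior (convexHull ℝ {A, B, E}) ⊆ interior (convexHull ℝ {A, B, C}) := by
      refine subset_interior_triangle h.ori_ne (convex_convexHull ℝ _).interior.isPreconnected ?_ ?_
      · rw [inter_comm]; exact exists_mem_interior_inter hside
      · exact fun z hz hz' => h'.notMem_skeleton hz (h.side_mem_skeleton hz')
    have := mem_closure_interior_triangle h'.ori_ne
      (subset_convexHull ℝ {A, B, E} (by simp : E ∈ ({A, B, E} : Set ℂ)))
    have := closure_minimal (hsub.trans interior_subset) (isClosed_triangle A B C) this
    obtain ⟨α, β, γ, h1, h2, h3, hs, e⟩ := mem_convexHull_triple.1 this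
    exact ⟨α, β, γ, h1, h2, hs, e⟩
  obtain ⟨α, β, γ, h1, h2, hs, e⟩ := sub h h' hside
  obtain ⟨α', β', γ', h1', h2', hs', e'⟩ := sub h' h (by rwa [mul_comm])
  have k := ori_of_bary hs e
  have k' := ori_of_bary hs' e'
  -- Each apex lies in the closed triangle of the other, so the relative heights `γ` and `γ'` over
  -- `A B` are reciprocal and at most 1; both equal 1.
  have hg : γ' * γ = 1 := by
    rw [k, ← mul_assoc] at k'
    exact (mul_eq_right₀ h.ori_ne).1 k'.symm
  have hg0 : 0 < γ := by
    rw [k] at hside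
    by_contra hc
    have := mul_self_nonneg (ori A B C)
    nlinarith
  have : 1 ≤ γ := by
    have : γ' ≤ 1 := by linarith
    nlinarith
  obtain rfl : α = 0 := by linarith
  obtain rfl : β = 0 := by linarith
  obtain rfl : γ = 1 := by linarith
  simpa using e


/-! ### Convex quadrangles -/

/-- `A C B D` is a strictly convex quadrangle with diagonals `A B` and `C D`. -/
structure Quad (A B C D : ℂ) : Prop where
  ori₁ : ori A B C ≠ 0
  ori₂ : ori A B D ≠ 0
  cross : (openSegment ℝ A B ∩ openSegment ℝ C D).Nonempty

lemma Quad.exists_coeff {A B C D : ℂ} (h : Quad A B C D) : ∃ l m s t : ℝ, 0 < l ∧ 0 < m ∧ 0 < s ∧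
    0 < t ∧ l + m = 1 ∧ s + t = 1 ∧ l • A + m • B = s • C + t • D := by
  obtain ⟨p, ⟨l, m, hl, hm, hlm, rfl⟩, s, t, hs, ht, hst, e⟩ := h.cross
  exact ⟨l, m, s, t, hl, hm, hs, ht, hlm, hst, e.symm⟩

lemma Quad.swap_left {A B C D : ℂ} (h : Quad A B C D) : Quad B A C D where
  ori₁ := by rw [ori_swap, neg_ne_zero]; exact h.ori₁
  ori₂ := by rw [ori_swap, neg_ne_zero]; exact h.ori₂
  cross := by rw [openSegment_symm]; exact h.cross

lemma Quad.swap_right {A B C D : ℂ} (h : Quad A B C D) : Quad A B D C where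
  ori₁ := h.ori₂
  ori₂ := h.ori₁
  cross := by rw [openSegment_symm ℝ D C]; exact h.cross

lemma ori_two (A B P Q : ℂ) {s t : ℝ} (h : s + t = 1) :
    ori A B (s • P + t • Q) = s * ori A B P + t * ori A B Q := by
  have := ori_combination A B P Q Q (α := s) (β := t) (γ := 0) (by linarith)
  simpa using this

/-- Evaluating the orientation over `A C`, and over `B C`, at the crossing point along either
diagonal shows that a degenerate triangle at `C D` would force `A B C` to be degenerate. -/
lemma Quad.symm {A B C D : ℂ} (h : Quad A B C D) : Quad C D A B := by
  obtain ⟨l, m, s, t, hl, hm, hs, ht, hlm, hst, e⟩ := h.exists_coeff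
  have e1 : t * ori A C D = m * ori A C B := by
    have h1 := ori_two A C C D hst
    have h2 := ori_two A C A B hlm
    rw [e, h1, ori_left, ori_right A C] at h2
    linarith
  have e2 : t * ori B C D = l * ori B C A := by
    have h1 := ori_two B C C D hst
    have h2 := ori_two B C A B hlm
    rw [e, h1, ori_left, ori_right B C] at h2
    linarith
  have hC := h.ori₁
  refine ⟨?_, ?_, by rw [inter_comm]; exact h.cross⟩
  · rw [ori_rotate A C D]
    intro h0
    rw [h0, mul_zero, ori_swap, ← ori_rotate] at e1
    rcases mul_eq_zero.1 e1.symm with h1 | h1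
    · exact hm.ne' h1
    · exact hC (neg_eq_zero.1 h1)
  · rw [ori_rotate B C D]
    intro h0
    rw [h0, mul_zero, ori_rotate] at e2
    rcases mul_eq_zero.1 e2.symm with h1 | h1
    · exact hl.ne' h1
    · exact hC h1

lemma Quad.ori_mul_neg {A B C D : ℂ} (h : Quad A B C D) : ori A B C * ori A B D < 0 := by
  obtain ⟨l, m, s, t, hl, hm, hs, ht, hlm, hst, e⟩ := h.exists_coeff
  have h1 := ori_two A B C D hst
  have h2 := ori_two A B A B hlm
  rw [e, h1, ori_left, ori_right] at h2
  have h3 := mul_self_pos.2 h.ori₁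
  have : s * (ori A B C * ori A B C) + t * (ori A B C * ori A B D) = 0 := by
    linear_combination (ori A B C) * h2
  by_contra hc
  nlinarith [mul_pos hs h3, mul_nonneg ht.le (not_lt.1 hc)]

/-- The interior of a convex quadrangle, cut along the diagonal `A B`. -/
def quadInterior (A B C D : ℂ) : Set ℂ :=
  interior (convexHull ℝ {A, B, C}) ∪ openSegment ℝ A B ∪ interior (convexHull ℝ {A, B, D})

lemma quadInterior_swap_left (A B C D : ℂ) : quadInterior B A C D = quadInterior A B C D := by
  rw [quadInterior, quadInterior, triple_swap B A, triple_swap B A, openSegment_symm]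

lemma Quad.openSegment_subset {A B C D : ℂ} (h : Quad A B C D) :
    openSegment ℝ C D ⊆ quadInterior A B C D := by
  obtain ⟨l, m, s, t, hl, hm, hs, ht, hlm, hst, e⟩ := h.exists_coeff
  rintro _ ⟨u, v, hu, hv, huv, rfl⟩
  rcases lt_trichotomy v t with hvt | rfl | hvt
  · left; left
    refine (mem_interior_triangle h.ori₁).2 ⟨v / t * l, v / t * m, 1 - v / t, by positivity,
      by positivity, sub_pos.2 ((div_lt_one ht).2 hvt), by linear_combination v / t * hlm, ?_⟩
    rw [mul_smul, mul_smul, ← smul_add, e, smul_add, smul_smul, smul_smul,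
      div_mul_cancel₀ _ ht.ne', add_right_comm, ← add_smul]
    congr 2
    rw [show s = 1 - t by linarith, show u = 1 - v by linarith]
    field_simp
    ring
  · left; right
    obtain rfl : u = s := by linarith
    exact ⟨l, m, hl, hm, hlm, e⟩
  · right
    have hus : u < s := by linarith
    refine (mem_interior_triangle h.ori₂).2 ⟨u / s * l, u / s * m, 1 - u / s, by positivity,
      by positivity, sub_pos.2 ((div_lt_one hs).2 hus), by linear_combination u / s * hlm, ?_⟩
    rw [mul_smul, mul_smul, ← smul_add, e, smul_add, smul_smul, smul_smul,
      div_mul_cancel₀ _ hs.ne', add_assoc, ← add_smul]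
    congr 2
    rw [show t = 1 - s by linarith, show v = 1 - u by linarith]
    field_simp
    ring

/-- Part of the weights at `C` and `D`, in the ratio `s : t`, is traded for `A` and `B` through the
crossing point until one of them vanishes. The sign of `δ * s - γ * t` tells which survives, that
is, on which side of `A B` the point lies. -/
lemma Quad.interior_subset {A B C D : ℂ} (h : Quad A B C D) :
    interior (convexHull ℝ {C, D, A}) ⊆ quadInterior A B C D := by
  obtain ⟨l, m, s, t, hl, hm, hs, ht, hlm, hst, e⟩ := h.exists_coeff
  intro z hz
  obtain ⟨γ, δ, α, hγ, hδ, hα, hsum, rfl⟩ := (mem_interior_triangle h.symm.ori₁).1 hz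
  rcases lt_trichotomy (δ * s) (γ * t) with hlt | heq | hlt
  · left; left
    refine (mem_interior_triangle h.ori₁).2 ⟨α + δ / t * l, δ / t * m, γ - δ / t * s,
      by positivity, by positivity, ?_, by
        have : δ / t * t = δ := div_mul_cancel₀ _ ht.ne'
        linear_combination hsum + δ / t * hlm - δ / t * hst + this, ?_⟩
    · rw [sub_pos, div_mul_eq_mul_div, div_lt_iff₀ ht]; exact hlt
    · have : (δ / t) • (l • A + m • B) = (δ / t) • (s • C) + δ • D := by
        rw [e, smul_add, smul_smul _ t, div_mul_cancel₀ _ ht.ne']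
      rw [add_smul, sub_smul, mul_smul, mul_smul, mul_smul, add_assoc (α • A), ← smul_add, this]
      abel
  · left; right
    refine ⟨α + δ / t * l, δ / t * m, by positivity, by positivity, ?_, ?_⟩
    · have h1 : δ / t * t = δ := div_mul_cancel₀ _ ht.ne'
      have h2 : δ / t * s = γ := by field_simp; linarith
      linear_combination hsum + δ / t * hlm - δ / t * hst + h1 + h2
    · have : (δ / t) • (l • A + m • B) = γ • C + δ • D := by
        rw [e, smul_add, smul_smul _ t, div_mul_cancel₀ _ ht.ne', smul_smul]
        congr 2
        field_simp; linarith
      rw [add_smul, mul_smul, mul_smul, add_assoc, ← smul_add, this]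
      abel
  · right
    refine (mem_interior_triangle h.ori₂).2 ⟨α + γ / s * l, γ / s * m, δ - γ / s * t,
      by positivity, by positivity, ?_, by
        have : γ / s * s = γ := div_mul_cancel₀ _ hs.ne'
        linear_combination hsum + γ / s * hlm - γ / s * hst + this, ?_⟩
    · rw [sub_pos, div_mul_eq_mul_div, div_lt_iff₀ hs]; exact hlt
    · have : (γ / s) • (l • A + m • B) = γ • C + (γ / s) • (t • D) := by
        rw [e, smul_add, smul_smul _ s, div_mul_cancel₀ _ hs.ne']
      rw [add_smul, sub_smul, mul_smul, mul_smul, mul_smul, add_assoc (α • A), ← smul_add, this]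
      abel

lemma Quad.quadInterior_subset {A B C D : ℂ} (h : Quad A B C D) :
    quadInterior C D A B ⊆ quadInterior A B C D := by
  refine union_subset (union_subset h.interior_subset h.openSegment_subset) ?_
  rw [← quadInterior_swap_left]
  exact h.swap_left.interior_subset

lemma Quad.quadInterior_eq {A B C D : ℂ} (h : Quad A B C D) :
    quadInterior C D A B = quadInterior A B C D :=
  h.quadInterior_subset.antisymm h.symm.quadInterior_subset

/-- The midpoint of `A` and the crossing point works. It shows that the old diagonal runs through an
open triangle of the new one. -/
lemma Quad.exists_mem_openSegment {A B C D : ℂ} (h : Quad A B C D) :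
    ∃ z ∈ openSegment ℝ A B, z ∈ interior (convexHull ℝ {C, D, A}) := by
  obtain ⟨l, m, s, t, hl, hm, hs, ht, hlm, hst, e⟩ := h.exists_coeff
  refine ⟨((1 + l) / 2) • A + (m / 2) • B, ⟨_, _, by positivity, by positivity, by linarith, rfl⟩,
    (mem_interior_triangle h.symm.ori₁).2 ⟨s / 2, t / 2, 1 / 2, by positivity, by positivity,
      by positivity, by linarith, ?_⟩⟩
  have : (1 / 2 : ℝ) • (l • A + m • B) = (1 / 2 : ℝ) • (s • C + t • D) := by rw [e]
  simp only [smul_add, smul_smul] at this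
  rw [show (1 + l) / 2 = 1 / 2 * l + 1 / 2 by ring, show m / 2 = 1 / 2 * m by ring, add_smul,
    add_right_comm, this]
  ring_nf

lemma ends_or_openSegment {A B z : ℂ} (h : z ∈ segment ℝ A B) :
    z = A ∨ z = B ∨ z ∈ openSegment ℝ A B := by
  rw [← insert_endpoints_openSegment] at h
  exact h

lemma ne_left_of_mem_openSegment {A B z : ℂ} (hne : A ≠ B) (h : z ∈ openSegment ℝ A B) : z ≠ A := by
  rintro rfl; exact hne (left_mem_openSegment_iff.1 h)

lemma ne_right_of_mem_openSegment {A B z : ℂ} (hne : A ≠ B) (h : z ∈ openSegment ℝ A B) :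
    z ≠ B := by
  rintro rfl; exact hne (right_mem_openSegment_iff.1 h)

lemma ne_of_ori_ne {A B C : ℂ} (h : ori A B C ≠ 0) : A ≠ B := by
  rintro rfl; exact h (by simp [ori])

/-! ### Flips -/

lemma IsTriangle.edge_CA_ne (ha : a ≠ 0) {A B C : ℂ} (h : IsTriangle a S T A B C) :
    edge a C A ≠ edge a A B := by
  intro he
  have h0 := h.ori_ne
  rcases eq_of_edge_eq ha h.shortest_AB h.shortest_CA he (left_mem_segment ℝ A B)
    (right_mem_segment ℝ C A) with ⟨rfl, -⟩ | ⟨rfl, -⟩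
  · exact h0 (ori_left _ _)
  · exact h0 (ori_right _ _)

lemma IsTriangle.edge_BC_ne (ha : a ≠ 0) {A B C : ℂ} (h : IsTriangle a S T A B C) :
    edge a B C ≠ edge a A B := by
  have := (h.swap ha).edge_CA_ne ha
  rwa [edge_comm C B, edge_comm B A] at this

/-- A triangle over the segment `A B` can be moved to the given lift of that segment. -/
lemma IsTriangle.move (ha : a ≠ 0) {A B X Y Z : ℂ} (h : IsTriangle a S T X Y Z)
    (hs : IsShortest a A B) (he : edge a X Y = edge a A B) :
    ∃ n : ℤ, IsTriangle a S T A B (Z + n • a) ∧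
      ((A = X + n • a ∧ B = Y + n • a) ∨ (A = Y + n • a ∧ B = X + n • a)) := by
  obtain ⟨n, hn⟩ := exists_zsmul_of_edge_eq ha h.shortest_AB hs he.symm
  refine ⟨n, ?_, hn⟩
  rcases hn with ⟨rfl, rfl⟩ | ⟨rfl, rfl⟩
  · exact h.add_zsmul ha n
  · exact (h.add_zsmul ha n).swap ha

/-- `T` and `T'` differ by the exchange of the diagonals of a convex quadrangle. -/
structure IsExchange (a : ℂ) (S : Set (Cylinder a)) (T T' : Set (Sym2 (Cylinder a)))
    (A B C D : ℂ) : Prop where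
  quad : Quad A B C D
  left : IsTriangle a S T A B C
  right : IsTriangle a S T A B D
  left' : IsTriangle a S T' C D A
  right' : IsTriangle a S T' C D B
  sdiff_eq : T \ {edge a A B} = T' \ {edge a C D}

lemma IsExchange.symm {A B C D : ℂ} (h : IsExchange a S T T' A B C D) :
    IsExchange a S T' T C D A B where
  quad := h.quad.symm
  left := h.left'
  right := h.right'
  left' := h.left
  right' := h.right
  sdiff_eq := h.sdiff_eq.symm

lemma IsNonCrossing.openSegment_notMem (hT : IsNonCrossing a S T) (ha : a ≠ 0) {A B z : ℂ}
    (hs : IsShortest a A B) (hAB : edge a A B ∈ T) (hz : z ∈ openSegment ℝ A B) :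
    proj a z ∉ S := by
  intro hzS
  have hne := hT.ne ha hs hAB
  rcases hT.eq_end ha hs hAB (openSegment_subset_segment ℝ A B hz) hzS with h | h
  · exact ne_left_of_mem_openSegment hne hz h
  · exact ne_right_of_mem_openSegment hne hz h

lemma IsNonCrossing.eq_of_openSegment (hT : IsNonCrossing a S T) (ha : a ≠ 0) {A B z : ℂ}
    (hs : IsShortest a A B) (hAB : edge a A B ∈ T) (hz : z ∈ openSegment ℝ A B)
    {e : Sym2 (Cylinder a)} (he : e ∈ T) (hze : proj a z ∈ carrier a e) : e = edge a A B := by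
  by_contra hne
  have := (hT.inter_segments e he _ hAB hne _ hze
    (by rw [carrier_edge ha hs]; exact mem_image_of_mem _ (openSegment_subset_segment ℝ A B hz))).2
  exact hT.openSegment_notMem ha hs hAB hz (hT.ends_mem _ hAB _ this)

/-- The interior of the quadrangle of two triangles meets only their common side. -/
lemma avoid_of_mem_quadInterior (hT : IsNonCrossing a S T) (ha : a ≠ 0) {A B C D z : ℂ}
    (h₁ : IsTriangle a S T A B C) (h₂ : IsTriangle a S T A B D) (hz : z ∈ quadInterior A B C D) :
    proj a z ∉ S ∧ ∀ e ∈ T, proj a z ∈ carrier a e → e = edge a A B := by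
  rcases hz with (hz | hz) | hz
  · have := h₁.notMem_skeleton hz
    exact ⟨fun h => this (Or.inl h), fun e he h => absurd (Or.inr (mem_iUnion₂.2 ⟨e, he, h⟩)) this⟩
  · exact ⟨hT.openSegment_notMem ha h₁.shortest_AB h₁.mem_AB hz,
      fun e he h => hT.eq_of_openSegment ha h₁.shortest_AB h₁.mem_AB hz he h⟩
  · have := h₂.notMem_skeleton hz
    exact ⟨fun h => this (Or.inl h), fun e he h => absurd (Or.inr (mem_iUnion₂.2 ⟨e, he, h⟩)) this⟩

/-- The inner points of the new diagonal lie in the interior of the quadrangle, where the skeleton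
consists of inner points of `A B` alone. -/
lemma isNonCrossing_flip (hT : IsNonCrossing a S T) (ha : a ≠ 0) {A B C D : ℂ}
    (h₁ : IsTriangle a S T A B C) (h₂ : IsTriangle a S T A B D) (hs : IsShortest a C D)
    (hq : Quad A B C D) : IsNonCrossing a S (T \ {edge a A B} ∪ {edge a C D}) := by
  have hCS : proj a C ∈ S := hT.proj_right_mem h₁.mem_BC
  have hDS : proj a D ∈ S := hT.proj_right_mem h₂.mem_BC
  have hav : ∀ {z}, z ∈ openSegment ℝ C D →
      proj a z ∉ S ∧ ∀ e ∈ T, proj a z ∈ carrier a e → e = edge a A B :=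
    fun hz => avoid_of_mem_quadInterior hT ha h₁ h₂ (hq.openSegment_subset hz)
  have hpt : ∀ p ∈ carrier a (edge a C D), p ∈ S → p ∈ edge a C D := by
    intro p hp hpS
    rw [carrier_edge ha hs] at hp
    obtain ⟨z, hz, rfl⟩ := hp
    rcases ends_or_openSegment hz with rfl | rfl | hz
    · exact Sym2.mem_mk_left _ _
    · exact Sym2.mem_mk_right _ _
    · exact absurd hpS (hav hz).1
  have hx : ∀ f ∈ T, f ≠ edge a A B → ∀ p ∈ carrier a (edge a C D), p ∈ carrier a f →
      p ∈ edge a C D ∧ p ∈ f := by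
    intro f hf hne p hp hpf
    have hpS : p ∈ S := by
      rw [carrier_edge ha hs] at hp
      obtain ⟨z, hz, rfl⟩ := hp
      rcases ends_or_openSegment hz with rfl | rfl | hz
      · exact hCS
      · exact hDS
      · exact absurd ((hav hz).2 f hf hpf) hne
    exact ⟨hpt p hp hpS, hT.inter_points f hf p hpf hpS⟩
  constructor
  · rintro e (he | rfl)
    · exact hT.isSegment e he.1
    · exact ⟨C, D, ne_of_ori_ne hq.symm.ori₁, hs, rfl⟩
  · rintro e (he | rfl) p hp
    · exact hT.ends_mem e he.1 p hp
    · rcases Sym2.mem_iff.1 hp with rfl | rfl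
      · exact hCS
      · exact hDS
  · rintro e (he | rfl)
    · exact hT.inter_points e he.1
    · exact hpt
  · rintro e (he | rfl) f (hf | rfl) hne p hpe hpf
    · exact hT.inter_segments e he.1 f hf.1 hne p hpe hpf
    · exact (hx e he.1 he.2 p hpf hpe).symm
    · exact hx f hf.1 hf.2 p hpe hpf
    · exact absurd rfl hne

/-- The flip is recast as a relation symmetric in the two triangulations, so that later inclusions
need proof in one direction only. -/
lemma isExchange_flip (hT : IsNonCrossing a S T) (ha : a ≠ 0) {A B C D : ℂ}
    (h₁ : IsTriangle a S T A B C) (h₂ : IsTriangle a S T A B D) (hs : IsShortest a C D)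
    (hq : Quad A B C D) : IsExchange a S T (T \ {edge a A B} ∪ {edge a C D}) A B C D := by
  have hT' := isNonCrossing_flip hT ha h₁ h₂ hs hq
  have hCD : edge a C D ∉ T := by
    intro h
    obtain ⟨p, hp, hp'⟩ := hq.cross
    have he := hT.eq_of_openSegment ha h₁.shortest_AB h₁.mem_AB hp h
      (by rw [carrier_edge ha hs]; exact mem_image_of_mem _ (openSegment_subset_segment ℝ C D hp'))
    have h0 := hq.ori₁
    rcases eq_of_edge_eq ha h₁.shortest_AB hs he (openSegment_subset_segment ℝ A B hp)
      (openSegment_subset_segment ℝ C D hp') with ⟨rfl, -⟩ | ⟨rfl, -⟩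
    · exact h0 (ori_left _ _)
    · exact h0 (ori_right _ _)
  have hS : ∀ z ∈ quadInterior C D A B, proj a z ∉ S := by
    intro z hz
    rw [hq.quadInterior_eq] at hz
    exact (avoid_of_mem_quadInterior hT ha h₁ h₂ hz).1
  refine ⟨hq, h₁, h₂, ?_, ?_, ?_⟩
  · refine hT'.isTriangle ha hq.symm.ori₁ hs (h₂.shortest_CA) (h₁.shortest_CA.symm ha) (Or.inr rfl)
      (Or.inl ⟨h₂.mem_CA, h₂.edge_CA_ne ha⟩) ?_ fun z hz => hS z (Or.inl (Or.inl hz))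
    rw [edge_comm A C]
    exact Or.inl ⟨h₁.mem_CA, h₁.edge_CA_ne ha⟩
  · refine hT'.isTriangle ha hq.symm.ori₂ hs (h₂.shortest_BC.symm ha) h₁.shortest_BC (Or.inr rfl)
      ?_ (Or.inl ⟨h₁.mem_BC, h₁.edge_BC_ne ha⟩) fun z hz => hS z (Or.inr hz)
    rw [edge_comm D B]
    exact Or.inl ⟨h₂.mem_BC, h₂.edge_BC_ne ha⟩
  · ext e
    simp only [Set.mem_sdiff, mem_union, mem_singleton_iff]
    constructor
    · rintro ⟨h1, h2⟩
      exact ⟨Or.inl ⟨h1, h2⟩, fun h => hCD (h ▸ h1)⟩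
    · rintro ⟨h1 | h1, h2⟩
      · exact h1
      · exact absurd h1 h2

/-- After translation to the lift `A B`, the apex lies on the side of `C` or of `D`, and each side
carries only one triangle. -/
lemma IsExchange.apex {A B C D X Y Z : ℂ} (h : IsExchange a S T T' A B C D) (ha : a ≠ 0)
    (hX : IsTriangle a S T X Y Z) (he : edge a X Y = edge a A B) :
    ∃ n : ℤ, (C = Z + n • a ∨ D = Z + n • a) ∧
      ((A = X + n • a ∧ B = Y + n • a) ∨ (A = Y + n • a ∧ B = X + n • a)) := by
  obtain ⟨n, hn, hn'⟩ := hX.move ha h.left.shortest_AB he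
  refine ⟨n, ?_, hn'⟩
  have h1 := h.quad.ori_mul_neg
  have h2 := hn.ori_ne
  rcases lt_or_gt_of_ne (mul_ne_zero h.quad.ori₁ h2) with h3 | h3
  · right
    refine hn.apex_unique h.right ?_
    by_contra hc
    have := mul_self_pos.2 h2
    have := mul_self_pos.2 h.quad.ori₁
    have h4 := h.quad.ori₂
    rcases lt_or_gt_of_ne h.quad.ori₁ with h5 | h5
    · have h6 : 0 < ori A B D := by by_contra; nlinarith
      have h7 : 0 < ori A B (Z + n • a) := by by_contra; nlinarith
      exact hc (mul_pos h7 h6)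
    · have h6 : ori A B D < 0 := by by_contra; nlinarith
      have h7 : ori A B (Z + n • a) < 0 := by by_contra; nlinarith
      exact hc (mul_pos_of_neg_of_neg h7 h6)
  · exact Or.inl (hn.apex_unique h.left (by rwa [mul_comm]))

lemma IsExchange.openTriangle_eq {A B C D X Y Z : ℂ} (h : IsExchange a S T T' A B C D) (ha : a ≠ 0)
    (hX : IsTriangle a S T X Y Z) (he : edge a X Y = edge a A B) :
    openTriangle a X Y Z = openTriangle a A B C ∨ openTriangle a X Y Z = openTriangle a A B D := by
  obtain ⟨n, hn, hn'⟩ := h.apex ha hX he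
  have := openTriangle_add_zsmul (a := a) hX.ori_ne n
  rcases hn with rfl | rfl <;> rcases hn' with ⟨rfl, rfl⟩ | ⟨rfl, rfl⟩
  · exact Or.inl this.symm
  · rw [openTriangle_swap (X + n • a)]; exact Or.inl this.symm
  · exact Or.inr this.symm
  · rw [openTriangle_swap (X + n • a) (Y + n • a) (Z + n • a)]; exact Or.inr this.symm

lemma IsExchange.skeleton_subset {A B C D : ℂ} (h : IsExchange a S T T' A B C D) (ha : a ≠ 0)
    (hT : IsNonCrossing a S T) :
    skeleton a S T ⊆ skeleton a S T' ∪ proj a '' quadInterior A B C D := by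
  rintro x (hx | hx)
  · exact Or.inl (Or.inl hx)
  · obtain ⟨e, he, hx⟩ := mem_iUnion₂.1 hx
    by_cases hAB : e = edge a A B
    · subst hAB
      rw [carrier_edge ha h.left.shortest_AB] at hx
      obtain ⟨z, hz, rfl⟩ := hx
      rcases ends_or_openSegment hz with rfl | rfl | hz
      · exact Or.inl (Or.inl (hT.proj_left_mem h.left.mem_AB))
      · exact Or.inl (Or.inl (hT.proj_right_mem h.left.mem_AB))
      · exact Or.inr ⟨z, Or.inl (Or.inr hz), rfl⟩
    · have : e ∈ T' \ {edge a C D} := h.sdiff_eq ▸ ⟨he, hAB⟩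
      exact Or.inl (Or.inr (mem_iUnion₂.2 ⟨e, this.1, hx⟩))

lemma IsExchange.skeleton_union_eq {A B C D : ℂ} (h : IsExchange a S T T' A B C D) (ha : a ≠ 0)
    (hT : IsNonCrossing a S T) (hT' : IsNonCrossing a S T') :
    skeleton a S T ∪ proj a '' quadInterior A B C D =
      skeleton a S T' ∪ proj a '' quadInterior A B C D := by
  apply Subset.antisymm
  · exact union_subset (h.skeleton_subset ha hT) subset_union_right
  · have := h.symm.skeleton_subset ha hT'
    rw [h.quad.quadInterior_eq] at this
    exact union_subset this subset_union_right

lemma mem_skeleton_or_of_mem_quadInterior {A B C D : ℂ} (h₁ : IsTriangle a S T A B C)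
    {x : Cylinder a} (hx : x ∈ proj a '' quadInterior A B C D) :
    x ∈ skeleton a S T ∨ x ∈ openTriangle a A B C ∨ x ∈ openTriangle a A B D := by
  obtain ⟨z, (hz | hz) | hz, rfl⟩ := hx
  · exact Or.inr (Or.inl ⟨z, hz, rfl⟩)
  · exact Or.inl (mem_skeleton_of_mem_segment h₁.shortest_AB h₁.mem_AB
      (openSegment_subset_segment ℝ A B hz))
  · exact Or.inr (Or.inr ⟨z, hz, rfl⟩)

/-- A region that enters the quadrangle is one of its two triangles, so the other regions do not
notice when the whole quadrangle is removed. The resulting description no longer depends on the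
diagonal. -/
lemma region_eq_of_notMem_quadInterior (ha : a ≠ 0) {A B C D : ℂ} (h₁ : IsTriangle a S T A B C)
    (h₂ : IsTriangle a S T A B D) {x : Cylinder a} (hx : x ∉ proj a '' quadInterior A B C D) :
    region a S T x =
      connectedComponentIn (skeleton a S T ∪ proj a '' quadInterior A B C D)ᶜ x := by
  by_cases hxs : x ∈ skeleton a S T
  · rw [region, connectedComponentIn_eq_empty (not_not.2 hxs),
      connectedComponentIn_eq_empty (not_not.2 (Or.inl hxs))]
  apply Subset.antisymm
  · refine isPreconnected_connectedComponentIn.subset_connectedComponentIn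
      (mem_connectedComponentIn hxs) ?_
    rintro y hy (hy' | hy')
    · exact connectedComponentIn_subset _ _ hy hy'
    · have hyr : region a S T x = region a S T y := connectedComponentIn_eq hy
      have hxr : x ∈ region a S T y := hyr ▸ mem_connectedComponentIn hxs
      rcases mem_skeleton_or_of_mem_quadInterior h₁ hy' with hy' | hy' | hy'
      · exact connectedComponentIn_subset _ _ hy hy'
      · rw [h₁.region_eq ha hy'] at hxr
        exact hx (image_mono (fun z hz => Or.inl (Or.inl hz)) hxr)
      · rw [h₂.region_eq ha hy'] at hxr
        exact hx (image_mono (fun z hz => Or.inr hz) hxr)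
  · exact connectedComponentIn_mono _ (compl_subset_compl.2 subset_union_left)

lemma IsExchange.region_eq {A B C D : ℂ} (h : IsExchange a S T T' A B C D) (ha : a ≠ 0)
    (hT : IsNonCrossing a S T) (hT' : IsNonCrossing a S T') {x : Cylinder a}
    (hx : x ∉ proj a '' quadInterior A B C D) : region a S T x = region a S T' x := by
  rw [region_eq_of_notMem_quadInterior ha h.left h.right hx, h.skeleton_union_eq ha hT hT',
    ← h.quad.quadInterior_eq, ← region_eq_of_notMem_quadInterior ha h.left' h.right']
  rwa [h.quad.quadInterior_eq]

/-- A segment that could be added to `T'` misses the open diagonal `A B`, which is covered by the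
two new triangles and by `C D`. It could then be added to `T` as well, so it already belongs to `T`.
-/
lemma IsExchange.maximal {A B C D : ℂ} (h : IsExchange a S T T' A B C D) (ha : a ≠ 0)
    (hT : Maximal (IsNonCrossing a S) T) (hT' : IsNonCrossing a S T') :
    Maximal (IsNonCrossing a S) T' := by
  refine ⟨hT', fun T'' hT'' hle e he => ?_⟩
  by_contra heT'
  have hold : ∀ f ∈ T, f ≠ edge a A B → f ∈ T'' := by
    intro f hf hne
    have : f ∈ T' \ {edge a C D} := h.sdiff_eq ▸ ⟨hf, hne⟩
    exact hle this.1
  have hCD : edge a C D ∈ T'' := hle h.left'.mem_AB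
  have heCD : e ≠ edge a C D := fun hc => heT' (hc ▸ h.left'.mem_AB)
  have hzav : ∀ z ∈ openSegment ℝ A B, proj a z ∉ carrier a e := by
    intro z hz hze
    obtain ⟨P, Q, -, sPQ, rfl, hzPQ⟩ := exists_lift ha (hT''.isSegment e he) hze
    rcases h.quad.symm.openSegment_subset hz with (hz | hz) | hz
    · exact hT''.notMem_interior ha h.left'.ori_ne h.left'.shortest_AB h.left'.shortest_BC
        h.left'.shortest_CA (hle h.left'.mem_AB) (hle h.left'.mem_BC) (hle h.left'.mem_CA)
        (fun z hz hc => h.left'.notMem_skeleton hz (Or.inl hc)) sPQ he hzPQ hz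
    · exact heCD (hT''.eq_of_openSegment ha h.left'.shortest_AB hCD hz he hze)
    · exact hT''.notMem_interior ha h.right'.ori_ne h.right'.shortest_AB h.right'.shortest_BC
        h.right'.shortest_CA (hle h.right'.mem_AB) (hle h.right'.mem_BC) (hle h.right'.mem_CA)
        (fun z hz hc => h.right'.notMem_skeleton hz (Or.inl hc)) sPQ he hzPQ hz
  have hx : ∀ f ∈ T, e ≠ f → ∀ p ∈ carrier a e, p ∈ carrier a f → p ∈ e ∧ p ∈ f := by
    intro f hf hne p hpe hpf
    by_cases hAB : f = edge a A B
    · subst hAB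
      have hpS : p ∈ S := by
        have hpf' := hpf
        rw [carrier_edge ha h.left.shortest_AB] at hpf'
        obtain ⟨z, hz, rfl⟩ := hpf'
        rcases ends_or_openSegment hz with rfl | rfl | hz
        · exact hT.prop.proj_left_mem hf
        · exact hT.prop.proj_right_mem hf
        · exact absurd hpe (hzav z hz)
      exact ⟨hT''.inter_points e he p hpe hpS, hT.prop.inter_points _ hf p hpf hpS⟩
    · exact hT''.inter_segments e he f (hold f hf hAB) hne p hpe hpf
  have hins : IsNonCrossing a S (insert e T) := by
    constructor
    · rintro f (rfl | hf)
      · exact hT''.isSegment _ he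
      · exact hT.prop.isSegment f hf
    · rintro f (rfl | hf)
      · exact hT''.ends_mem _ he
      · exact hT.prop.ends_mem f hf
    · rintro f (rfl | hf)
      · exact hT''.inter_points _ he
      · exact hT.prop.inter_points f hf
    · rintro f (rfl | hf) g (rfl | hg) hne p hpf hpg
      · exact absurd rfl hne
      · exact hx g hg hne p hpf hpg
      · exact (hx f hf hne.symm p hpg hpf).symm
      · exact hT.prop.inter_segments f hf g hg hne p hpf hpg
  have heT : e ∈ T := hT.2 hins (subset_insert _ _) (mem_insert _ _)
  by_cases hAB : e = edge a A B
  · subst hAB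
    obtain ⟨p, hp, -⟩ := h.quad.cross
    refine hzav p hp ?_
    rw [carrier_edge ha h.left.shortest_AB]
    exact mem_image_of_mem _ (openSegment_subset_segment ℝ A B hp)
  · have : e ∈ T' \ {edge a C D} := h.sdiff_eq ▸ ⟨heT, hAB⟩
    exact heT' this.1

lemma IsExchange.isTriangulation {A B C D : ℂ} (h : IsExchange a S T T' A B C D) (ha : a ≠ 0)
    (hT : IsTriangulation a S T) (hT' : IsNonCrossing a S T') : IsTriangulation a S T' := by
  refine ⟨h.maximal ha hT.maximal hT', fun x hx hb => ?_⟩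
  by_cases h1 : x ∈ openTriangle a C D A
  · exact ⟨C, D, A, h.left', h.left'.region_eq ha h1⟩
  by_cases h2 : x ∈ openTriangle a C D B
  · exact ⟨C, D, B, h.right', h.right'.region_eq ha h2⟩
  have hxW : x ∉ proj a '' quadInterior A B C D := by
    rw [← h.quad.quadInterior_eq]
    intro hc
    rcases mem_skeleton_or_of_mem_quadInterior h.left' hc with hc | hc | hc
    · exact hx hc
    · exact h1 hc
    · exact h2 hc
  have hr := h.region_eq ha hT.maximal.prop hT' hxW
  have hxT : x ∈ (skeleton a S T)ᶜ := by
    intro hc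
    rcases h.skeleton_subset ha hT.maximal.prop hc with hc | hc
    · exact hx hc
    · exact hxW hc
  obtain ⟨X, Y, Z, hX, hXr⟩ := hT.triangular x hxT (hr ▸ hb)
  have hxX : x ∈ openTriangle a X Y Z := hXr ▸ mem_connectedComponentIn hxT
  -- The only side that could have been lost is `A B`, but the triangles over it lie in the
  -- quadrangle, and `x` does not.
  have side : ∀ {X Y Z : ℂ}, IsTriangle a S T X Y Z → x ∈ openTriangle a X Y Z →
      edge a X Y ∈ T' := by
    intro X Y Z hX hxX
    by_cases he : edge a X Y = edge a A B
    · exfalso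
      rcases h.openTriangle_eq ha hX he with h3 | h3 <;> rw [h3] at hxX
      · exact hxW (image_mono (fun z hz => Or.inl (Or.inl hz)) hxX)
      · exact hxW (image_mono (fun z hz => Or.inr hz) hxX)
    · have : edge a X Y ∈ T' \ {edge a C D} := h.sdiff_eq ▸ ⟨hX.mem_AB, he⟩
      exact this.1
  refine ⟨X, Y, Z, ⟨hX.affineIndependent, hX.shortest_AB, hX.shortest_BC, hX.shortest_CA,
    side hX hxX, side hX.rotate (by rwa [openTriangle_rotate]),
    side hX.rotate.rotate (by rwa [openTriangle_rotate, openTriangle_rotate]), ?_⟩, hr ▸ hXr⟩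
  rw [← hXr, hr, disjoint_left]
  exact fun y hy => connectedComponentIn_subset _ _ hy

/-! ### Boundaries -/

/-- The union of the regions with property `P`. -/
def regionUnion (a : ℂ) (S : Set (Cylinder a)) (P : Set (Cylinder a) → Prop)
    (T : Set (Sym2 (Cylinder a))) : Set (Cylinder a) :=
  {x | P (region a S T x)}

/-- The segments along the boundary of the union of the regions with property `P`. -/
def boundary (a : ℂ) (S : Set (Cylinder a)) (P : Set (Cylinder a) → Prop)
    (T : Set (Sym2 (Cylinder a))) : Set (Sym2 (Cylinder a)) :=
  {e ∈ T | carrier a e ⊆ frontier (regionUnion a S P T)}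

/-- A property of sets that holds neither for the empty set nor for open triangles. -/
structure IsOuter (a : ℂ) (P : Set (Cylinder a) → Prop) : Prop where
  empty : ¬P ∅
  triangle : ∀ A B C, ¬P (openTriangle a A B C)

/-- Unboundedness upwards. -/
def Upward (a : ℂ) (R : Set (Cylinder a)) : Prop := ∀ M : ℝ, ∃ z : ℂ, proj a z ∈ R ∧ M < (z / a).im

/-- Unboundedness downwards. -/
def Downward (a : ℂ) (R : Set (Cylinder a)) : Prop :=
  ∀ M : ℝ, ∃ z : ℂ, proj a z ∈ R ∧ (z / a).im < M

lemma exists_im_bound (ha : a ≠ 0) (A B C : ℂ) :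
    ∃ M : ℝ, ∀ z, proj a z ∈ openTriangle a A B C → |(z / a).im| ≤ M := by
  obtain ⟨M, hM⟩ := (((Set.toFinite {A, B, C}).isCompact_convexHull ℝ).image
    (f := fun z : ℂ => (z / a).im) (by fun_prop)).isBounded.exists_norm_le
  refine ⟨M, ?_⟩
  rintro z ⟨w, hw, he⟩
  obtain ⟨n, rfl⟩ := proj_eq_iff.1 he
  rw [im_add_zsmul ha]
  exact hM _ (mem_image_of_mem _ (_root_.interior_subset hw))

lemma isOuter_upward (ha : a ≠ 0) : IsOuter a (Upward a) where
  empty h := by obtain ⟨z, hz, -⟩ := h 0; exact hz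
  triangle A B C h := by
    obtain ⟨M, hM⟩ := exists_im_bound ha A B C
    obtain ⟨z, hz, hzM⟩ := h M
    exact absurd (hM z hz) (not_le.2 (hzM.trans_le (le_abs_self _)))

lemma isOuter_downward (ha : a ≠ 0) : IsOuter a (Downward a) where
  empty h := by obtain ⟨z, hz, -⟩ := h 0; exact hz
  triangle A B C h := by
    obtain ⟨M, hM⟩ := exists_im_bound ha A B C
    obtain ⟨z, hz, hzM⟩ := h (-M)
    have := neg_abs_le (z / a).im
    linarith [hM z hz]

lemma region_eq_empty {x : Cylinder a} (hx : x ∈ skeleton a S T) : region a S T x = ∅ :=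
  connectedComponentIn_eq_empty (not_not.2 hx)

lemma IsOuter.disjoint_quad (hP : IsOuter a P) (ha : a ≠ 0) {A B C D : ℂ}
    (h₁ : IsTriangle a S T A B C) (h₂ : IsTriangle a S T A B D) {x : Cylinder a}
    (hx : x ∈ proj a '' quadInterior A B C D) : x ∉ regionUnion a S P T := by
  intro (h : P _)
  rcases mem_skeleton_or_of_mem_quadInterior h₁ hx with h3 | h3 | h3
  · rw [region_eq_empty h3] at h; exact hP.empty h
  · rw [h₁.region_eq ha h3] at h; exact hP.triangle _ _ _ h
  · rw [h₂.region_eq ha h3] at h; exact hP.triangle _ _ _ h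

lemma IsExchange.regionUnion_eq {A B C D : ℂ} (h : IsExchange a S T T' A B C D) (ha : a ≠ 0)
    (hT : IsNonCrossing a S T) (hT' : IsNonCrossing a S T') (hP : IsOuter a P) :
    regionUnion a S P T = regionUnion a S P T' := by
  ext x
  by_cases hx : x ∈ proj a '' quadInterior A B C D
  · exact iff_of_false (hP.disjoint_quad ha h.left h.right hx)
      (hP.disjoint_quad ha h.left' h.right' (by rwa [h.quad.quadInterior_eq]))
  · simp only [regionUnion, mem_ofPred_eq, h.region_eq ha hT hT' hx]

/-- Some point of `A B` has an open neighbourhood inside the quadrangle, which is disjoint from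
every outer region. -/
lemma IsExchange.notMem_boundary {A B C D : ℂ} (h : IsExchange a S T T' A B C D) (ha : a ≠ 0)
    (hP : IsOuter a P) : edge a A B ∉ boundary a S P T := by
  rintro ⟨-, hc⟩
  obtain ⟨z, hz, hz'⟩ := h.quad.exists_mem_openSegment
  have h1 : proj a z ∈ closure (regionUnion a S P T) := frontier_subset_closure <| hc <| by
    rw [carrier_edge ha h.left.shortest_AB]
    exact mem_image_of_mem _ (openSegment_subset_segment ℝ A B hz)
  obtain ⟨y, hy, hy'⟩ := mem_closure_iff.1 h1 _ (isOpen_openTriangle C D A) (mem_image_of_mem _ hz')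
  exact hP.disjoint_quad ha h.left h.right (image_mono h.quad.interior_subset hy) hy'

lemma IsExchange.boundary_subset {A B C D : ℂ} (h : IsExchange a S T T' A B C D) (ha : a ≠ 0)
    (hT : IsNonCrossing a S T) (hT' : IsNonCrossing a S T') (hP : IsOuter a P) :
    boundary a S P T ⊆ boundary a S P T' := by
  intro e he
  have hne : e ≠ edge a A B := fun hc => h.notMem_boundary ha hP (hc ▸ he)
  have : e ∈ T' \ {edge a C D} := h.sdiff_eq ▸ ⟨he.1, hne⟩
  exact ⟨this.1, h.regionUnion_eq ha hT hT' hP ▸ he.2⟩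

lemma IsExchange.boundary_eq {A B C D : ℂ} (h : IsExchange a S T T' A B C D) (ha : a ≠ 0)
    (hT : IsNonCrossing a S T) (hT' : IsNonCrossing a S T') (hP : IsOuter a P) :
    boundary a S P T = boundary a S P T' :=
  (h.boundary_subset ha hT hT' hP).antisymm (h.symm.boundary_subset ha hT' hT hP)

lemma IsFlip.boundary_eq (ha : a ≠ 0) (hT : IsNonCrossing a S T) (h : IsFlip a S T T')
    (hP : IsOuter a P) : boundary a S P T = boundary a S P T' := by
  obtain ⟨A, B, C, D, h₁, h₂, hs, hc, rfl⟩ := h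
  have hq : Quad A B C D := ⟨h₁.ori_ne, h₂.ori_ne, hc⟩
  exact (isExchange_flip hT ha h₁ h₂ hs hq).boundary_eq ha hT
    (isNonCrossing_flip hT ha h₁ h₂ hs hq) hP

lemma boundary_eq_of_reachable (ha : a ≠ 0) {T₁ T₂ : Triangulation a S}
    (h : (flipGraph a S).Reachable T₁ T₂) (hP : IsOuter a P) :
    boundary a S P T₁.1 = boundary a S P T₂.1 := by
  obtain ⟨w⟩ := h
  induction w with
  | nil => rfl
  | @cons U V _ hadj _ ih =>
    rw [← ih]
    rcases (SimpleGraph.fromRel_adj _ _ _).1 hadj with ⟨-, h | h⟩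
    · exact h.boundary_eq ha U.2.maximal.prop hP
    · exact (h.boundary_eq ha V.2.maximal.prop hP).symm


/-! ### The sides of a segment of a triangulation -/

lemma finite_sym2 {α : Type*} {S : Set α} (hS : S.Finite) :
    {e : Sym2 α | ∀ p ∈ e, p ∈ S}.Finite := by
  refine ((hS.prod hS).image (fun q : α × α => s(q.1, q.2))).subset fun e => ?_
  induction e with
  | _ p q =>
    intro he
    exact ⟨(p, q), ⟨he p (Sym2.mem_mk_left _ _), he q (Sym2.mem_mk_right _ _)⟩, rfl⟩

lemma IsNonCrossing.finite (hT : IsNonCrossing a S T) (hS : S.Finite) : T.Finite :=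
  (finite_sym2 hS).subset hT.ends_mem

lemma hor_sub_le_of_mem_segment {A B z w : ℂ} (hz : z ∈ segment ℝ A B) (hw : w ∈ segment ℝ A B) :
    |hor a z - hor a w| ≤ |hor a B - hor a A| := by
  obtain ⟨s, t, hs, ht, hst, rfl⟩ := hz
  obtain ⟨u, v, hu, hv, huv, rfl⟩ := hw
  obtain rfl : s = 1 - t := by linarith
  obtain rfl : u = 1 - v := by linarith
  simp only [hor_add, hor_smul]
  rw [show (1 - t) * hor a A + t * hor a B - ((1 - v) * hor a A + v * hor a B)
    = (t - v) * (hor a B - hor a A) by ring, abs_mul]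
  refine mul_le_of_le_one_left (abs_nonneg _) ?_
  rw [abs_le]; constructor <;> linarith

lemma continuous_hor : Continuous (hor a) := by unfold hor; fun_prop

lemma isClosed_carrier (ha : a ≠ 0) {e : Sym2 (Cylinder a)} (he : IsSegment a e) :
    IsClosed (carrier a e) := by
  have := t2Space ha
  obtain ⟨A, B, -, hs, rfl⟩ := he
  exact (isCompact_carrier ha hs).isClosed

/-- By finiteness, the points of `S` and the other segments form a closed set that misses `p`. Close
to `p`, the only lift of the segment itself is `C D`, which does not enter the open half plane. -/
lemma exists_halfBall (ha : a ≠ 0) (hS : S.Finite) (hT : IsNonCrossing a S T) {C D p : ℂ}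
    (hs : IsShortest a C D) (hCD : edge a C D ∈ T) (hp : p ∈ openSegment ℝ C D) :
    ∃ r > 0, ∀ z ∈ Metric.ball p r, 0 < ori C D z → proj a z ∉ skeleton a S T := by
  have := t2Space ha
  set K : Set (Cylinder a) := S ∪ ⋃ e ∈ T \ {edge a C D}, carrier a e with hK
  have hKc : IsClosed K := hS.isClosed.union
    (((hT.finite hS).subset sdiff_subset).isClosed_biUnion
      fun e he => isClosed_carrier ha (hT.isSegment e he.1))
  have hpK : proj a p ∉ K := by
    rintro (h | h)
    · exact hT.openSegment_notMem ha hs hCD hp h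
    · obtain ⟨e, he, h⟩ := mem_iUnion₂.1 h
      exact he.2 (hT.eq_of_openSegment ha hs hCD hp he.1 h)
  have h1 : ∀ᶠ z in 𝓝 p, proj a z ∉ K :=
    continuous_proj.continuousAt.eventually (hKc.isOpen_compl.mem_nhds hpK)
  have h2 : ∀ᶠ z in 𝓝 p, |hor a z - hor a p| < 1 / 2 := by
    have : Filter.Tendsto (fun z => |hor a z - hor a p|) (𝓝 p) (𝓝 |hor a p - hor a p|) :=
      ((continuous_hor.sub continuous_const).abs).tendsto p
    rw [sub_self, abs_zero] at this
    exact this.eventually_lt_const (by norm_num)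
  obtain ⟨r, hr, h⟩ := Metric.eventually_nhds_iff_ball.1 (h1.and h2)
  refine ⟨r, hr, fun z hz hpos hsk => ?_⟩
  obtain ⟨hzK, hzx⟩ := h z hz
  have hzc : proj a z ∈ carrier a (edge a C D) := by
    rcases hsk with hsk | hsk
    · exact absurd (Or.inl hsk) hzK
    · obtain ⟨e, he, hze⟩ := mem_iUnion₂.1 hsk
      by_cases hc : e = edge a C D
      · exact hc ▸ hze
      · exact absurd (Or.inr (mem_iUnion₂.2 ⟨e, ⟨he, hc⟩, hze⟩)) hzK
  obtain ⟨n, hn⟩ := (mem_carrier_edge ha hs).1 hzc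
  have h3 := (hor_sub_le_of_mem_segment (a := a) hn
    (openSegment_subset_segment ℝ C D hp)).trans_lt ((isShortest_iff ha).1 hs)
  rw [hor_add_zsmul ha] at h3
  rw [abs_lt] at h3 hzx
  have hn0 : n = 0 := by
    have : |(n : ℝ)| < 1 := by rw [abs_lt]; constructor <;> linarith [h3.1, h3.2, hzx.1, hzx.2]
    exact Int.abs_lt_one_iff.1 (by exact_mod_cast this)
  rw [hn0, zero_smul, add_zero] at hn
  obtain ⟨s, t, -, -, hst, rfl⟩ := hn
  rw [ori_two _ _ _ _ hst, ori_left, ori_right] at hpos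
  simp at hpos

lemma convex_halfBall (C D p : ℂ) (r : ℝ) :
    Convex ℝ (Metric.ball p r ∩ {z | 0 < ori C D z}) := by
  refine (convex_ball p r).inter fun x hx y hy s t hs ht hst => ?_
  simp only [mem_ofPred_eq] at *
  rw [ori_two _ _ _ _ hst]
  rcases hs.eq_or_lt with rfl | hs
  · obtain rfl : t = 1 := by linarith
    simpa using hy
  · nlinarith [mul_pos hs hx, mul_nonneg ht hy.le]

lemma mem_closure_halfPlane {C D p : ℂ} (hne : C ≠ D) (hp : p ∈ openSegment ℝ C D) :
    p ∈ closure {z | 0 < ori C D z} := by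
  obtain ⟨s, t, -, -, hst, rfl⟩ := hp
  set p := s • C + t • D
  have hpos : ∀ ε : ℝ, 0 < ε → 0 < ori C D (p + ε • (Complex.I * (D - C))) := by
    intro ε hε
    have h0 : ori C D p = 0 := by rw [ori_two _ _ _ _ hst, ori_left, ori_right]; ring
    have : ori C D (p + ε • (Complex.I * (D - C))) = ori C D p + ε * Complex.normSq (D - C) := by
      simp [ori, Complex.normSq_apply]; ring
    rw [this, h0, zero_add]
    exact mul_pos hε (Complex.normSq_pos.2 (sub_ne_zero.2 hne.symm))
  have hlim : Filter.Tendsto (fun ε : ℝ => p + ε • (Complex.I * (D - C))) (𝓝[>] 0) (𝓝 p) := by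
    have : Continuous fun ε : ℝ => p + ε • (Complex.I * (D - C)) := by fun_prop
    simpa using (this.tendsto 0).mono_left nhdsWithin_le_nhds
  exact mem_closure_of_tendsto hlim (Filter.eventually_of_mem self_mem_nhdsWithin hpos)

lemma region_eq_of_isPreconnected {H : Set ℂ} (hH : IsPreconnected H)
    (hd : ∀ z ∈ H, proj a z ∉ skeleton a S T) {z w : ℂ} (hz : z ∈ H) (hw : w ∈ H) :
    region a S T (proj a z) = region a S T (proj a w) := by
  refine connectedComponentIn_eq ?_
  refine (hH.image _ continuous_proj.continuousOn).subset_connectedComponentIn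
    (mem_image_of_mem _ hz) ?_ (mem_image_of_mem _ hw)
  rintro _ ⟨y, hy, rfl⟩
  exact hd y hy

/-- Being flanked on the positive side by the outer region, and being flanked by its complement, are
both open conditions along the open segment. Connectedness spreads the first from `p` to all of it,
and the closure then reaches the ends. -/
lemma IsOuter.mem_boundary (hP : IsOuter a P) (ha : a ≠ 0) (hS : S.Finite)
    (hT : IsNonCrossing a S T) {C D p z : ℂ} {r : ℝ} (hs : IsShortest a C D)
    (hCD : edge a C D ∈ T) (hp : p ∈ openSegment ℝ C D) (hr : 0 < r)
    (hd : ∀ z ∈ Metric.ball p r, 0 < ori C D z → proj a z ∉ skeleton a S T)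
    (hz : z ∈ Metric.ball p r) (hz' : 0 < ori C D z) (hPz : P (region a S T (proj a z))) :
    edge a C D ∈ boundary a S P T := by
  have hne := hT.ne ha hs hCD
  set U := regionUnion a S P T with hU
  have hUs : ∀ x ∈ U, x ∉ skeleton a S T := by
    intro x (hx : P _) hc
    rw [region_eq_empty hc] at hx
    exact hP.empty hx
  -- The parameter is a set of truth values, so that openness is proved once and used for both
  -- `{True}` and `{False}`.
  let Q : Set Prop → Set ℂ := fun R =>
    {p | ∃ r > 0, ∀ z ∈ Metric.ball p r, 0 < ori C D z → (proj a z ∈ U) ∈ R}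
  have hQo : ∀ R, IsOpen (Q R) := by
    intro R
    rw [Metric.isOpen_iff]
    rintro p ⟨r, hr, h⟩
    refine ⟨r / 2, by positivity, fun q hq => ⟨r / 2, by positivity, fun z hz hz' => h z ?_ hz'⟩⟩
    rw [Metric.mem_ball] at *
    linarith [dist_triangle z q p]
  have hcov : ∀ p r, (∀ z ∈ Metric.ball p r, 0 < ori C D z → proj a z ∉ skeleton a S T) →
      ∀ z ∈ Metric.ball p r, 0 < ori C D z → ∀ w ∈ Metric.ball p r, 0 < ori C D w →
      (proj a z ∈ U ↔ proj a w ∈ U) := by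
    intro p r hd z hz hz' w hw hw'
    have := region_eq_of_isPreconnected (convex_halfBall C D p r).isPreconnected
      (fun z hz => hd z hz.1 hz.2) ⟨hz, hz'⟩ ⟨hw, hw'⟩
    rw [hU, regionUnion, mem_ofPred_eq, mem_ofPred_eq, this]
  have hdich : ∀ p ∈ openSegment ℝ C D, p ∈ Q {True} ∪ Q {False} := by
    intro p hp
    obtain ⟨r, hr, hd⟩ := exists_halfBall ha hS hT hs hCD hp
    by_cases h : ∃ z ∈ Metric.ball p r, 0 < ori C D z ∧ proj a z ∈ U
    · obtain ⟨z, hz, hz', hzU⟩ := h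
      left
      exact ⟨r, hr, fun w hw hw' => eq_true ((hcov p r hd z hz hz' w hw hw').1 hzU)⟩
    · push Not at h
      exact Or.inr ⟨r, hr, fun w hw hw' => eq_false (h w hw hw')⟩
  have hhalf : ∀ p ∈ openSegment ℝ C D, ∀ r > 0, ∃ z ∈ Metric.ball p r, 0 < ori C D z := by
    intro p hp r hr
    obtain ⟨z, hz, hz'⟩ := Metric.mem_closure_iff.1 (mem_closure_halfPlane hne hp) r hr
    exact ⟨z, by rwa [Metric.mem_ball, dist_comm], hz⟩
  have hall : ∀ q ∈ openSegment ℝ C D, q ∈ Q {True} := by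
    intro q hq
    by_contra hcon
    obtain ⟨y, hy, ⟨r₁, hr₁, h₁⟩, r₂, hr₂, h₂⟩ :=
      (convex_openSegment C D).isPreconnected (Q {True}) (Q {False}) (hQo _) (hQo _) hdich
        ⟨p, hp, r, hr, fun w hw hw' => eq_true ((hcov p r hd z hz hz' w hw hw').1 hPz)⟩
        ⟨q, hq, (hdich q hq).resolve_left hcon⟩
    obtain ⟨w, hw, hw'⟩ := hhalf y hy (min r₁ r₂) (lt_min hr₁ hr₂)
    have e1 : (proj a w ∈ U) = True := h₁ w (Metric.ball_subset_ball (min_le_left _ _) hw) hw'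
    have e2 : (proj a w ∈ U) = False := h₂ w (Metric.ball_subset_ball (min_le_right _ _) hw) hw'
    rw [e1] at e2
    exact e2 ▸ trivial
  have hcl : openSegment ℝ C D ⊆ closure (proj a ⁻¹' U) := by
    intro q hq
    obtain ⟨r, hr, h⟩ := hall q hq
    rw [Metric.mem_closure_iff]
    intro ε hε
    obtain ⟨w, hw, hw'⟩ := hhalf q hq (min r ε) (lt_min hr hε)
    have hwU : (proj a w ∈ U) = True := h w (Metric.ball_subset_ball (min_le_left _ _) hw) hw'
    refine ⟨w, of_eq_true hwU, ?_⟩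
    rw [dist_comm]
    exact (Metric.mem_ball.1 hw).trans_le (min_le_right _ _)
  refine ⟨hCD, ?_⟩
  rw [carrier_edge ha hs]
  rintro _ ⟨q, hq, rfl⟩
  refine ⟨?_, fun hc => hUs _ (interior_subset hc) (mem_skeleton_of_mem_segment hs hCD hq)⟩
  have : q ∈ closure (proj a ⁻¹' U) := by
    rw [← closure_openSegment] at hq
    exact closure_minimal hcl isClosed_closure hq
  exact continuous_proj.closure_preimage_subset U this

/-- A set of bounded height lies in the image of a compact rectangle of horizontal width 1, a
truncated fundamental domain. -/
lemma upward_or_downward (ha : a ≠ 0) {R : Set (Cylinder a)} (hR : ¬Bornology.IsBounded R) :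
    Upward a R ∨ Downward a R := by
  by_contra hcon
  simp only [Upward, Downward, not_or, not_forall, not_exists, not_and, not_lt] at hcon
  obtain ⟨⟨M, hM⟩, m, hm⟩ := hcon
  apply hR
  have hc : IsCompact ((fun z => proj a (z * a)) '' (Icc (0 : ℝ) 1 ×ℂ Icc m M)) :=
    ((isCompact_Icc).reProdIm isCompact_Icc).image (continuous_proj.comp (by fun_prop))
  refine hc.isBounded.subset fun x hx => ?_
  obtain ⟨z, rfl⟩ := QuotientAddGroup.mk_surjective x
  have e : ((z + (-⌊hor a z⌋) • a) / a).re = Int.fract (hor a z) := by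
    have := hor_add_zsmul ha z (-⌊hor a z⌋)
    rw [hor] at this
    rw [this, Int.fract]
    push_cast
    ring
  refine ⟨(z + (-⌊hor a z⌋) • a) / a, ⟨?_, ?_⟩, ?_⟩
  · rw [mem_preimage, e]
    exact ⟨Int.fract_nonneg _, (Int.fract_lt_one _).le⟩
  · rw [mem_preimage, im_add_zsmul ha]
    exact ⟨hm z hx, hM z hx⟩
  · simp only [div_mul_cancel₀ _ ha]
    exact proj_add_zsmul _ _

/-- A segment of a triangulation that is not on its boundary has a triangle on either side. -/
lemma IsTriangulation.exists_triangle (hT : IsTriangulation a S T) (ha : a ≠ 0) (hS : S.Finite)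
    {C D : ℂ} (hs : IsShortest a C D) (hCD : edge a C D ∈ T)
    (hup : edge a C D ∉ boundary a S (Upward a) T)
    (hdown : edge a C D ∉ boundary a S (Downward a) T) :
    ∃ E, IsTriangle a S T C D E ∧ 0 < ori C D E := by
  have hnc := hT.maximal.prop
  have hne := hnc.ne ha hs hCD
  set p := (1 / 2 : ℝ) • C + (1 / 2 : ℝ) • D with hpdef
  have hp : p ∈ openSegment ℝ C D := ⟨_, _, by norm_num, by norm_num, by norm_num, rfl⟩
  obtain ⟨r, hr, hd⟩ := exists_halfBall ha hS hnc hs hCD hp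
  have hpH : p ∈ closure (Metric.ball p r ∩ {z | 0 < ori C D z}) :=
    Metric.isOpen_ball.inter_closure ⟨Metric.mem_ball_self hr, mem_closure_halfPlane hne hp⟩
  obtain ⟨z, hz, hz'⟩ := closure_nonempty_iff.1 ⟨p, hpH⟩
  by_cases hb : Bornology.IsBounded (region a S T (proj a z))
  · obtain ⟨X, Y, Z, hX, hr⟩ := hT.triangular _ (hd z hz hz') hb
    have hzr : proj a z ∈ openTriangle a X Y Z := hr ▸ mem_connectedComponentIn (hd z hz hz')
    obtain ⟨w, hw, he⟩ := hzr
    obtain ⟨n, rfl⟩ := proj_eq_iff.1 he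
    have key : ∀ {X Y Z : ℂ}, IsTriangle a S T X Y Z →
        w + n • a ∈ interior (convexHull ℝ {X, Y, Z}) → p ∈ segment ℝ X Y →
        ∃ E, IsTriangle a S T C D E ∧ 0 < ori C D E := by
      intro X Y Z hX hw hpXY
      have aux : ∀ {Z : ℂ}, IsTriangle a S T C D Z →
          w + n • a ∈ interior (convexHull ℝ {C, D, Z}) →
          ∃ E, IsTriangle a S T C D E ∧ 0 < ori C D E := by
        intro Z hX hw
        refine ⟨Z, hX, ?_⟩
        obtain ⟨α, β, γ, -, -, hγ, hsum, e⟩ := (mem_interior_triangle hX.ori_ne).1 hw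
        have h1 : 0 < γ * ori C D Z := ori_of_bary hsum e ▸ hz'
        exact (pos_iff_pos_of_mul_pos h1).1 hγ
      rcases hnc.meet ha hs hCD hX.shortest_AB hX.mem_AB (openSegment_subset_segment ℝ C D hp) hpXY
        with (⟨rfl, rfl⟩ | ⟨rfl, rfl⟩) | ⟨h1, -⟩
      · exact aux hX hw
      · exact aux (hX.swap ha) (by rwa [triple_swap])
      · rcases h1 with h1 | h1
        · exact absurd h1 (ne_left_of_mem_openSegment hne hp)
        · exact absurd h1 (ne_right_of_mem_openSegment hne hp)
    have hX' := hX.add_zsmul ha n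
    have hw' := mem_interior_add (t := n • a) hX.ori_ne hw
    -- The half disc at `p` lies in the triangle, so `p` is in the closed triangle. Being on the
    -- skeleton it is not interior, hence it is on a side, and that side can only be `C D`.
    have hsub := subset_interior_triangle hX'.ori_ne (convex_halfBall C D p r).isPreconnected
      ⟨_, ⟨hz, hz'⟩, hw'⟩ (fun z hz hc => hd z hz.1 hz.2 (hX'.side_mem_skeleton hc))
    have hpc := closure_minimal (hsub.trans interior_subset) (isClosed_triangle _ _ _) hpH
    have hpi : p ∉ interior (convexHull ℝ {X + n • a, Y + n • a, Z + n • a}) := fun hc =>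
      hX'.notMem_skeleton hc
        (mem_skeleton_of_mem_segment hs hCD (openSegment_subset_segment ℝ C D hp))
    rcases mem_side_of_mem_convexHull hX'.ori_ne hpc hpi with h1 | h1 | h1
    · exact key hX' hw' h1
    · exact key hX'.rotate (by rwa [← triple_rotate]) h1
    · exact key hX'.rotate.rotate (by rwa [← triple_rotate, ← triple_rotate]) h1
  · exfalso
    rcases upward_or_downward ha hb with h | h
    · exact hup ((isOuter_upward ha).mem_boundary ha hS hnc hs hCD hp hr hd hz hz' h)
    · exact hdown ((isOuter_downward ha).mem_boundary ha hS hnc hs hCD hp hr hd hz hz' h)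


/-! ### Weights of the points -/

/-- A weight function on the plane, for which the flips that lower the lifted surface over a
triangulation are allowed on the cylinder, and no ties occur. -/
structure IsWeight (a : ℂ) (S : Set (Cylinder a)) (w : ℂ → ℝ) : Prop where
  add_zsmul : ∀ z, ∀ n : ℤ, w (z + n • a) = w z + 2 * n * hor a z + n ^ 2
  ne : ∀ {A B C D : ℂ}, proj a A ∈ S → proj a B ∈ S → proj a C ∈ S → proj a D ∈ S →
    IsShortest a A B → IsShortest a C D → Quad A B C D →
    ∀ {l m s t : ℝ}, 0 < l → 0 < m → 0 < s → 0 < t → l + m = 1 → s + t = 1 →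
    l • A + m • B = s • C + t • D → l * w A + m * w B ≠ s * w C + t * w D
  shortest : ∀ {A B C D : ℂ}, proj a A ∈ S → proj a B ∈ S → proj a C ∈ S → proj a D ∈ S →
    IsShortest a A B → IsShortest a A C → IsShortest a B C → IsShortest a A D → IsShortest a B D →
    Quad A B C D →
    ∀ {l m s t : ℝ}, 0 < l → 0 < m → 0 < s → 0 < t → l + m = 1 → s + t = 1 →
    l • A + m • B = s • C + t • D → s * w C + t * w D < l * w A + m * w B → IsShortest a C D
  -- The signs of `c` and `e` describe a straight or reflex angle at `D`, where no exchange is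
  -- available and convexity must come from the weight itself.
  convex : ∀ {C D E F : ℂ}, proj a C ∈ S → proj a D ∈ S → proj a E ∈ S → proj a F ∈ S →
    IsShortest a D C → IsShortest a D E → IsShortest a D F → ori C D E ≠ 0 →
    ∀ {c d e : ℝ}, c ≤ 0 → e < 0 → c + d + e = 1 → F = c • C + d • D + e • E →
    c * w C + d * w D + e * w E ≤ w F

/-- The determinant of four lifted points. -/
def lift (w : ℂ → ℝ) (A B C D : ℂ) : ℝ :=
  ori A B C * w D - ori D B C * w A - ori A D C * w B - ori A B D * w C

lemma lift_eq (w : ℂ → ℝ) {A B C D : ℂ} {α β γ : ℝ} (h : α + β + γ = 1)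
    (hD : D = α • A + β • B + γ • C) :
    lift w A B C D = ori A B C * (w D - (α * w A + β * w B + γ * w C)) := by
  have h1 : ori A B D = γ * ori A B C := ori_of_bary h hD
  have h2 : ori D B C = α * ori A B C := by
    rw [← ori_rotate D B C, ← ori_rotate A B C]
    exact ori_of_bary (α := β) (β := γ) (by linarith) (by rw [hD]; abel)
  have h3 : ori A D C = β * ori A B C := by
    rw [← ori_rotate A D C, ← ori_rotate D C A, ← ori_rotate A B C, ← ori_rotate B C A]
    exact ori_of_bary (α := γ) (β := α) (by linarith) (by rw [hD]; abel)
  rw [lift, h1, h2, h3]; ring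

/-! ### Perturbation and genericity of the heights -/

lemma lift_add_mul (u v : ℂ → ℝ) (r : ℝ) (A B C D : ℂ) :
    lift (fun z => u z + r * v z) A B C D = lift u A B C D + r * lift v A B C D := by
  simp only [lift]; ring

/-- A small positive perturbation keeps strict signs, and it breaks a tie whenever its own
coefficient is nonzero. -/
lemma eventually_sign (x y : ℝ) : ∀ᶠ r in 𝓝[>] (0 : ℝ),
    (0 < x → 0 < x + r * y) ∧ (x < 0 → x + r * y < 0) ∧ (y ≠ 0 → x + r * y ≠ 0) := by
  have hc : Tendsto (fun r : ℝ => x + r * y) (𝓝[>] 0) (𝓝 x) := by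
    have : Continuous fun r : ℝ => x + r * y := by fun_prop
    simpa using (this.tendsto 0).mono_left nhdsWithin_le_nhds
  rcases lt_trichotomy x 0 with hx | rfl | hx
  · filter_upwards [hc.eventually_lt_const hx] with r hr
    exact ⟨fun h => absurd h hx.not_gt, fun _ => hr, fun _ => hr.ne⟩
  · filter_upwards [self_mem_nhdsWithin] with r hr
    refine ⟨fun h => absurd h (lt_irrefl _), fun h => absurd h (lt_irrefl _), fun h => ?_⟩
    rw [zero_add]
    exact mul_ne_zero (ne_of_gt hr) h
  · filter_upwards [hc.eventually_const_lt hx] with r hr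
    exact ⟨fun _ => hr, fun h => absurd h hx.not_gt, fun _ => hr.ne'⟩

/-- Finitely many quadruples can be perturbed simultaneously. -/
lemma exists_perturbation (Q : Set (ℂ × ℂ × ℂ × ℂ)) (hQ : Q.Finite) (u v : ℂ → ℝ) :
    ∃ r > 0, ∀ A B C D, (A, B, C, D) ∈ Q → ori A B C ≠ 0 → ∀ α β γ : ℝ, α + β + γ = 1 →
      D = α • A + β • B + γ • C →
      (α * u A + β * u B + γ * u C < u D → α * (u A + r * v A) + β * (u B + r * v B)
        + γ * (u C + r * v C) < u D + r * v D) ∧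
      (α * v A + β * v B + γ * v C ≠ v D → α * (u A + r * v A) + β * (u B + r * v B)
        + γ * (u C + r * v C) ≠ u D + r * v D) := by
  have h : ∀ᶠ r in 𝓝[>] (0 : ℝ), ∀ q ∈ Q,
      (0 < lift u q.1 q.2.1 q.2.2.1 q.2.2.2 →
        0 < lift (fun z => u z + r * v z) q.1 q.2.1 q.2.2.1 q.2.2.2) ∧
      (lift u q.1 q.2.1 q.2.2.1 q.2.2.2 < 0 →
        lift (fun z => u z + r * v z) q.1 q.2.1 q.2.2.1 q.2.2.2 < 0) ∧
      (lift v q.1 q.2.1 q.2.2.1 q.2.2.2 ≠ 0 →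
        lift (fun z => u z + r * v z) q.1 q.2.1 q.2.2.1 q.2.2.2 ≠ 0) := by
    rw [hQ.eventually_all]
    intro q _
    simp only [lift_add_mul]
    exact eventually_sign _ _
  obtain ⟨r, hr, hr0⟩ := (h.and self_mem_nhdsWithin).exists
  refine ⟨r, hr0, fun A B C D hq ho α β γ hsum hD => ?_⟩
  obtain ⟨hp, hn, hz⟩ := hr _ hq
  simp only [lift_eq _ hsum hD] at hp hn hz
  constructor
  · intro hlt
    rw [← sub_pos] at hlt ⊢
    rcases lt_or_gt_of_ne ho with ho | ho
    · exact pos_of_mul_neg_right (hn (mul_neg_of_neg_of_pos ho hlt)) ho.le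
    · exact (pos_iff_pos_of_mul_pos (hp (mul_pos ho hlt))).1 ho
  · intro hne he
    exact hz (mul_ne_zero ho (sub_ne_zero.2 hne.symm)) (by rw [he, sub_self, mul_zero])

/-- Each condition excludes the kernel of a linear form in `b`, and finitely many proper subspaces
do not cover a real vector space. The form is nonzero because on the indicator of the orbit of `D`
only the coefficient `ori A B C` survives. -/
lemma exists_generic (Q : Set (ℂ × ℂ × ℂ × ℂ)) (hQ : Q.Finite) :
    ∃ b : Cylinder a → ℝ, ∀ A B C D, (A, B, C, D) ∈ Q → ori A B C ≠ 0 →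
      proj a A ≠ proj a D → proj a B ≠ proj a D → proj a C ≠ proj a D →
      lift (fun z => b (proj a z)) A B C D ≠ 0 := by
  classical
  let L : ℂ × ℂ × ℂ × ℂ → ((Cylinder a → ℝ) →ₗ[ℝ] ℝ) := fun q =>
    ori q.1 q.2.1 q.2.2.1 • LinearMap.proj (proj a q.2.2.2)
      - ori q.2.2.2 q.2.1 q.2.2.1 • LinearMap.proj (proj a q.1)
      - ori q.1 q.2.2.2 q.2.2.1 • LinearMap.proj (proj a q.2.1)
      - ori q.1 q.2.1 q.2.2.2 • LinearMap.proj (proj a q.2.2.1)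
  have hL : ∀ q b, L q b = lift (fun z => b (proj a z)) q.1 q.2.1 q.2.2.1 q.2.2.2 := by
    intro q b
    simp [L, lift]
  let Q' : Set (ℂ × ℂ × ℂ × ℂ) := {q ∈ Q | L q ≠ 0}
  have hQ' : Q'.Finite := hQ.subset (sep_subset _ _)
  have hne := Subspace.biUnion_ne_univ_of_top_notMem
    (s := hQ'.toFinset.image fun q => LinearMap.ker (L q)) (by
      simp only [Finset.mem_image, Set.Finite.mem_toFinset, not_exists, not_and]
      intro q hq h
      exact hq.2 (LinearMap.ker_eq_top.1 h))
  obtain ⟨b, hb⟩ := (Set.ne_univ_iff_exists_notMem _).1 hne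
  refine ⟨b, fun A B C D hq ho h1 h2 h3 h0 => hb ?_⟩
  have hmem : (A, B, C, D) ∈ Q' := by
    refine ⟨hq, fun hz => ho ?_⟩
    have := congrArg (fun f => f (Pi.single (proj a D) 1)) hz
    simp only [hL, lift, LinearMap.zero_apply, Pi.single_eq_same, Pi.single_eq_of_ne h1,
      Pi.single_eq_of_ne h2, Pi.single_eq_of_ne h3] at this
    linarith
  refine mem_iUnion₂.2 ⟨LinearMap.ker (L (A, B, C, D)), ?_, ?_⟩
  · exact Finset.mem_image_of_mem _ (hQ'.mem_toFinset.2 hmem)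
  · exact (hL _ b).trans h0

lemma finite_bounded_lifts (ha : a ≠ 0) (hS : S.Finite) (r : ℝ) :
    {z : ℂ | proj a z ∈ S ∧ |hor a z| ≤ r}.Finite := by
  have : {z : ℂ | proj a z ∈ S ∧ |hor a z| ≤ r} ⊆
      ⋃ x ∈ S, {z : ℂ | proj a z = x ∧ |hor a z| ≤ r} := fun z hz =>
    mem_iUnion₂.2 ⟨_, hz.1, rfl, hz.2⟩
  refine (hS.biUnion fun x _ => ?_).subset this
  obtain ⟨z₀, rfl⟩ := QuotientAddGroup.mk_surjective x
  refine ((Set.finite_Icc (-⌈r + |hor a z₀|⌉) ⌈r + |hor a z₀|⌉).image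
    (fun n : ℤ => z₀ + n • a)).subset ?_
  rintro z ⟨hz, hz'⟩
  obtain ⟨n, rfl⟩ := proj_eq_iff.1 hz.symm
  refine ⟨n, ?_, rfl⟩
  rw [hor_add_zsmul ha] at hz'
  rw [Set.mem_Icc, ← abs_le]
  have h1 : |(n : ℝ)| ≤ r + |hor a z₀| := by
    have := abs_sub (hor a z₀ + n) (hor a z₀)
    rw [add_sub_cancel_left] at this
    linarith
  have h2 := h1.trans (Int.le_ceil _)
  exact_mod_cast h2

lemma affine_hor {A B C D : ℂ} {α β γ : ℝ} (hD : D = α • A + β • B + γ • C) :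
    hor a D = α * hor a A + β * hor a B + γ * hor a C := by
  rw [hD, hor_add, hor_add, hor_smul, hor_smul, hor_smul]

lemma affine_im {A B C D : ℂ} {α β γ : ℝ} (hD : D = α • A + β • B + γ • C) :
    (D / a).im = α * (A / a).im + β * (B / a).im + γ * (C / a).im := by
  rw [hD]
  simp [add_div, mul_div_assoc]

/-- The weight has three scales: horizontal square, vertical square, generic function of the orbit.
Strict inequalities are thereby decided lexicographically in the first two, and the third excludes
equality. -/
lemma exists_generic_weight (ha : a ≠ 0) (hS : S.Finite) : ∃ w : ℂ → ℝ,
    (∀ z, ∀ n : ℤ, w (z + n • a) = w z + 2 * n * hor a z + n ^ 2) ∧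
    ∀ A B C D : ℂ, proj a A ∈ S → proj a B ∈ S → proj a C ∈ S → proj a D ∈ S →
      |hor a B - hor a A| < 1 → |hor a C - hor a A| < 1 → |hor a D - hor a A| < 1 →
      ori A B C ≠ 0 → ∀ α β γ : ℝ, α + β + γ = 1 → D = α • A + β • B + γ • C →
      (proj a A ≠ proj a D → proj a B ≠ proj a D → proj a C ≠ proj a D →
        w D ≠ α * w A + β * w B + γ * w C) ∧
      (α * hor a A ^ 2 + β * hor a B ^ 2 + γ * hor a C ^ 2 < hor a D ^ 2 ∨
        (α * hor a A ^ 2 + β * hor a B ^ 2 + γ * hor a C ^ 2 = hor a D ^ 2 ∧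
          α * (A / a).im ^ 2 + β * (B / a).im ^ 2 + γ * (C / a).im ^ 2 < (D / a).im ^ 2) →
        α * w A + β * w B + γ * w C < w D) := by
  set K : Set ℂ := {z : ℂ | proj a z ∈ S ∧ |hor a z| ≤ 2}
  have hK : K.Finite := finite_bounded_lifts ha hS 2
  set Q := K ×ˢ K ×ˢ K ×ˢ K
  have hQ : Q.Finite := hK.prod (hK.prod (hK.prod hK))
  obtain ⟨b, hb⟩ := exists_generic (a := a) Q hQ
  set u₀ : ℂ → ℝ := fun z => hor a z ^ 2 with hu₀
  set u₁ : ℂ → ℝ := fun z => (z / a).im ^ 2 with hu₁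
  obtain ⟨ε, hε, h1⟩ := exists_perturbation Q hQ u₀ u₁
  obtain ⟨δ, hδ, h2⟩ := exists_perturbation Q hQ (fun z => u₀ z + ε * u₁ z) (fun z => b (proj a z))
  set w : ℂ → ℝ := fun z => u₀ z + ε * u₁ z + δ * b (proj a z) with hw
  have htr : ∀ z, ∀ n : ℤ, w (z + n • a) = w z + 2 * n * hor a z + n ^ 2 := by
    intro z n
    simp only [hw, hu₀, hu₁, proj_add_zsmul, im_add_zsmul ha, hor_add_zsmul ha]
    ring
  refine ⟨w, htr, ?_⟩
  have main : ∀ A B C D : ℂ, (A, B, C, D) ∈ Q →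
      ori A B C ≠ 0 → ∀ α β γ : ℝ, α + β + γ = 1 → D = α • A + β • B + γ • C →
      (proj a A ≠ proj a D → proj a B ≠ proj a D → proj a C ≠ proj a D →
        w D ≠ α * w A + β * w B + γ * w C) ∧
      (α * hor a A ^ 2 + β * hor a B ^ 2 + γ * hor a C ^ 2 < hor a D ^ 2 ∨
        (α * hor a A ^ 2 + β * hor a B ^ 2 + γ * hor a C ^ 2 = hor a D ^ 2 ∧
          α * (A / a).im ^ 2 + β * (B / a).im ^ 2 + γ * (C / a).im ^ 2 < (D / a).im ^ 2) →
        α * w A + β * w B + γ * w C < w D) := by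
    intro A B C D hq ho α β γ hsum hD
    obtain ⟨p1, -⟩ := h1 A B C D hq ho α β γ hsum hD
    obtain ⟨p2, g2⟩ := h2 A B C D hq ho α β γ hsum hD
    have hg := hb A B C D hq ho
    rw [lift_eq _ hsum hD] at hg
    constructor
    · intro k1 k2 k3 he
      refine g2 (fun hc => hg k1 k2 k3 ?_) he.symm
      rw [hc, sub_self, mul_zero]
    · rintro (hlt | ⟨heq, hlt⟩)
      · exact p2 (p1 hlt)
      · refine p2 ?_
        have := mul_lt_mul_of_pos_left hlt hε
        simp only [hu₀, hu₁]
        linarith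
  intro A B C D hA hB hC hD hAB hAC hAD ho α β γ hsum hbary
  -- This shift puts `A` at horizontal coordinate in `[0, 1)` and the other points within distance 1
  -- of it, so the finite window `K` suffices. The shift adds the same affine function on both sides
  -- of each comparison.
  set n : ℤ := -⌊hor a A⌋ with hn
  have hmem : ∀ z, proj a z ∈ S → |hor a z - hor a A| < 1 → z + n • a ∈ K := by
    intro z hz hza
    refine ⟨by rwa [proj_add_zsmul], ?_⟩
    rw [hor_add_zsmul ha, hn]
    have h3 := Int.floor_le (hor a A)
    have h4 := Int.lt_floor_add_one (hor a A)
    rw [abs_lt] at hza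
    push_cast
    rw [abs_le]
    constructor <;> linarith
  have hbary' : D + n • a = α • (A + n • a) + β • (B + n • a) + γ • (C + n • a) := by
    rw [bary_add hsum, hbary]
  have key := main (A + n • a) (B + n • a) (C + n • a) (D + n • a)
    ⟨hmem A hA (by simp), hmem B hB hAB, hmem C hC hAC, hmem D hD hAD⟩
    (by rwa [ori_add_right]) α β γ hsum hbary'
  have hh := affine_hor (a := a) hbary
  have e1 : ∀ u : ℝ, α * (u ^ 2) + β * (u ^ 2) + γ * (u ^ 2) = u ^ 2 := by
    intro u; linear_combination u ^ 2 * hsum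
  simp only [proj_add_zsmul, hor_add_zsmul ha, im_add_zsmul ha, htr] at key
  have e2 : α * (w A + 2 * n * hor a A + n ^ 2) + β * (w B + 2 * n * hor a B + n ^ 2)
      + γ * (w C + 2 * n * hor a C + n ^ 2)
      = α * w A + β * w B + γ * w C + (2 * n * hor a D + n ^ 2) := by
    rw [hh]; linear_combination (n : ℝ) ^ 2 * hsum
  have e3 : α * (hor a A + n) ^ 2 + β * (hor a B + n) ^ 2 + γ * (hor a C + n) ^ 2
      = α * hor a A ^ 2 + β * hor a B ^ 2 + γ * hor a C ^ 2 + (2 * n * hor a D + n ^ 2) := by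
    rw [hh]; linear_combination (n : ℝ) ^ 2 * hsum
  rw [e2, e3] at key
  refine ⟨fun k1 k2 k3 he => key.1 k1 k2 k3 (by rw [he]; ring), fun hlex => ?_⟩
  have := key.2 (hlex.imp (fun h => by linarith) (fun h => ⟨by linarith [h.1], h.2⟩))
  linarith

/-- The bounds force the interval of `A`, `B` strictly inside that of `C`, `D`. A chord of the
parabola exceeds it at the common mean by the product of the distances to the ends, so the longer
chord is higher. Contrapositively, a diagonal that is lower must be short. -/
lemma mul_lt_mul_of_nested {A B C D l m s t : ℝ} (hl : 0 < l) (hm : 0 < m) (hs : 0 < s)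
    (ht : 0 < t) (hlm : l + m = 1) (hst : s + t = 1) (he : l * A + m * B = s * C + t * D)
    (hAC : |C - A| < 1 / 2) (hBC : |C - B| < 1 / 2) (hAD : |D - A| < 1 / 2)
    (hBD : |D - B| < 1 / 2) (hCD : 1 / 2 ≤ |D - C|) :
    l * A ^ 2 + m * B ^ 2 < s * C ^ 2 + t * D ^ 2 := by
  wlog hAB : A ≤ B generalizing A B l m
  · have := this (A := B) (B := A) hm hl (by linarith) (by linarith) hBC hAC hBD hAD (by linarith)
    linarith
  wlog hCD' : C ≤ D generalizing C D s t
  · have := this (C := D) (D := C) ht hs (by linarith) (by rwa [abs_sub_comm])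
      (by linarith) hAD hBD hAC hBC (by linarith)
    linarith
  rw [abs_of_nonneg (by linarith)] at hCD
  rw [abs_lt] at *
  have h1 : m * (B - A) < t * (D - C) := by
    have e1 : m * (B - A) = l * A + m * B - A := by linear_combination -A * hlm
    have e2 : t * (D - C) = s * C + t * D - C := by linear_combination -C * hst
    rw [e1, e2, he]; linarith
  have h2 : l * (B - A) < s * (D - C) := by
    have e1 : l * (B - A) = B - (l * A + m * B) := by linear_combination B * hlm
    have e2 : s * (D - C) = D - (s * C + t * D) := by linear_combination D * hst
    rw [e1, e2, he]; linarith
  have h3 : m * (B - A) * (l * (B - A)) < t * (D - C) * (s * (D - C)) :=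
    mul_lt_mul'' h1 h2 (mul_nonneg hm.le (by linarith)) (mul_nonneg hl.le (by linarith))
  have e1 : l * A ^ 2 + m * B ^ 2 = (l * A + m * B) ^ 2 + m * (B - A) * (l * (B - A)) := by
    obtain rfl : l = 1 - m := by linarith
    ring
  have e2 : s * C ^ 2 + t * D ^ 2 = (s * C + t * D) ^ 2 + t * (D - C) * (s * (D - C)) := by
    obtain rfl : s = 1 - t := by linarith
    ring
  rw [e1, e2, he]
  linarith

/-- Recentring at `y` removes the coefficient `d`. For nonpositive `c` and `e` the right side is a
sum of nonnegative terms. -/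
lemma affine_sq {c d e x y z f : ℝ} (hs : c + d + e = 1) (hf : f = c * x + d * y + e * z) :
    f ^ 2 - (c * x ^ 2 + d * y ^ 2 + e * z ^ 2)
      = (f - y) ^ 2 - c * (x - y) ^ 2 - e * (z - y) ^ 2 := by
  obtain rfl : d = 1 - c - e := by linarith
  rw [hf]; ring

lemma bary_of_cross {A B C D : ℂ} {l m s t : ℝ} (ht : 0 < t)
    (e : l • A + m • B = s • C + t • D) : D = (l / t) • A + (m / t) • B + (-(s / t)) • C := by
  have h1 : (t⁻¹) • (l • A + m • B) = t⁻¹ • (s • C + t • D) := by rw [e]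
  simp only [smul_add, smul_smul] at h1
  rw [inv_mul_cancel₀ ht.ne', one_smul] at h1
  rw [div_eq_inv_mul, div_eq_inv_mul, div_eq_inv_mul, neg_smul, h1]
  abel

lemma exists_isWeight (ha : a ≠ 0) (hS : S.Finite) : ∃ w, IsWeight a S w := by
  obtain ⟨w, htr, hw⟩ := exists_generic_weight ha hS
  refine ⟨w, htr, ?_, ?_, ?_⟩
  · intro A B C D hA hB hC hD sAB sCD hq l m s t hl hm hs ht hlm hst e hc
    have hsum : l / t + m / t + -(s / t) = 1 := by field_simp; linarith
    have hb := bary_of_cross ht e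
    have hp : l • A + m • B ∈ segment ℝ A B := ⟨l, m, hl.le, hm.le, hlm, rfl⟩
    have hp' : l • A + m • B ∈ segment ℝ C D := ⟨s, t, hs.le, ht.le, hst, e.symm⟩
    have hA' := abs_lt.1 (sAB.hor_lt ha hp)
    have hB' := abs_lt.1 ((sAB.symm ha).hor_lt ha (segment_symm ℝ A B ▸ hp))
    have hC' := abs_lt.1 (sCD.hor_lt ha hp')
    have hD' := abs_lt.1 ((sCD.symm ha).hor_lt ha (segment_symm ℝ C D ▸ hp'))
    have hAD : A ≠ D := by
      rintro rfl; exact hq.ori₂ (ori_left _ _)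
    have hBD : B ≠ D := by
      rintro rfl; exact hq.ori₂ (ori_right _ _)
    refine (hw A B C D hA hB hC hD ?_ ?_ ?_ hq.ori₁ _ _ _ hsum hb).1 ?_ ?_ ?_ ?_
    · rw [abs_lt]; constructor <;> linarith
    · rw [abs_lt]; constructor <;> linarith
    · rw [abs_lt]; constructor <;> linarith
    · exact fun h => hAD (eq_of_proj_eq ha h (by rw [abs_lt]; constructor <;> linarith))
    · exact fun h => hBD (eq_of_proj_eq ha h (by rw [abs_lt]; constructor <;> linarith))
    · exact fun h => ne_of_ori_ne hq.symm.ori₁ (eq_of_proj_eq ha h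
        (by rw [abs_lt]; constructor <;> linarith))
    · field_simp; linarith
  · intro A B C D hA hB hC hD sAB sAC sBC sAD sBD hq l m s t hl hm hs ht hlm hst e hlt
    rw [isShortest_iff ha] at *
    by_contra hCD
    have hsum : l / t + m / t + -(s / t) = 1 := by field_simp; linarith
    have hb := bary_of_cross ht e
    have hh := affine_hor (a := a) hb
    have hh' : l * hor a A + m * hor a B = s * hor a C + t * hor a D := by
      rw [hh]; field_simp; ring
    have h1 := mul_lt_mul_of_nested hl hm hs ht hlm hst hh' sAC sBC sAD sBD (not_lt.1 hCD)
    have h2 := (hw A B C D hA hB hC hD (by linarith) (by linarith) (by linarith) hq.ori₁ _ _ _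
      hsum hb).2 (Or.inl ?_)
    · have h3 : t * (l / t * w A + m / t * w B + -(s / t) * w C) < t * w D :=
        mul_lt_mul_of_pos_left h2 ht
      have h4 : t * (l / t * w A + m / t * w B + -(s / t) * w C) = l * w A + m * w B - s * w C := by
        field_simp; ring
      linarith
    · have h4 : t * (l / t * hor a A ^ 2 + m / t * hor a B ^ 2 + -(s / t) * hor a C ^ 2)
          = l * hor a A ^ 2 + m * hor a B ^ 2 - s * hor a C ^ 2 := by
        field_simp; ring
      refine lt_of_mul_lt_mul_left ?_ ht.le
      rw [h4]; linarith
  · intro C D E F hC hD hE hF sDC sDE sDF ho c d e hc he hsum hb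
    rw [isShortest_iff ha] at *
    have hDE : E ≠ D := by rintro rfl; exact ho (ori_right _ _)
    have ho' : ori D E C ≠ 0 := by rwa [ori_rotate]
    have h1 := affine_sq hsum (affine_hor (a := a) hb)
    have h2 := affine_sq hsum (affine_im (a := a) hb)
    have k1 := mul_nonneg (neg_nonneg.2 hc) (sq_nonneg (hor a C - hor a D))
    have k2 := mul_nonneg (neg_nonneg.2 hc) (sq_nonneg ((C / a).im - (D / a).im))
    have k3 := mul_nonneg (neg_nonneg.2 he.le) (sq_nonneg (hor a E - hor a D))
    have k5 := sq_nonneg (hor a F - hor a D)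
    have k6 := sq_nonneg ((F / a).im - (D / a).im)
    have h3 := (hw D E C F hD hE hC hF (by linarith) (by linarith) (by linarith) ho' d e c
      (by linarith) (by rw [hb]; abel)).2 ?_
    · linarith
    -- For horizontally aligned `E` and `D` the first scale may tie. Then `E` and `D` differ in
    -- height, and the vertical square decides strictly.
    · rcases eq_or_ne (hor a E) (hor a D) with h4 | h4
      · rcases (show d * hor a D ^ 2 + e * hor a E ^ 2 + c * hor a C ^ 2 ≤ hor a F ^ 2 by
          linarith).lt_or_eq with h6 | h6
        · exact Or.inl h6
        · refine Or.inr ⟨h6, ?_⟩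
          have h5 : (E / a).im ≠ (D / a).im := fun h5 => hDE <| by
            have : E / a = D / a := Complex.ext h4 h5
            rwa [div_left_inj' ha] at this
          have := mul_pos (neg_pos.2 he) (sq_pos_of_ne_zero (sub_ne_zero.2 h5))
          linarith
      · left
        have := mul_pos (neg_pos.2 he) (sq_pos_of_ne_zero (sub_ne_zero.2 h4))
        linarith


/-! ### Flips that lower the lifted surface -/

/-- The lifted surface over the triangles of `T` has the height `v` over `z`. -/
def HasHeight (a : ℂ) (S : Set (Cylinder a)) (w : ℂ → ℝ) (T : Set (Sym2 (Cylinder a))) (z : ℂ)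
    (v : ℝ) : Prop :=
  ∃ A B C : ℂ, IsTriangle a S T A B C ∧ ∃ α β γ : ℝ, 0 ≤ α ∧ 0 ≤ β ∧ 0 ≤ γ ∧ α + β + γ = 1 ∧
    z = α • A + β • B + γ • C ∧ v = α * w A + β * w B + γ * w C

/-- The lifted surface of `T'` is nowhere above that of `T`. -/
def Below (a : ℂ) (S : Set (Cylinder a)) (w : ℂ → ℝ) (T' T : Set (Sym2 (Cylinder a))) : Prop :=
  ∀ z v, HasHeight a S w T z v → ∃ v' ≤ v, HasHeight a S w T' z v'

lemma Below.trans (h : Below a S w T'' T') (h' : Below a S w T' T) : Below a S w T'' T := by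
  intro z v hv
  obtain ⟨v', hv', h1⟩ := h' z v hv
  obtain ⟨v'', hv'', h2⟩ := h z v' h1
  exact ⟨v'', hv''.trans hv', h2⟩

lemma HasHeight.add_zsmul (hw : IsWeight a S w) (ha : a ≠ 0) {z : ℂ} {v : ℝ}
    (h : HasHeight a S w T z v) (n : ℤ) :
    HasHeight a S w T (z + n • a) (v + 2 * n * hor a z + n ^ 2) := by
  obtain ⟨A, B, C, ht, α, β, γ, hα, hβ, hγ, hs, rfl, rfl⟩ := h
  refine ⟨_, _, _, ht.add_zsmul ha n, α, β, γ, hα, hβ, hγ, hs, (bary_add hs).symm, ?_⟩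
  simp only [hw.add_zsmul, hor_add, hor_smul]
  linear_combination -(n : ℝ) ^ 2 * hs

lemma IsExchange.swap_right {A B C D : ℂ} (h : IsExchange a S T T' A B C D) (ha : a ≠ 0) :
    IsExchange a S T T' A B D C :=
  ⟨h.quad.swap_right, h.right, h.left, h.left'.swap ha, h.right'.swap ha,
    by rw [h.sdiff_eq, edge_comm C D]⟩

lemma IsExchange.swap_left {A B C D : ℂ} (h : IsExchange a S T T' A B C D) (ha : a ≠ 0) :
    IsExchange a S T T' B A C D :=
  ⟨h.quad.swap_left, h.left.swap ha, h.right.swap ha, h.right', h.left',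
    by rw [← h.sdiff_eq, edge_comm A B]⟩

/-- For `β * l ≤ α * m`, the crossing identity scaled by `β / m` eliminates `B` and puts the point
in the new triangle `C D A`. The same substitution in the heights replaces the diagonal `A B` by the
lower one. -/
lemma IsExchange.exists_lower {A B C D : ℂ} (h : IsExchange a S T T' A B C D) (ha : a ≠ 0)
    {l m s t : ℝ} (hl : 0 < l) (hm : 0 < m) (hs : 0 < s) (ht : 0 < t) (hlm : l + m = 1)
    (hst : s + t = 1) (e : l • A + m • B = s • C + t • D)
    (hlt : s * w C + t * w D ≤ l * w A + m * w B) {α β γ : ℝ} (hα : 0 ≤ α) (hβ : 0 ≤ β)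
    (hγ : 0 ≤ γ) (hsum : α + β + γ = 1) : ∃ v' ≤ α * w A + β * w B + γ * w C,
      HasHeight a S w T' (α • A + β • B + γ • C) v' := by
  wlog hle : β * l ≤ α * m generalizing A B l m α β
  · obtain ⟨v', hv', hh⟩ := this (h.swap_left ha) hm hl (by linarith) (by rw [← e, add_comm])
      (by linarith) hβ hα (by linarith) (by linarith)
    exact ⟨v', by linarith, by rwa [add_comm (β • B)] at hh⟩
  have hbm : β / m * m = β := div_mul_cancel₀ _ hm.ne'
  refine ⟨(β / m * s + γ) * w C + β / m * t * w D + (α - β / m * l) * w A, ?_,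
    C, D, A, h.left', _, _, _, by positivity, by positivity, ?_, ?_, ?_, rfl⟩
  · have := mul_le_mul_of_nonneg_left hlt (div_nonneg hβ hm.le)
    have e1 : β / m * (l * w A + m * w B) = β / m * l * w A + β * w B := by
      rw [mul_add, ← mul_assoc, ← mul_assoc, hbm]
    linarith
  · rw [sub_nonneg, div_mul_eq_mul_div, div_le_iff₀ hm]; exact hle
  · linear_combination hsum + β / m * hst - β / m * hlm + hbm
  · have e1 : (β / m) • (l • A + m • B) = (β / m) • (s • C + t • D) := by rw [e]
    simp only [smul_add, smul_smul, hbm] at e1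
    have e2 : β • B = (β / m * s) • C + (β / m * t) • D - (β / m * l) • A := by
      rw [← e1]; abel
    rw [e2, add_smul, sub_smul]
    abel

/-- Triangles over a translate of `A B` are moved to the chosen lift, lowered there and moved back;
the affine corrections of the weight cancel. All other triangles persist. -/
lemma IsExchange.below {A B C D : ℂ} (h : IsExchange a S T T' A B C D) (ha : a ≠ 0)
    (hw : IsWeight a S w) (hT' : IsNonCrossing a S T')
    {l m s t : ℝ} (hl : 0 < l) (hm : 0 < m) (hs : 0 < s) (ht : 0 < t) (hlm : l + m = 1)
    (hst : s + t = 1) (e : l • A + m • B = s • C + t • D)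
    (hlt : s * w C + t * w D ≤ l * w A + m * w B) : Below a S w T' T := by
  have key : ∀ {X Y Z : ℂ} {α β γ : ℝ}, IsTriangle a S T X Y Z → edge a X Y = edge a A B →
      0 ≤ α → 0 ≤ β → 0 ≤ γ → α + β + γ = 1 → ∃ v' ≤ α * w X + β * w Y + γ * w Z,
      HasHeight a S w T' (α • X + β • Y + γ • Z) v' := by
    intro X Y Z α β γ hX he hα hβ hγ hsum
    obtain ⟨n, hn, hn'⟩ := h.apex ha hX he
    have hz : ∃ v' ≤ α * w (X + n • a) + β * w (Y + n • a) + γ * w (Z + n • a),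
        HasHeight a S w T' (α • (X + n • a) + β • (Y + n • a) + γ • (Z + n • a)) v' := by
      have aux : ∀ {X Y : ℂ} {α β : ℝ}, A = X + n • a → B = Y + n • a →
          0 ≤ α → 0 ≤ β → α + β + γ = 1 →
          ∃ v' ≤ α * w (X + n • a) + β * w (Y + n • a) + γ * w (Z + n • a),
          HasHeight a S w T' (α • (X + n • a) + β • (Y + n • a) + γ • (Z + n • a)) v' := by
        intro X Y α β hA hB hα hβ hsum
        rw [← hA, ← hB]
        rcases hn with hn | hn <;> rw [← hn]
        · exact h.exists_lower ha hl hm hs ht hlm hst e hlt hα hβ hγ hsum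
        · exact (h.swap_right ha).exists_lower ha hl hm ht hs hlm (by linarith)
            (by rw [e, add_comm]) (by linarith) hα hβ hγ hsum
      rcases hn' with ⟨hA, hB⟩ | ⟨hA, hB⟩
      · exact aux hA hB hα hβ hsum
      · obtain ⟨v', hv', hh⟩ := aux hA hB hβ hα (by linarith)
        exact ⟨v', by linarith, by rwa [add_comm (β • _)] at hh⟩
    obtain ⟨v', hv', hh⟩ := hz
    have := hh.add_zsmul hw ha (-n)
    rw [bary_add hsum, neg_smul, add_neg_cancel_right] at this
    refine ⟨_, ?_, this⟩
    simp only [hw.add_zsmul] at hv'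
    have e1 : hor a (α • X + β • Y + γ • Z) = α * hor a X + β * hor a Y + γ * hor a Z :=
      affine_hor rfl
    rw [hor_add_zsmul ha, e1]
    push_cast
    have e2 : (α + β + γ) * (n : ℝ) ^ 2 = n ^ 2 := by rw [hsum, one_mul]
    linarith
  rintro z v ⟨X, Y, Z, hX, α, β, γ, hα, hβ, hγ, hsum, rfl, rfl⟩
  by_cases h1 : edge a X Y = edge a A B
  · exact key hX h1 hα hβ hγ hsum
  by_cases h2 : edge a Y Z = edge a A B
  · obtain ⟨v', hv', hh⟩ := key hX.rotate h2 hβ hγ hα (by linarith)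
    exact ⟨v', by linarith, by rwa [add_comm, ← add_assoc] at hh⟩
  by_cases h3 : edge a Z X = edge a A B
  · obtain ⟨v', hv', hh⟩ := key hX.rotate.rotate h3 hγ hα hβ (by linarith)
    exact ⟨v', by linarith, by rwa [add_assoc, add_comm] at hh⟩
  have hm : ∀ f ∈ T, f ≠ edge a A B → f ∈ T' := by
    intro f hf hne
    have : f ∈ T' \ {edge a C D} := h.sdiff_eq ▸ ⟨hf, hne⟩
    exact this.1
  exact ⟨_, le_rfl, X, Y, Z, hT'.isTriangle ha hX.ori_ne hX.shortest_AB hX.shortest_BC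
    hX.shortest_CA (hm _ hX.mem_AB h1) (hm _ hX.mem_BC h2) (hm _ hX.mem_CA h3)
    (fun z hz hc => hX.notMem_skeleton hz (Or.inl hc)), α, β, γ, hα, hβ, hγ, hsum, rfl, rfl⟩

/-- Heights form a relation, since a point may lie in several closed triangles. Over the inside of a
side the value is unique, which suffices to see that a flip lowers the surface strictly. -/
lemma IsTriangle.height_eq (ha : a ≠ 0) (hT : IsNonCrossing a S T) {A B C : ℂ}
    (h : IsTriangle a S T A B C) {l m : ℝ} (hl : 0 < l) (hm : 0 < m) (hlm : l + m = 1) {v : ℝ}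
    (hv : HasHeight a S w T (l • A + m • B) v) : v = l * w A + m * w B := by
  obtain ⟨X, Y, Z, hX, α, β, γ, hα, hβ, hγ, hsum, hz, rfl⟩ := hv
  have hp : l • A + m • B ∈ openSegment ℝ A B := ⟨l, m, hl, hm, hlm, rfl⟩
  have hp' := openSegment_subset_segment ℝ A B hp
  have hne := ne_of_ori_ne h.ori_ne
  have key : ∀ {X Y Z : ℂ} {α β : ℝ}, IsTriangle a S T X Y Z → 0 ≤ α → 0 ≤ β → α + β = 1 →
      l • A + m • B = α • X + β • Y → α * w X + β * w Y = l * w A + m * w B := by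
    intro X Y Z α β hX hα hβ hsum hz
    have hq : l • A + m • B ∈ segment ℝ X Y := ⟨α, β, hα, hβ, hsum, hz.symm⟩
    have uniq : ∀ {x y : ℝ}, x + y = 1 → l • A + m • B = x • A + y • B → l = x ∧ m = y := by
      intro x y hxy e
      have := bary_unique h.ori_ne (α := l) (β := m) (γ := 0) (α' := x) (β' := y) (γ' := 0)
        (by linarith) (by linarith) (by rw [e])
      exact ⟨this.1, this.2.1⟩
    rcases hT.meet ha h.shortest_AB h.mem_AB hX.shortest_AB hX.mem_AB hp' hq with
      (⟨rfl, rfl⟩ | ⟨rfl, rfl⟩) | ⟨h1, -⟩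
    · obtain ⟨rfl, rfl⟩ := uniq hsum hz
      rfl
    · obtain ⟨rfl, rfl⟩ := uniq (by linarith) (hz.trans (add_comm _ _))
      ring
    · rcases h1 with h1 | h1
      · exact absurd h1 (ne_left_of_mem_openSegment hne hp)
      · exact absurd h1 (ne_right_of_mem_openSegment hne hp)
  rcases hγ.eq_or_lt with rfl | hγ'
  · have := key hX hα hβ (by linarith) (by rw [hz, zero_smul, add_zero])
    linarith
  rcases hα.eq_or_lt with rfl | hα'
  · have := key hX.rotate hβ hγ (by linarith) (by rw [hz, zero_smul, zero_add])
    linarith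
  rcases hβ.eq_or_lt with rfl | hβ'
  · have := key hX.rotate.rotate hγ hα (by linarith) (by rw [hz, zero_smul, add_zero, add_comm])
    linarith
  exact absurd (mem_skeleton_of_mem_segment h.shortest_AB h.mem_AB hp')
    (hX.notMem_skeleton ((mem_interior_triangle hX.ori_ne).2
      ⟨α, β, γ, hα', hβ', hγ', hsum, hz⟩))

/-- No exchange of diagonals lowers the lifted surface. -/
def IsOptimal (a : ℂ) (S : Set (Cylinder a)) (w : ℂ → ℝ) (T : Set (Sym2 (Cylinder a))) : Prop :=
  ∀ A B C D : ℂ, IsTriangle a S T A B C → IsTriangle a S T A B D → ∀ l m s t : ℝ, 0 < l → 0 < m →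
    0 < s → 0 < t → l + m = 1 → s + t = 1 → l • A + m • B = s • C + t • D →
    l * w A + m * w B ≤ s * w C + t * w D

/-- The strict part of `Below` is well-founded on the finite set of triangulations. At a minimal
reachable triangulation a lowering exchange would be a legitimate flip, by `IsWeight.shortest`, to a
smaller reachable one. -/
lemma exists_reachable_isOptimal (ha : a ≠ 0) (hS : S.Finite) (hw : IsWeight a S w)
    (T : Triangulation a S) :
    ∃ T' : Triangulation a S, (flipGraph a S).Reachable T T' ∧ IsOptimal a S w T'.1 := by
  have hfin : Finite (Triangulation a S) :=
    Set.Finite.to_subtype ((finite_sym2 hS).finite_subsets.subset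
      fun T hT => hT.maximal.prop.ends_mem)
  let r : Triangulation a S → Triangulation a S → Prop := fun T' T =>
    Below a S w T'.1 T.1 ∧ ¬Below a S w T.1 T'.1
  have : IsTrans _ r := ⟨fun _ _ _ h h' =>
    ⟨h.1.trans h'.1, fun hc => h.2 (h'.1.trans hc)⟩⟩
  have : Std.Irrefl r := ⟨fun _ h => h.2 h.1⟩
  have hwf : WellFounded r := Finite.wellFounded_of_trans_of_irrefl r
  obtain ⟨T', hT', hmin⟩ := hwf.has_min {T' | (flipGraph a S).Reachable T T'}
    ⟨T, SimpleGraph.Reachable.refl T⟩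
  refine ⟨T', hT', fun A B C D h₁ h₂ l m s t hl hm hs ht hlm hst e => ?_⟩
  by_contra hlt
  rw [not_le] at hlt
  have hnc := T'.2.maximal.prop
  have hq : Quad A B C D := ⟨h₁.ori_ne, h₂.ori_ne, _, ⟨l, m, hl, hm, hlm, rfl⟩,
    s, t, hs, ht, hst, e.symm⟩
  have sCD := hw.shortest (hnc.proj_left_mem h₁.mem_AB) (hnc.proj_right_mem h₁.mem_AB)
    (hnc.proj_right_mem h₁.mem_BC) (hnc.proj_right_mem h₂.mem_BC) h₁.shortest_AB
    (h₁.shortest_CA.symm ha) h₁.shortest_BC (h₂.shortest_CA.symm ha) h₂.shortest_BC hq hl hm hs ht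
    hlm hst e hlt
  have hnc' := isNonCrossing_flip hnc ha h₁ h₂ sCD hq
  have hex := isExchange_flip hnc ha h₁ h₂ sCD hq
  let T'' : Triangulation a S := ⟨_, hex.isTriangulation ha T'.2 hnc'⟩
  have hr : r T'' T' := by
    refine ⟨hex.below ha hw hnc' hl hm hs ht hlm hst e hlt.le, fun hc => ?_⟩
    obtain ⟨v, hv, hh⟩ := hc (l • A + m • B) (s * w C + t * w D)
      ⟨C, D, A, hex.left', s, t, 0, hs.le, ht.le, le_rfl, by linarith, by rw [e, zero_smul, add_zero], by ring⟩
    rw [h₁.height_eq ha hnc hl hm hlm hh] at hv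
    exact absurd hv (not_le.2 hlt)
  refine hmin T'' (hT'.trans (SimpleGraph.Adj.reachable ?_)) hr
  refine (SimpleGraph.fromRel_adj _ _ _).2 ⟨?_, Or.inl ⟨A, B, C, D, h₁, h₂, sCD, hq.cross, rfl⟩⟩
  intro hc
  rw [← hc] at hr
  exact hr.2 hr.1


/-! ### Convexity of the lifted surface -/

/-- Local convexity across `C D`. If `c` or `d` is nonpositive, the angle at `D` or `C` is straight
or reflex and the weight takes care of it. Otherwise the quadrangle is strictly convex, and division
by `1 - e` turns the relation into the crossing of its diagonals. -/
lemma IsOptimal.le_apex (h : IsOptimal a S w T) (hw : IsWeight a S w) (ha : a ≠ 0)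
    (hT : IsNonCrossing a S T) {C D E F : ℂ} (hE : IsTriangle a S T C D E)
    (hF : IsTriangle a S T C D F) {c d e : ℝ} (hsum : c + d + e = 1) (he : e < 0)
    (hb : F = c • C + d • D + e • E) : c * w C + d * w D + e * w E ≤ w F := by
  have hC := hT.proj_left_mem hE.mem_AB
  have hD := hT.proj_right_mem hE.mem_AB
  have hES := hT.proj_right_mem hE.mem_BC
  have hFS := hT.proj_right_mem hF.mem_BC
  rcases le_or_gt c 0 with hc | hc
  · exact hw.convex hC hD hES hFS (hE.shortest_AB.symm ha) hE.shortest_BC hF.shortest_BC hE.ori_ne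
      hc he hsum hb
  rcases le_or_gt d 0 with hd | hd
  · have := hw.convex hD hC hES hFS hE.shortest_AB (hE.shortest_CA.symm ha)
      (hF.shortest_CA.symm ha) (hE.swap ha).ori_ne (d := c) hd he (by linarith)
      (by rw [hb, add_comm (d • D)])
    linarith
  · have hpos : 0 < 1 - e := by linarith
    have hinv : 0 < (1 - e)⁻¹ := inv_pos.2 hpos
    have hcancel : (1 - e)⁻¹ * (1 - e) = 1 := inv_mul_cancel₀ hpos.ne'
    have := h C D E F hE hF ((1 - e)⁻¹ * c) ((1 - e)⁻¹ * d) ((1 - e)⁻¹ * (-e)) ((1 - e)⁻¹)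
      (by positivity) (by positivity) (mul_pos hinv (by linarith)) hinv
      (by rw [← mul_add, show c + d = 1 - e by linarith, hcancel])
      (by linarith) (by
        rw [mul_smul, mul_smul, mul_smul, ← smul_add, ← smul_add, hb, neg_smul]
        congr 1; abel)
    have h2 : (1 - e)⁻¹ * (c * w C + d * w D) ≤ (1 - e)⁻¹ * (-e * w E + w F) := by linarith
    have := le_of_mul_le_mul_left h2 hinv
    linarith

/-- The segment from `A` to `B` crosses at its parameter `s` a segment of `T` whose lift exceeds
the lift of `A B` there by `u`. -/
def Crosses (a : ℂ) (w : ℂ → ℝ) (T : Set (Sym2 (Cylinder a))) (A B : ℂ) (s u : ℝ) : Prop :=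
  0 < s ∧ s < 1 ∧ ∃ (C D : ℂ) (σ τ : ℝ), edge a C D ∈ T ∧ IsShortest a C D ∧ 0 < σ ∧ 0 < τ ∧
    σ + τ = 1 ∧ (1 - s) • A + s • B = σ • C + τ • D ∧
    u = σ * w C + τ * w D - ((1 - s) * w A + s * w B)

lemma Crosses.symm {A B : ℂ} {s u : ℝ} (h : Crosses a w T A B s u) :
    Crosses a w T B A (1 - s) u := by
  obtain ⟨h0, h1, C, D, σ, τ, hm, hs, hσ, hτ, hst, e, rfl⟩ := h
  exact ⟨by linarith, by linarith, C, D, σ, τ, hm, hs, hσ, hτ, hst,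
    by rw [← e, sub_sub_cancel, add_comm], by ring⟩

/-- The first side of a triangle met on the way from its side `C D` to `A`. -/
lemma exists_exit_param {C D E A : ℂ} {σ τ c d e : ℝ} (hσ : 0 < σ) (hτ : 0 < τ) (hst : σ + τ = 1)
    (hsum : c + d + e = 1) (hA : A = c • C + d • D + e • E)
    (hneg : c < 0 ∨ d < 0) : ∃ t γ δ : ℝ, 0 < t ∧ t < 1 ∧ 0 ≤ γ ∧ 0 ≤ δ ∧ γ * δ = 0 ∧
      γ + δ + t * e = 1 ∧ (1 - t) • (σ • C + τ • D) + t • A = γ • C + δ • D + (t * e) • E := by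
  have comb : ∀ t : ℝ, (1 - t) • (σ • C + τ • D) + t • A
      = ((1 - t) * σ + t * c) • C + ((1 - t) * τ + t * d) • D + (t * e) • E := by
    intro t
    rw [hA]
    simp only [smul_add, add_smul, smul_smul]
    abel
  have hs : ∀ t : ℝ, (1 - t) * σ + t * c + ((1 - t) * τ + t * d) + t * e = 1 := by
    intro t; linear_combination (1 - t) * hst + t * hsum
  wlog hcd : c * τ ≤ d * σ generalizing C D σ τ c d
  · obtain ⟨t, γ, δ, h0, h1, hγ, hδ, hγδ, hsum', e'⟩ := this (C := D) (D := C) hτ hσ (by linarith)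
      (by linarith) (by rw [hA, add_comm (c • C)]) hneg.symm
      (fun t => by rw [add_comm (τ • D), comb, add_comm (((1 - t) * σ + t * c) • C)])
      (fun t => by linarith [hs t]) (by linarith)
    exact ⟨t, δ, γ, h0, h1, hδ, hγ, by linarith, by linarith,
      by rw [add_comm (σ • C), e', add_comm (γ • D)]⟩
  have hc : c < 0 := by
    rcases hneg with h | h
    · exact h
    · by_contra hc
      nlinarith [mul_nonneg (not_lt.1 hc) hτ.le, mul_neg_of_neg_of_pos h hσ]
  have hpos : 0 < σ - c := by linarith
  have h0 : (1 - σ / (σ - c)) * σ + σ / (σ - c) * c = 0 := by field_simp; ring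
  -- At this parameter the coordinate at `C` vanishes; by `hcd` the coordinate at `D` is still
  -- nonnegative.
  refine ⟨σ / (σ - c), _, _, by positivity, (div_lt_one hpos).2 (by linarith), h0.ge, ?_, ?_,
    hs _, comb _⟩
  · rw [show (1 - σ / (σ - c)) * τ + σ / (σ - c) * d = (d * σ - c * τ) / (σ - c) by
      field_simp; ring]
    exact div_nonneg (by linarith) hpos.le
  · rw [h0, zero_mul]

/-- From a crossing with `C D`, the way towards `A` passes through the triangle until it crosses
another side or ends at `A = E`. The exit is recorded in the coordinates of the triangle, so that
its height can be compared with the affine function over it. -/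
lemma exists_exit (ha : a ≠ 0) (hT : IsNonCrossing a S T) {A B C D E : ℂ} (hA : proj a A ∈ S)
    (hopen : ∀ z ∈ openSegment ℝ A B, proj a z ∉ S) (hE : IsTriangle a S T C D E)
    (hside : 0 < ori C D A * ori C D E) {s σ τ : ℝ} (hs0 : 0 < s) (hs1 : s < 1) (hσ : 0 < σ)
    (hτ : 0 < τ) (hst : σ + τ = 1) (hz : (1 - s) • A + s • B = σ • C + τ • D) :
    ∃ s' u' γ δ ε : ℝ, 0 ≤ s' ∧ s' < s ∧ 0 < ε ∧ γ + δ + ε = 1 ∧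
      (1 - s') • A + s' • B = γ • C + δ • D + ε • E ∧
      u' = γ * w C + δ * w D + ε * w E - ((1 - s') * w A + s' * w B) ∧
      ((s' = 0 ∧ u' = 0) ∨ Crosses a w T A B s' u') := by
  have hES := hT.proj_right_mem hE.mem_BC
  obtain ⟨c, d, e, hsum, hb⟩ := exists_bary hE.ori_ne A
  have he : 0 < e := by
    rw [ori_of_bary hsum hb, mul_assoc] at hside
    exact (pos_iff_pos_of_mul_pos hside).2 (mul_self_pos.2 hE.ori_ne)
  by_cases hneg : c < 0 ∨ d < 0
  · obtain ⟨t, γ, δ, ht0, ht1, hγ, hδ, hγδ, hsum', e'⟩ :=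
      exists_exit_param hσ hτ hst hsum hb hneg
    have hpar : (1 - (1 - t) * s) • A + ((1 - t) * s) • B = γ • C + δ • D + (t * e) • E := by
      rw [← e', ← hz]
      simp only [smul_add, smul_smul]
      rw [show 1 - (1 - t) * s = (1 - t) * (1 - s) + t by ring, add_smul]
      abel
    have hsp : 0 < (1 - t) * s := mul_pos (by linarith) hs0
    have hsl : (1 - t) * s < s := by nlinarith
    have hte : 0 < t * e := mul_pos ht0 he
    refine ⟨(1 - t) * s, _, γ, δ, t * e, hsp.le, hsl, hte, hsum', hpar, rfl,
      Or.inr ⟨hsp, by linarith, ?_⟩⟩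
    have hmem : γ • C + δ • D + (t * e) • E ∈ openSegment ℝ A B :=
      ⟨_, _, by linarith, hsp, by ring, hpar⟩
    have hnS := hopen _ hmem
    rcases mul_eq_zero.1 hγδ with rfl | rfl
    · have hδ' : 0 < δ := by
        refine hδ.lt_of_ne ?_
        rintro rfl
        obtain h1 : t * e = 1 := by linarith
        rw [h1] at hnS
        simp only [zero_smul, zero_add, one_smul] at hnS
        exact hnS hES
      exact ⟨D, E, δ, t * e, hE.mem_BC, hE.shortest_BC, hδ', hte, by linarith,
        by rw [hpar, zero_smul, zero_add], by ring⟩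
    · have hγ' : 0 < γ := by
        refine hγ.lt_of_ne ?_
        rintro rfl
        obtain h1 : t * e = 1 := by linarith
        rw [h1] at hnS
        simp only [zero_smul, zero_add, one_smul] at hnS
        exact hnS hES
      exact ⟨E, C, t * e, γ, hE.mem_CA, hE.shortest_CA, hte, hγ', by linarith,
        by rw [hpar, zero_smul, add_zero, add_comm], by ring⟩
  · simp only [not_or, not_lt] at hneg
    obtain ⟨hc, hd⟩ := hneg
    have hAE : A = E := by
      have hA1 : A ∉ interior (convexHull ℝ {C, D, E}) := fun h =>
        hE.notMem_skeleton h (Or.inl hA)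
      rw [mem_interior_triangle hE.ori_ne] at hA1
      rcases hc.eq_or_lt with rfl | hc
      · have hseg : A ∈ segment ℝ D E := ⟨d, e, hd, he.le, by linarith, by rw [hb]; simp⟩
        rcases hT.eq_end ha hE.shortest_BC hE.mem_BC hseg hA with h | h
        · rw [h, ori_right, zero_mul] at hside
          exact absurd hside (lt_irrefl _)
        · exact h
      rcases hd.eq_or_lt with rfl | hd
      · have hseg : A ∈ segment ℝ E C := ⟨e, c, he.le, hc.le, by linarith,
          by rw [hb]; simp [add_comm]⟩
        rcases hT.eq_end ha hE.shortest_CA hE.mem_CA hseg hA with h | h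
        · exact h
        · rw [h, ori_left, zero_mul] at hside
          exact absurd hside (lt_irrefl _)
      exact absurd ⟨c, d, e, hc, hd, he, hsum, hb⟩ hA1
    subst hAE
    exact ⟨0, 0, 0, 0, 1, le_rfl, hs0, one_pos, by norm_num, by simp, by ring, Or.inl ⟨rfl, rfl⟩⟩

/-- Only lifts with ends horizontally within 1 of `A` can be met, and by transversality each meets
`A B` at one parameter. -/
lemma finite_crosses (ha : a ≠ 0) (hS : S.Finite) (hT : IsNonCrossing a S T) {A B : ℂ}
    (sAB : IsShortest a A B)
    (htr : ∀ C D, edge a C D ∈ T → IsShortest a C D →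
      (openSegment ℝ A B ∩ openSegment ℝ C D).Nonempty → ori C D A ≠ 0) :
    {q : ℝ × ℝ | Crosses a w T A B q.1 q.2}.Finite := by
  have hK := finite_bounded_lifts (S := S) ha hS (|hor a A| + 1)
  refine ((hK.prod hK).biUnion (t := fun p : ℂ × ℂ => {q : ℝ × ℝ | 0 < q.1 ∧ q.1 < 1 ∧
    ori p.1 p.2 A ≠ 0 ∧ ∃ σ τ : ℝ, σ + τ = 1 ∧ (1 - q.1) • A + q.1 • B = σ • p.1 + τ • p.2 ∧
    q.2 = σ * w p.1 + τ * w p.2 - ((1 - q.1) * w A + q.1 * w B)}) fun p _ => ?_).subset ?_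
  · apply Set.Subsingleton.finite
    rintro ⟨s, u⟩ ⟨hs, hs1, ho, σ, τ, hst, e, hu⟩ ⟨s', u'⟩ ⟨hs', hs1', -, σ', τ', hst', e', hu'⟩
    dsimp only at *
    have k1 : (1 - s) * ori p.1 p.2 A + s * ori p.1 p.2 B = 0 := by
      rw [← ori_two _ _ _ _ (by ring), e, ori_two _ _ _ _ hst, ori_left, ori_right]; ring
    have k2 : (1 - s') * ori p.1 p.2 A + s' * ori p.1 p.2 B = 0 := by
      rw [← ori_two _ _ _ _ (by ring), e', ori_two _ _ _ _ hst', ori_left, ori_right]; ring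
    obtain rfl : s = s' := by
      have : (s' - s) * ori p.1 p.2 A = 0 := by linear_combination s' * k1 - s * k2
      rcases mul_eq_zero.1 this with h | h
      · linarith
      · exact absurd h ho
    have := bary_unique ho (α := σ) (β := τ) (γ := 0) (α' := σ') (β' := τ') (γ' := 0)
      (by linarith) (by linarith) (by rw [← e, ← e'])
    rw [hu, hu', this.1, this.2.1]
  · rintro ⟨s, u⟩ ⟨hs, hs1, C, D, σ, τ, hm, sCD, hσ, hτ, hst, e, hu⟩
    have hz : (1 - s) • A + s • B ∈ openSegment ℝ A B := ⟨_, _, by linarith, hs, by ring, rfl⟩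
    have hz' : (1 - s) • A + s • B ∈ openSegment ℝ C D := ⟨_, _, hσ, hτ, hst, e.symm⟩
    have hzs := openSegment_subset_segment ℝ C D hz'
    have h1 := abs_lt.1 (sAB.hor_lt ha (openSegment_subset_segment ℝ A B hz))
    have h2 := abs_lt.1 (sCD.hor_lt ha hzs)
    have h3 := abs_lt.1 ((sCD.symm ha).hor_lt ha (segment_symm ℝ C D ▸ hzs))
    have h4 := neg_abs_le (hor a A)
    have h5 := le_abs_self (hor a A)
    refine mem_iUnion₂.2 ⟨(C, D), ⟨⟨hT.proj_left_mem hm, ?_⟩, hT.proj_right_mem hm, ?_⟩, hs, hs1,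
      htr C D hm sCD ⟨_, hz, hz'⟩, σ, τ, hst, e, hu⟩
    · rw [abs_le]; constructor <;> linarith
    · rw [abs_le]; constructor <;> linarith

/-- The lifted surface of an optimal triangulation is below each segment that crosses only
inner segments. -/
lemma IsOptimal.crosses_nonpos (h : IsOptimal a S w T) (hw : IsWeight a S w) (ha : a ≠ 0)
    (hS : S.Finite) (hT : IsNonCrossing a S T) {A B : ℂ} (sAB : IsShortest a A B)
    (hA : proj a A ∈ S) (hB : proj a B ∈ S) (hopen : ∀ z ∈ openSegment ℝ A B, proj a z ∉ S)
    (htr : ∀ C D, edge a C D ∈ T → IsShortest a C D →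
      (openSegment ℝ A B ∩ openSegment ℝ C D).Nonempty → ori C D A ≠ 0)
    (hside : ∀ C D, edge a C D ∈ T → IsShortest a C D →
      (openSegment ℝ A B ∩ openSegment ℝ C D).Nonempty →
      ∃ E, IsTriangle a S T C D E ∧ 0 < ori C D E)
    {s u : ℝ} (hsu : Crosses a w T A B s u) : u ≤ 0 := by
  by_contra hu
  rw [not_le] at hu
  have hfin := finite_crosses (w := w) ha hS hT sAB htr
  -- Discrete maximum principle: among the crossings of maximal excess take the one closest to `A`.
  -- The neighbour towards `A` has strictly smaller excess and the neighbour towards `B` no larger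
  -- one, which contradicts convexity across the crossed segment.
  obtain ⟨⟨s₁, M⟩, hM, hmax⟩ := Set.exists_max_image _ Prod.snd hfin ⟨(s, u), hsu⟩
  have hMpos : 0 < M := hu.trans_le (hmax (s, u) hsu)
  have hfin' := hfin.subset (sep_subset {q : ℝ × ℝ | Crosses a w T A B q.1 q.2} fun q => q.2 = M)
  obtain ⟨⟨s₀, M'⟩, ⟨hM', rfl⟩, hmin⟩ := Set.exists_min_image _ Prod.fst hfin' ⟨(s₁, M), hM, rfl⟩
  replace hmax : ∀ b ∈ {q : ℝ × ℝ | Crosses a w T A B q.1 q.2}, b.2 ≤ M' := hmax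
  obtain ⟨hs0, hs1, C, D, σ, τ, hm, sCD, hσ, hτ, hst, e, hMe⟩ := hM'
  dsimp only at hs0 hs1 e hMe
  have hne : (openSegment ℝ A B ∩ openSegment ℝ C D).Nonempty :=
    ⟨(1 - s₀) • A + s₀ • B, ⟨_, _, by linarith, hs0, by ring, rfl⟩, _, _, hσ, hτ, hst, e.symm⟩
  wlog hpos : 0 < ori C D A generalizing C D σ τ
  · refine this D C τ σ (edge_comm C D ▸ hm) (sCD.symm ha) hτ hσ (by linarith)
      (by rw [e, add_comm]) (by rw [hMe]; ring) (by rwa [openSegment_symm ℝ D C]) ?_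
    rw [ori_swap]
    have := htr C D hm sCD hne
    have := lt_of_le_of_ne (not_lt.1 hpos) this
    linarith
  obtain ⟨E, hE, hEpos⟩ := hside C D hm sCD hne
  obtain ⟨F, hF, hFpos⟩ := hside D C (edge_comm C D ▸ hm) (sCD.symm ha)
    (by rwa [openSegment_symm ℝ D C])
  replace hF := hF.swap ha
  rw [ori_swap, neg_pos] at hFpos
  have hBneg : ori C D B < 0 := by
    have k1 : (1 - s₀) * ori C D A + s₀ * ori C D B = 0 := by
      rw [← ori_two _ _ _ _ (by ring), e, ori_two _ _ _ _ hst, ori_left, ori_right]; ring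
    by_contra hc
    nlinarith [mul_nonneg hs0.le (not_lt.1 hc), mul_pos (sub_pos.2 hs1) hpos]
  obtain ⟨s', u', γ, δ, ε, hs'0, hs's, hε, hsum, hz, hu', hcase⟩ :=
    exists_exit (w := w) ha hT hA hopen hE (mul_pos hpos hEpos) hs0 hs1 hσ hτ hst e
  obtain ⟨r, u'', γ', δ', φ, hr0, hrs, hφ, hsum', hz', hu'', hcase'⟩ :=
    exists_exit (w := w) ha hT hB (by rwa [openSegment_symm]) hF (mul_pos_of_neg_of_neg hBneg hFpos)
      (s := 1 - s₀) (by linarith) (by linarith) hσ hτ hst (by rw [← e, sub_sub_cancel, add_comm])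
  have hu'M : u' < M' := by
    rcases hcase with ⟨-, h0⟩ | hc
    · rwa [h0]
    · refine lt_of_le_of_ne (hmax (s', u') hc) fun heq => ?_
      exact absurd (hmin (s', u') ⟨hc, heq⟩) (not_le.2 hs's)
  have hu''M : u'' ≤ M' := by
    rcases hcase' with ⟨-, h0⟩ | hc
    · rw [h0]; exact hMpos.le
    · exact hmax (1 - r, u'') hc.symm
  obtain ⟨c, d, f, hcdf, hb⟩ := exists_bary hE.ori_ne F
  have hf : f < 0 := by
    rw [ori_of_bary hcdf hb] at hFpos
    by_contra hc
    exact absurd hFpos (not_lt.2 (mul_nonneg (not_lt.1 hc) hEpos.le))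
  have hconv := h.le_apex hw ha hT hE hF hcdf hf hb
  set k := 1 - r - s' with hk
  have hkpos : 0 < k := by linarith
  set x := (1 - r - s₀) / k with hx
  set y := (s₀ - s') / k with hy
  have hxpos : 0 < x := div_pos (by linarith) hkpos
  have hypos : 0 < y := div_pos (by linarith) hkpos
  have hxy : x + y = 1 := by rw [hx, hy, ← add_div, div_eq_one_iff_eq hkpos.ne']; ring
  have hpar : s₀ = x * s' + y * (1 - r) := by
    rw [hx, hy]; field_simp; ring
  have hcomb : σ • C + τ • D + (0 : ℝ) • E = (x * γ + y * (γ' + φ * c)) • C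
      + (x * δ + y * (δ' + φ * d)) • D + (x * ε + y * (φ * f)) • E := by
    have e1 : (1 - s₀) • A + s₀ • B
        = x • ((1 - s') • A + s' • B) + y • ((1 - r) • B + r • A) := by
      have : 1 - s₀ = x * (1 - s') + y * r := by rw [hpar]; linear_combination -hxy
      rw [this, hpar]
      simp only [smul_add, add_smul, smul_smul]
      abel
    rw [zero_smul, add_zero, ← e, e1, hz, hz', hb]
    simp only [smul_add, add_smul, mul_smul]
    abel
  -- Both neighbours are written in the coordinates of `C D E`. The affine function through the
  -- lifts of `C`, `D`, `E` is exact at the crossing and towards `A`; towards `B` it does not exceed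
  -- the surface, by `hconv`.
  obtain ⟨i1, i2, i3⟩ := bary_unique hE.ori_ne (by linarith)
    (by linear_combination x * hsum + y * hsum' + y * φ * hcdf + hxy) hcomb
  have hineq : M' + ((1 - s₀) * w A + s₀ * w B)
      ≤ x * (u' + ((1 - s') * w A + s' * w B)) + y * (u'' + ((1 - r) * w B + r * w A)) := by
    have e2 : M' + ((1 - s₀) * w A + s₀ * w B) = x * (γ * w C + δ * w D + ε * w E)
        + y * (γ' * w C + δ' * w D + φ * (c * w C + d * w D + f * w E)) := by
      rw [hMe, sub_add_cancel, i1, i2]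
      linear_combination w E * i3
    rw [e2, hu', hu'', sub_add_cancel, sub_add_cancel]
    have := mul_le_mul_of_nonneg_left hconv hφ.le
    gcongr
  have e3 : (1 - s₀) * w A + s₀ * w B
      = x * ((1 - s') * w A + s' * w B) + y * ((1 - r) * w B + r * w A) := by
    rw [hpar]; linear_combination -(w A) * hxy
  nlinarith [mul_lt_mul_of_pos_left hu'M hxpos, mul_le_mul_of_nonneg_left hu''M hypos.le]


/-! ### Crossing segments -/

lemma exists_param_of_ori_eq_zero {C D A : ℂ} (hne : C ≠ D) (h : ori C D A = 0) :
    ∃ x : ℝ, A = (1 - x) • C + x • D := by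
  have hN : Complex.normSq (D - C) ≠ 0 := (Complex.normSq_pos.2 (sub_ne_zero.2 hne.symm)).ne'
  obtain ⟨x, hx⟩ : ∃ x : ℝ, x * Complex.normSq (D - C)
      = (A - C).re * (D - C).re + (A - C).im * (D - C).im := ⟨_, div_mul_cancel₀ _ hN⟩
  refine ⟨x, Complex.ext (mul_left_cancel₀ hN ?_) (mul_left_cancel₀ hN ?_)⟩
  all_goals
    simp only [Complex.normSq_apply, ori, Complex.sub_re, Complex.sub_im, Complex.add_re,
      Complex.add_im, Complex.real_smul, Complex.re_ofReal_mul, Complex.im_ofReal_mul] at *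
  · linear_combination (-(D.re - C.re)) * hx - (D.im - C.im) * h
  · linear_combination (-(D.im - C.im)) * hx + (D.re - C.re) * h

/-- Collinear segments without further points of a set that overlap agree. -/
lemma eq_of_ori_eq_zero {A B C D z : ℂ} {V : Set ℂ} (hA : A ∈ V) (hB : B ∈ V) (hC : C ∈ V)
    (hD : D ∈ V) (hAB : ∀ z ∈ openSegment ℝ A B, z ∉ V) (hCD : ∀ z ∈ openSegment ℝ C D, z ∉ V)
    (hne : C ≠ D) (hz : z ∈ openSegment ℝ A B) (hz' : z ∈ openSegment ℝ C D)
    (h : ori C D A = 0) : (A = C ∧ B = D) ∨ (A = D ∧ B = C) := by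
  obtain ⟨x, hx⟩ := exists_param_of_ori_eq_zero hne h
  obtain ⟨l, m, hl, hm, hlm, rfl⟩ := hz
  have hzo : ori C D (l • A + m • B) = 0 := by
    obtain ⟨s, t, -, -, hst, e⟩ := hz'
    rw [← e, ori_two _ _ _ _ hst, ori_left, ori_right]; ring
  have hB0 : ori C D B = 0 := by
    rw [ori_two _ _ _ _ hlm, h, mul_zero, zero_add] at hzo
    exact (mul_eq_zero.1 hzo).resolve_left hm.ne'
  obtain ⟨y, hy⟩ := exists_param_of_ori_eq_zero hne hB0
  have inj : ∀ {p q : ℝ}, (1 - p) • C + p • D = (1 - q) • C + q • D → p = q := by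
    intro p q e
    have : (p - q) • (D - C) = 0 := by
      have : (p - q) • (D - C) = ((1 - p) • C + p • D) - ((1 - q) • C + q • D) := by
        simp only [sub_smul, smul_sub, one_smul]; abel
      rw [this, e, sub_self]
    rcases smul_eq_zero.1 this with h | h
    · linarith
    · exact absurd (sub_eq_zero.1 h).symm hne
  have comb : ∀ l m : ℝ, l + m = 1 →
      l • A + m • B = (1 - (l * x + m * y)) • C + (l * x + m * y) • D := by
    intro l m hlm
    rw [hx, hy, show 1 - (l * x + m * y) = l * (1 - x) + m * (1 - y) by linear_combination -hlm]
    simp only [smul_add, add_smul, smul_smul]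
    abel
  have hr : 0 < l * x + m * y ∧ l * x + m * y < 1 := by
    obtain ⟨s, t, hs, ht, hst, e⟩ := hz'
    have : t = l * x + m * y := inj (by rw [← comb l m hlm, ← e, ← hst, add_sub_cancel_right])
    rw [← this]; constructor <;> linarith
  have hout : ∀ {p : ℝ} {P : ℂ}, P ∈ V → P = (1 - p) • C + p • D → p ≤ 0 ∨ 1 ≤ p := by
    intro p P hP e
    by_contra hc
    simp only [not_or, not_le] at hc
    exact hCD P ⟨1 - p, p, by linarith, hc.1, by ring, e.symm⟩ hP
  -- On the common line, `A` and `B` lie outside the open segment on opposite sides. If `x < 0` or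
  -- `1 < y`, then `C` or `D` would be an inner point of `A B`.
  have main : ∀ {A B : ℂ} {x y : ℝ}, A ∈ V → B ∈ V → (∀ z ∈ openSegment ℝ A B, z ∉ V) →
      (∀ l m : ℝ, l + m = 1 →
        l • A + m • B = (1 - (l * x + m * y)) • C + (l * x + m * y) • D) →
      x ≤ 0 → 1 ≤ y → A = C ∧ B = D := by
    intro A B x y hA hB hAB comb hx0 hy1
    have hyx : 0 < y - x := by linarith
    have hx' : x = 0 := by
      refine hx0.eq_of_not_lt fun hlt => hAB C ⟨y / (y - x), -x / (y - x), div_pos (by linarith) hyx,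
        div_pos (by linarith) hyx, by field_simp; ring, ?_⟩ hC
      rw [comb _ _ (by field_simp; ring),
        show y / (y - x) * x + -x / (y - x) * y = 0 by field_simp; ring]
      simp
    have hy' : y = 1 := by
      refine hy1.eq_of_not_lt' fun hlt => hAB D ⟨(y - 1) / (y - x), (1 - x) / (y - x),
        div_pos (by linarith) hyx, div_pos (by linarith) hyx, by field_simp; ring, ?_⟩ hD
      rw [comb _ _ (by field_simp; ring),
        show (y - 1) / (y - x) * x + (1 - x) / (y - x) * y = 1 by field_simp; ring]
      simp
    have e1 := comb 1 0 (by norm_num)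
    have e2 := comb 0 1 (by norm_num)
    rw [hx', hy'] at e1 e2
    simp only [one_smul, zero_smul, add_zero, zero_add, mul_zero, mul_one, sub_zero, sub_self]
      at e1 e2
    exact ⟨e1, e2⟩
  rcases hout hA hx with h1 | h1 <;> rcases hout hB hy with h2 | h2
  · nlinarith
  · exact Or.inl (main hA hB hAB comb h1 h2)
  · refine Or.inr (main hB hA (by rwa [openSegment_symm]) (fun l m h => ?_) h2 h1).symm
    rw [add_comm, comb m l (by linarith), add_comm (m * x)]
  · nlinarith

/-- Since neither segment has inner points in `S`, a degenerate triangle would make the two segments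
collinear and equal. -/
lemma quad_of_cross (ha : a ≠ 0) (hT : IsNonCrossing a S T) (hT' : IsNonCrossing a S T')
    {A B C D : ℂ} (sAB : IsShortest a A B) (hAB : edge a A B ∈ T) (sCD : IsShortest a C D)
    (hCD : edge a C D ∈ T') (hne : edge a A B ≠ edge a C D)
    (hx : (openSegment ℝ A B ∩ openSegment ℝ C D).Nonempty) : Quad A B C D := by
  obtain ⟨z, hz, hz'⟩ := hx
  have hA := hT.proj_left_mem hAB
  have hB := hT.proj_right_mem hAB
  have hC := hT'.proj_left_mem hCD
  have hD := hT'.proj_right_mem hCD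
  have h1 := fun z hz => hT.openSegment_notMem ha (z := z) sAB hAB hz
  have h2 := fun z hz => hT'.openSegment_notMem ha (z := z) sCD hCD hz
  have key : ¬((C = A ∧ D = B) ∨ (C = B ∧ D = A)) := by
    rintro (⟨rfl, rfl⟩ | ⟨rfl, rfl⟩)
    · exact hne rfl
    · exact hne (edge_comm _ _)
  refine ⟨fun h => key ?_, fun h => key ?_, z, hz, hz'⟩
  · exact eq_of_ori_eq_zero (V := {z | proj a z ∈ S}) hC hD hA hB h2 h1 (hT.ne ha sAB hAB)
      hz' hz h
  · have := eq_of_ori_eq_zero (V := {z | proj a z ∈ S}) hD hC hA hB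
      (by rw [openSegment_symm]; exact h2) h1 (hT.ne ha sAB hAB)
      (by rwa [openSegment_symm]) hz h
    tauto

lemma IsNonCrossing.not_quad (hT : IsNonCrossing a S T) (ha : a ≠ 0) {A B C D : ℂ}
    (sAB : IsShortest a A B) (hAB : edge a A B ∈ T) (sCD : IsShortest a C D)
    (hCD : edge a C D ∈ T) (hq : Quad A B C D) : False := by
  obtain ⟨p, hp, hp'⟩ := hq.cross
  have h2 := hq.symm.ori₁
  have h3 := hq.symm.ori₂
  rcases hT.meet ha sAB hAB sCD hCD (openSegment_subset_segment ℝ _ _ hp)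
    (openSegment_subset_segment ℝ _ _ hp') with (⟨rfl, -⟩ | ⟨rfl, -⟩) | ⟨h1 | h1, -⟩
  · exact h2 (ori_left _ _)
  · exact h3 (ori_left _ _)
  · exact ne_left_of_mem_openSegment (hT.ne ha sAB hAB) hp h1
  · exact ne_right_of_mem_openSegment (hT.ne ha sAB hAB) hp h1

/-- A segment that is not in a maximal set of non-crossing segments crosses one of them. -/
lemma exists_quad_of_notMem (ha : a ≠ 0) (hT : IsNonCrossing a S T)
    (hT' : Maximal (IsNonCrossing a S) T') {e : Sym2 (Cylinder a)} (he : e ∈ T) (he' : e ∉ T') :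
    ∃ A B C D : ℂ, edge a A B = e ∧ IsShortest a A B ∧ edge a C D ∈ T' ∧ IsShortest a C D ∧
      Quad A B C D := by
  by_contra hcon
  have hx : ∀ f ∈ T', ∀ p ∈ carrier a e, p ∈ carrier a f → p ∈ e ∧ p ∈ f := by
    intro f hf p hpe hpf
    obtain ⟨z, rfl⟩ := QuotientAddGroup.mk_surjective p
    obtain ⟨A, B, -, sAB, rfl, hz⟩ := exists_lift ha (hT.isSegment e he) hpe
    obtain ⟨C, D, -, sCD, rfl, hz'⟩ := exists_lift ha (hT'.prop.isSegment f hf) hpf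
    have hzS : proj a z ∈ S := by
      rcases ends_or_openSegment hz with rfl | rfl | hz
      · exact hT.proj_left_mem he
      · exact hT.proj_right_mem he
      rcases ends_or_openSegment hz' with rfl | rfl | hz'
      · exact hT'.prop.proj_left_mem hf
      · exact hT'.prop.proj_right_mem hf
      exact absurd ⟨A, B, C, D, rfl, sAB, hf, sCD, quad_of_cross ha hT hT'.prop sAB he sCD hf
        (fun h => he' (h ▸ hf)) ⟨z, hz, hz'⟩⟩ hcon
    exact ⟨hT.inter_points _ he _ hpe hzS, hT'.prop.inter_points _ hf _ hpf hzS⟩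
  have hins : IsNonCrossing a S (insert e T') := by
    constructor
    · rintro f (rfl | hf)
      · exact hT.isSegment _ he
      · exact hT'.prop.isSegment f hf
    · rintro f (rfl | hf)
      · exact hT.ends_mem _ he
      · exact hT'.prop.ends_mem f hf
    · rintro f (rfl | hf)
      · exact hT.inter_points _ he
      · exact hT'.prop.inter_points f hf
    · rintro f (rfl | hf) g (rfl | hg) hne p hpf hpg
      · exact absurd rfl hne
      · exact hx g hg p hpf hpg
      · exact (hx f hf p hpg hpf).symm
      · exact hT'.prop.inter_segments f hf g hg hne p hpf hpg
  exact he' (hT'.2 hins (subset_insert _ _) (mem_insert _ _))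

/-! ### Uniqueness of the optimal triangulation -/

/-- Boundary segments of `T'` belong to `T` and so cannot cross `A B`. Every segment of `T'` crossed
by `A B` therefore has triangles on both sides, as `IsOptimal.crosses_nonpos` requires. -/
lemma IsOptimal.le_of_cross (ha : a ≠ 0) (hS : S.Finite) (hw : IsWeight a S w)
    (hT : IsNonCrossing a S T) (hT' : IsTriangulation a S T') (h : IsOptimal a S w T')
    (hup : boundary a S (Upward a) T' ⊆ T) (hdown : boundary a S (Downward a) T' ⊆ T)
    {A B C D : ℂ} (sAB : IsShortest a A B) (hAB : edge a A B ∈ T) (sCD : IsShortest a C D)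
    (hCD : edge a C D ∈ T') (hq : Quad A B C D) {l m s t : ℝ} (hl : 0 < l) (hm : 0 < m)
    (hs : 0 < s) (ht : 0 < t) (hlm : l + m = 1) (hst : s + t = 1)
    (e : l • A + m • B = s • C + t • D) : s * w C + t * w D ≤ l * w A + m * w B := by
  have hnc := hT'.maximal.prop
  have he : edge a A B ∉ T' := fun hc => hnc.not_quad ha sAB hc sCD hCD hq
  have hquad : ∀ C D, edge a C D ∈ T' → IsShortest a C D →
      (openSegment ℝ A B ∩ openSegment ℝ C D).Nonempty → Quad A B C D :=
    fun C D hCD sCD hx => quad_of_cross ha hT hnc sAB hAB sCD hCD (fun hc => he (hc ▸ hCD)) hx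
  have := h.crosses_nonpos hw ha hS hnc sAB (hT.proj_left_mem hAB) (hT.proj_right_mem hAB)
    (fun z hz => hT.openSegment_notMem ha sAB hAB hz)
    (fun C D hCD sCD hx => (hquad C D hCD sCD hx).symm.ori₁)
    (fun C D hCD sCD hx => hT'.exists_triangle ha hS sCD hCD
      (fun hc => hT.not_quad ha sAB hAB sCD (hup hc) (hquad C D hCD sCD hx))
      (fun hc => hT.not_quad ha sAB hAB sCD (hdown hc) (hquad C D hCD sCD hx)))
    (s := m) (u := s * w C + t * w D - ((1 - m) * w A + m * w B))
    ⟨hm, by linarith, C, D, s, t, hCD, sCD, hs, ht, hst,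
      by rw [← e, ← hlm, add_sub_cancel_right], rfl⟩
  obtain rfl : l = 1 - m := by linarith
  linarith

/-- At a crossing of a segment of `T` with one of `T'`, optimality of each gives the two opposite
inequalities between the heights; equality is excluded by `IsWeight.ne`. -/
lemma IsOptimal.subset (ha : a ≠ 0) (hS : S.Finite) (hw : IsWeight a S w)
    (hT : IsTriangulation a S T) (hT' : IsTriangulation a S T')
    (h : IsOptimal a S w T) (h' : IsOptimal a S w T')
    (hup : boundary a S (Upward a) T = boundary a S (Upward a) T')
    (hdown : boundary a S (Downward a) T = boundary a S (Downward a) T') : T ⊆ T' := by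
  intro e he
  by_contra he'
  have hT₁ := hT.maximal.prop
  have hT₂ := hT'.maximal.prop
  obtain ⟨A, B, C, D, rfl, sAB, hCD, sCD, hq⟩ := exists_quad_of_notMem ha hT₁ hT'.maximal he he'
  obtain ⟨l, m, s, t, hl, hm, hs, ht, hlm, hst, e⟩ := hq.exists_coeff
  have h1 := h'.le_of_cross ha hS hw hT₁ hT' (hup ▸ sep_subset _ _) (hdown ▸ sep_subset _ _)
    sAB he sCD hCD hq hl hm hs ht hlm hst e
  have h2 := h.le_of_cross ha hS hw hT₂ hT (hup ▸ sep_subset _ _) (hdown ▸ sep_subset _ _)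
    sCD hCD sAB he hq.symm hs ht hl hm hst hlm e.symm
  exact hw.ne (hT₁.proj_left_mem he) (hT₁.proj_right_mem he) (hT₂.proj_left_mem hCD)
    (hT₂.proj_right_mem hCD) sAB sCD hq hl hm hs ht hlm hst e (le_antisymm h2 h1)

end FlatCylinder

/-! ### The components of the flip graph -/

theorem theorem4p3 (a : ℂ) (ha : a ≠ 0) (S : Set (FlatCylinder.Cylinder a)) (hS : S.Finite)
    (T₁ T₂ : FlatCylinder.Triangulation a S) :
    (FlatCylinder.flipGraph a S).Reachable T₁ T₂ ↔
      FlatCylinder.upperBoundary a S T₁.1 = FlatCylinder.upperBoundary a S T₂.1 ∧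
        FlatCylinder.lowerBoundary a S T₁.1 = FlatCylinder.lowerBoundary a S T₂.1 := by
  open FlatCylinder in
  constructor
  · exact fun h => ⟨boundary_eq_of_reachable ha h (isOuter_upward ha),
      boundary_eq_of_reachable ha h (isOuter_downward ha)⟩
  · rintro ⟨hup, hdown⟩
    obtain ⟨w, hw⟩ := exists_isWeight ha hS
    obtain ⟨T₁', h₁, o₁⟩ := exists_reachable_isOptimal ha hS hw T₁
    obtain ⟨T₂', h₂, o₂⟩ := exists_reachable_isOptimal ha hS hw T₂
    have hup' : boundary a S (Upward a) T₁'.1 = boundary a S (Upward a) T₂'.1 := by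
      rw [← boundary_eq_of_reachable ha h₁ (isOuter_upward ha),
        ← boundary_eq_of_reachable ha h₂ (isOuter_upward ha)]
      exact hup
    have hdown' : boundary a S (Downward a) T₁'.1 = boundary a S (Downward a) T₂'.1 := by
      rw [← boundary_eq_of_reachable ha h₁ (isOuter_downward ha),
        ← boundary_eq_of_reachable ha h₂ (isOuter_downward ha)]
      exact hdown
    have heq : T₁' = T₂' := Subtype.ext <|
      (o₁.subset ha hS hw T₁'.2 T₂'.2 o₂ hup' hdown').antisymm
        (o₂.subset ha hS hw T₂'.2 T₁'.2 o₁ hup'.symm hdown'.symm)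
    exact h₁.trans (heq ▸ h₂.symm)
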